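/- **Setting.** Let $I=(t_0,t_f)$ with $t_0<t_f$, $x_0\in\mathbb R^{n_x}$, $y=(x,u,p)\in\mathbb R^{n_y}=\mathbb R^{n_x}\times\mathbb R^{n_u}\times\mathbb R^{n_p}$. For a component function $g(t,y)\in\mathbb R^{n_g}$ consider the optimal control problem $$\min_{x,u,p}\ \varphi(x(t_f),p)+\int_{t_0}^{t_f} l\big(t,y(t),g(t,y(t))\big)\,dt\quad\text{s.t.}\quad x'(t)=f\big(t,y(t),g(t,y(t))\big)\ \text{a.e. in } I,\quad x(t_0)=x_0,$$ with $y(t)=(x(t),u(t),p)\in Y^\infty:=W^{1,\infty}(I)^{n_x}\times L^\infty(I)^{n_u}\times\mathbb R^{n_p}$, and the quantity of interest $q(x,u,p;g)=\phi(x(t_f),p)+\int_{t_0}^{t_f}\ell(t,y(t),g(t,y(t)))\,dt$. The functions $g$ range over $\mathcal G^3$, the space of all $g:I\times\mathbb R^{n_y}\to\mathbb R^{n_g}$ that are $C^3$ in $y$ for a.a. $t$, measurable in $t$ for each $y$, and have finite norm $\sum_{n=0}^3\operatorname{ess\,sup}_t\sup_y\|\partial_y^n g(t,y)\|$. Let $Z^\infty=Y^\infty\times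 W^{1,\infty}(I)^{n_x}$. Below, $[t]$ denotes evaluation at $(t,y(t),g(t,y(t)))$ (for $g$ and its derivatives at $(t,y(t))$) and $[t_f]$ evaluation at $(x(t_f),p)$; subscripts $x,u,p,g$ denote partial derivatives. Write $$A=f_x+f_g g_x,\quad B=f_u+f_g g_u,\quad C=f_p+f_g g_p,\qquad \mathrm D_aL=\nabla_aL+g_a^T\nabla_gL\quad(a\in\{x,u,p\},\ L\in\{l,\ell\}).$$ The first-order optimality system for $z=(x,u,p,\lambda)\in Z^\infty$ with component function $g$ is: the state equation and initial condition above; $\lambda'=-A[t]^T\lambda-\mathrm D_xl[t]$ a.e.; $\lambda(t_f)=\nabla_x\varphi[t_f]$; $B[t]^T\lambda(t)+\mathrm D_ul[t]=0$ a.e.; $\nabla_p\varphi[t_f]+\int_{t_0}^{t_f}(C[t]^T\lambda(t)+\mathrm D_pl[t])\,dt=0$. **Assumptions.** 1. $\varphi$ and $\phi$ are $C^2$. Each $F\in\{f,l,\ell\}$ is measurable in $t$ for fixed $(y,g)$ and $C^2$ in $(y,g)$ for a.a. $t$; its $(y,g)$-derivatives of orders $0,1,2$ are bounded at $(y,g)=0$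 uniformly for a.a. $t$, and on every ball $\{\|(y,g)\|\le R\}$ they are Lipschitz in $(y,g)$ with a constant $L(R)$ independent of a.a. $t$. 2. $\bar g\in\mathcal G^3$, and $\bar z=(\bar x,\bar u,\bar p,\bar\lambda)\in Z^\infty$ satisfies the first-order optimality system with $g=\bar g$. From here on all coefficients are evaluated along $(\bar z,\bar g)$. 3. (Second-order sufficient condition.) Let $H(t,y,g)=l(t,y,g)+\bar\lambda(t)^Tf(t,y,g)$, $d[t]=\nabla_gH[t]=\nabla_gl[t]+f_g[t]^T\bar\lambda(t)$ and, for $a,b\in\{x,u,p\}$, $$\bar H_{ab}=\nabla^2_{ab}H+\nabla^2_{ag}H\,\bar g_b+\bar g_a^T\nabla^2_{gb}H+\bar g_a^T\nabla^2_{gg}H\,\bar g_b+\sum_{k=1}^{n_g}(\nabla_gH)_k\nabla^2_{ab}\bar g_k,\qquad \bar H_{ga}=\nabla^2_{ga}H+\nabla^2_{gg}H\,\bar g_a .$$ (i) The Hessian $\nabla^2_{(x,p)}\varphi[t_f]$ is positive semidefinite. (ii) There is $\epsilon>0$ such that the integral over $I$ of the quadratic form of the block matrix $(\bar H_{ab}[t])_{a,b\in\{x,u,p\}}$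 at $(\delta x(t),\delta u(t),\delta p)$ is at least $\epsilon(\|\delta x\|_{L^2}^2+\|\delta u\|_{L^2}^2+|\delta p|^2)$ for all $(\delta x,\delta u,\delta p)\in Y^2:=W^{1,2}(I)^{n_x}\times L^2(I)^{n_u}\times\mathbb R^{n_p}$ with $\delta x'=A\delta x+B\delta u+C\delta p$ a.e. and $\delta x(t_0)=0$. (iii) $\bar H_{uu}[t]$ is invertible for a.a. $t$, with inverse bounded uniformly in $t$. **Theorem.** There are open neighborhoods $N_g\ni\bar g$ in $\mathcal G^3$ and $N_z\ni\bar z$ in $Z^\infty$ such that for each $g\in N_g$ the optimality system has exactly one solution $z(g)=(x(g),u(g),p(g),\lambda(g))$ in $N_z$; the map $g\mapsto z(g)$ is continuously Fréchet differentiable on $N_g$, $z(\bar g)=\bar z$, and $\tilde q(g):=q(x(g),u(g),p(g);g)$ is continuously Fréchet differentiable on $N_g$. Moreover, the adjoint system $$\begin{aligned} &\widetilde{\delta x}'=A\widetilde{\delta x}+B\widetilde{\delta u}+C\widetilde{\delta p}\ \text{ a.e.},\qquad \widetilde{\delta x}(t_0)=0,\\ &\widetilde{\delta\lambda}'=-A^T\widetilde{\delta\lambda}-\bar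 H_{xx}\widetilde{\delta x}-\bar H_{xu}\widetilde{\delta u}-\bar H_{xp}\widetilde{\delta p}-\mathrm D_x\ell\ \text{ a.e.},\\ &\widetilde{\delta\lambda}(t_f)=\nabla_x\phi[t_f]+\nabla^2_{xx}\varphi[t_f]\widetilde{\delta x}(t_f)+\nabla^2_{xp}\varphi[t_f]\widetilde{\delta p},\\ &\bar H_{ux}\widetilde{\delta x}+\bar H_{uu}\widetilde{\delta u}+\bar H_{up}\widetilde{\delta p}+B^T\widetilde{\delta\lambda}=-\mathrm D_u\ell\ \text{ a.e.},\\ &\nabla^2_{px}\varphi[t_f]\widetilde{\delta x}(t_f)+\int_{t_0}^{t_f}\!\big(\bar H_{px}\widetilde{\delta x}+\bar H_{pu}\widetilde{\delta u}+C^T\widetilde{\delta\lambda}\big)dt+\Big(\nabla^2_{pp}\varphi[t_f]+\int_{t_0}^{t_f}\!\bar H_{pp}\,dt\Big)\widetilde{\delta p}=-\nabla_p\phi[t_f]-\int_{t_0}^{t_f}\!\mathrm D_p\ell\,dt \end{aligned}$$ has exactly one solution $(\widetilde{\delta x},\widetilde{\delta u},\widetilde{\delta p},\widetilde{\delta\lambda})\in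 Z^\infty$, and for all $\delta g\in\mathcal G^3$, with $\delta g[t]=\delta g(t,\bar x(t),\bar u(t),\bar p)$ and likewise for its $y$-derivatives, $$\begin{aligned}\tilde q_g(\bar g)\,\delta g=&\int_{t_0}^{t_f}\Big(\bar H_{gx}[t]\widetilde{\delta x}(t)+\bar H_{gu}[t]\widetilde{\delta u}(t)+\bar H_{gp}[t]\widetilde{\delta p}+f_g[t]^T\widetilde{\delta\lambda}(t)+\nabla_g\ell[t]\Big)^T\delta g[t]\,dt\\&+\int_{t_0}^{t_f}d[t]^T\delta g_x[t]\widetilde{\delta x}(t)+d[t]^T\delta g_u[t]\widetilde{\delta u}(t)+d[t]^T\delta g_p[t]\widetilde{\delta p}\,dt.\end{aligned}$$ Finally, consider, for linear data $(r,r_0,c_x,c_u,\sigma_f,\gamma)$, the linear-quadratic problem over $Y^2$ $$\min\ \int_{t_0}^{t_f}\!\big(c_x^T\delta x+c_u^T\delta u\big)dt+\tfrac12\int_{t_0}^{t_f}\!\begin{pmatrix}\delta x\\\delta u\\\delta p\end{pmatrix}^{\!T}\!(\bar H_{ab})\begin{pmatrix}\delta x\\\delta u\\\delta p\end{pmatrix}dt+\sigma_f^T\delta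 x(t_f)+\gamma^T\delta p+\tfrac12\begin{pmatrix}\delta x(t_f)\\\delta p\end{pmatrix}^{\!T}\!\nabla^2_{(x,p)}\varphi[t_f]\begin{pmatrix}\delta x(t_f)\\\delta p\end{pmatrix}$$ subject to $\delta x'=A\delta x+B\delta u+C\delta p+r$ a.e., $\delta x(t_0)=r_0$, and take $r=0$, $r_0=0$, $c_x=\mathrm D_x\ell$, $c_u=\mathrm D_u\ell$, $\sigma_f=\nabla_x\phi[t_f]$, $\gamma=\nabla_p\phi[t_f]+\int_{t_0}^{t_f}\mathrm D_p\ell\,dt$. Then the adjoint system is its system of necessary and sufficient optimality conditions: $(\widetilde{\delta x},\widetilde{\delta u},\widetilde{\delta p},\widetilde{\delta\lambda})\in Z^\infty$ solves the adjoint system if and only if $(\widetilde{\delta x},\widetilde{\delta u},\widetilde{\delta p})$ solves the linear-quadratic problem with costate (Lagrange multiplier of the differential equation) $\widetilde{\delta\lambda}$; and an element of $Y^\infty$ solves the linear-quadratic problem if and only if it can be completed by some $\widetilde{\delta\lambda}\in W^{1,\infty}(I)^{n_x}$ to a solution of the adjoint system. -/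

import Mathlib

open MeasureTheory Set Filter Topology
open ContinuousLinearMap (adjoint)
open scoped ENNReal InnerProductSpace

noncomputable section

namespace OCPSens

/-! ### Finite-dimensional spaces -/

/-- Euclidean space `ℝⁿ`. -/
abbrev Rn (n : ℕ) : Type := EuclideanSpace ℝ (Fin n)

/-- State-control-parameter triples `y = (x, u, p)`. -/
abbrev Yn (nx nu np : ℕ) : Type := Rn nx × Rn nu × Rn np

/-- The inclusions of the `x`-, `u`- and `p`-directions into `y`-space. -/
def ιx {nx nu np : ℕ} : Rn nx →L[ℝ] Yn nx nu np := ContinuousLinearMap.inl ℝ _ _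

def ιu {nx nu np : ℕ} : Rn nu →L[ℝ] Yn nx nu np :=
  (ContinuousLinearMap.inr ℝ (Rn nx) (Rn nu × Rn np)).comp (ContinuousLinearMap.inl ℝ _ _)

def ιp {nx nu np : ℕ} : Rn np →L[ℝ] Yn nx nu np :=
  (ContinuousLinearMap.inr ℝ (Rn nx) (Rn nu × Rn np)).comp (ContinuousLinearMap.inr ℝ _ _)

/-- The inclusion of `y`-space, and of the `g`-directions, into the space of pairs `(y, g)`. -/
def ιY {nx nu np ng : ℕ} : Yn nx nu np →L[ℝ] Yn nx nu np × Rn ng := ContinuousLinearMap.inl ℝ _ _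

def ιg {nx nu np ng : ℕ} : Rn ng →L[ℝ] Yn nx nu np × Rn ng := ContinuousLinearMap.inr ℝ _ _

/-! ### Partial derivatives

Below, `ι : E →L W` is the inclusion of a block of variables. -/

/-- Partial Jacobian of `F` at `w` with respect to the block `ι`. -/
def pjac {E W V : Type*} [NormedAddCommGroup E] [NormedSpace ℝ E] [NormedAddCommGroup W]
    [NormedSpace ℝ W] [NormedAddCommGroup V] [NormedSpace ℝ V]
    (ι : E →L[ℝ] W) (F : W → V) (w : W) : E →L[ℝ] V :=
  (fderiv ℝ F w).comp ι

/-- Partial gradient `∇_a F(w)` of a scalar function with respect to the block `ι`. -/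
def pgrad {n : ℕ} {W : Type*} [NormedAddCommGroup W] [NormedSpace ℝ W]
    (ι : Rn n →L[ℝ] W) (F : W → ℝ) (w : W) : Rn n :=
  (InnerProductSpace.toDual ℝ (Rn n)).symm (pjac ι F w)

/-- Block `∇²_{ab} F(w) = ∂_b ∇_a F(w)` of the Hessian (a matrix with `a`-rows and `b`-columns). -/
def phess {m n : ℕ} {W : Type*} [NormedAddCommGroup W] [NormedSpace ℝ W]
    (ιa : Rn m →L[ℝ] W) (ιb : Rn n →L[ℝ] W) (F : W → ℝ) (w : W) : Rn n →L[ℝ] Rn m :=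
  pjac ιb (pgrad ιa F) w

/-! ### Function spaces on a bounded interval -/

/-- A bounded nonempty open interval `(t₀, t_f)`. -/
structure TimeInterval where
  t0 : ℝ
  tf : ℝ
  lt : t0 < tf

/-- Lebesgue measure on the interval. -/
def TimeInterval.vol (I : TimeInterval) : Measure ℝ := volume.restrict (Ioo I.t0 I.tf)

instance (I : TimeInterval) : IsFiniteMeasure I.vol := by
  unfold TimeInterval.vol; infer_instance

/-- The Lebesgue space `(L^q(I))ⁿ`. -/
abbrev Lq (I : TimeInterval) (q : ℝ≥0∞) (n : ℕ) : Type := Lp (Rn n) q I.vol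

/-- The pairs `(x, v)` of a continuous function `x` on `[t₀, t_f]` and `v ∈ L^q(I)ⁿ` such that `x` is
absolutely continuous with derivative `v`. -/
def w1Submodule (I : TimeInterval) (q : ℝ≥0∞) [hq : Fact (1 ≤ q)] (n : ℕ) :
    Submodule ℝ (C(Icc I.t0 I.tf, Rn n) × Lq I q n) where
  carrier := {z | ∀ t : Icc I.t0 I.tf,
    z.1 t = z.1 ⟨I.t0, left_mem_Icc.2 I.lt.le⟩ + ∫ s in I.t0..t, z.2 s ∂I.vol}
  zero_mem' := by
    intro t
    have h : ∫ s in I.t0..t, (0 : Lq I q n) s ∂I.vol = ∫ s in I.t0..t, (0 : Rn n) ∂I.vol :=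
      intervalIntegral.integral_congr_ae ((Lp.coeFn_zero (Rn n) q I.vol).mono fun s hs _ => hs)
    simp only [Prod.fst_zero, Prod.snd_zero, ContinuousMap.zero_apply, zero_add]
    rw [h, intervalIntegral.integral_zero]
  add_mem' := by
    intro a b ha hb t
    have hint : ∀ c : Lq I q n, IntervalIntegrable c I.vol I.t0 t := fun c =>
      ((Lp.memLp c).integrable hq.out).intervalIntegrable
    have h : ∫ s in I.t0..t, (a.2 + b.2) s ∂I.vol = ∫ s in I.t0..t, (a.2 s + b.2 s) ∂I.vol :=
      intervalIntegral.integral_congr_ae ((Lp.coeFn_add a.2 b.2).mono fun s hs _ => hs)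
    have ha' := ha t
    have hb' := hb t
    simp only [Prod.fst_add, Prod.snd_add, ContinuousMap.add_apply]
    rw [h, intervalIntegral.integral_add (hint _) (hint _), ha', hb']
    abel
  smul_mem' := by
    intro c a ha t
    have h : ∫ s in I.t0..t, (c • a.2) s ∂I.vol = ∫ s in I.t0..t, c • a.2 s ∂I.vol :=
      intervalIntegral.integral_congr_ae ((Lp.coeFn_smul c a.2).mono fun s hs _ => hs)
    have ha' := ha t
    simp only [Prod.smul_fst, Prod.smul_snd, ContinuousMap.smul_apply]
    rw [h, intervalIntegral.integral_smul, ha', smul_add]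

/-- The Sobolev space `(W^{1,q}(I))ⁿ`: absolutely continuous functions on `[t₀, t_f]` with derivative
in `L^q`, normed by the maximum of `sup ‖x‖` and `‖x'‖_{L^q}`. -/
def W1 (I : TimeInterval) (q : ℝ≥0∞) [Fact (1 ≤ q)] (n : ℕ) : Type := w1Submodule I q n

namespace W1

variable {I : TimeInterval} {q : ℝ≥0∞} [Fact (1 ≤ q)] {n : ℕ}

instance : NormedAddCommGroup (W1 I q n) := inferInstanceAs (NormedAddCommGroup (w1Submodule I q n))

instance : NormedSpace ℝ (W1 I q n) := inferInstanceAs (NormedSpace ℝ (w1Submodule I q n))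

/-- The underlying pair `(x, x')`. -/
def pair (x : W1 I q n) : C(Icc I.t0 I.tf, Rn n) × Lq I q n :=
  Subtype.val (p := fun z => z ∈ w1Submodule I q n) x

/-- The value `x(t)` for `t ∈ [t₀, t_f]` (extended by constants outside). -/
def val (x : W1 I q n) : ℝ → Rn n := IccExtend I.lt.le x.pair.1

/-- The derivative `x'(t)`, defined for almost all `t`. -/
def der (x : W1 I q n) : ℝ → Rn n := x.pair.2

end W1

/-- `W^{1,q} × L^q × ℝ^{n_p}`, the space of triples `(x, u, p)`. -/
abbrev YSpace (I : TimeInterval) (q : ℝ≥0∞) [Fact (1 ≤ q)] (nx nu np : ℕ) : Type :=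
  W1 I q nx × Lq I q nu × Rn np

/-- `W^{1,∞} × L^∞ × ℝ^{n_p} × W^{1,∞}`, the space of `((x, u, p), λ)`. -/
abbrev ZSpace (I : TimeInterval) (nx nu np : ℕ) : Type :=
  YSpace I ∞ nx nu np × W1 I ∞ nx

/-- The curve `t ↦ (x(t), u(t), p)`. -/
def curve {I : TimeInterval} {q : ℝ≥0∞} [Fact (1 ≤ q)] {nx nu np : ℕ}
    (y : YSpace I q nx nu np) (t : ℝ) : Yn nx nu np :=
  (y.1.val t, y.2.1 t, y.2.2)

/-- `∑_{n ≤ s} ess sup_t sup_y ‖∂ⁿ/∂yⁿ g(t, y)‖`. -/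
def gNorm (I : TimeInterval) (s : ℕ) {nx nu np ng : ℕ} (g : ℝ → Yn nx nu np → Rn ng) : ℝ≥0∞ :=
  ∑ n ∈ Finset.range (s + 1),
    essSup (fun t => ⨆ y, ‖iteratedFDeriv ℝ n (g t) y‖ₑ) I.vol

theorem gNorm_add_le (I : TimeInterval) (s : ℕ) {nx nu np ng : ℕ}
    {g h : ℝ → Yn nx nu np → Rn ng} (hg : ∀ᵐ t ∂I.vol, ContDiff ℝ s (g t))
    (hh : ∀ᵐ t ∂I.vol, ContDiff ℝ s (h t)) :
    gNorm I s (g + h) ≤ gNorm I s g + gNorm I s h := by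
  unfold gNorm
  rw [← Finset.sum_add_distrib]
  refine Finset.sum_le_sum fun n hn => ?_
  have hns : (n : WithTop ℕ∞) ≤ s := by
    have : n ≤ s := Nat.lt_succ_iff.1 (Finset.mem_range.1 hn)
    exact_mod_cast this
  refine le_trans (essSup_mono_ae ?_) (ENNReal.essSup_add_le _ _)
  filter_upwards [hg, hh] with t h1 h2
  refine iSup_le fun y => ?_
  have : iteratedFDeriv ℝ n ((g + h) t) y
      = iteratedFDeriv ℝ n (g t) y + iteratedFDeriv ℝ n (h t) y :=
    iteratedFDeriv_add_apply (h1.of_le hns).contDiffAt (h2.of_le hns).contDiffAt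
  rw [this]
  refine (enorm_add_le (iteratedFDeriv ℝ n (g t) y) (iteratedFDeriv ℝ n (h t) y)).trans ?_
  exact add_le_add (le_iSup (fun y => ‖iteratedFDeriv ℝ n (g t) y‖ₑ) y)
    (le_iSup (fun y => ‖iteratedFDeriv ℝ n (h t) y‖ₑ) y)

theorem gNorm_smul (I : TimeInterval) (s : ℕ) {nx nu np ng : ℕ} (c : ℝ)
    {g : ℝ → Yn nx nu np → Rn ng} (hg : ∀ᵐ t ∂I.vol, ContDiff ℝ s (g t)) :
    gNorm I s (c • g) = ‖c‖ₑ * gNorm I s g := by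
  unfold gNorm
  rw [Finset.mul_sum]
  refine Finset.sum_congr rfl fun n hn => ?_
  have hns : (n : WithTop ℕ∞) ≤ s := by
    have : n ≤ s := Nat.lt_succ_iff.1 (Finset.mem_range.1 hn)
    exact_mod_cast this
  rw [← ENNReal.essSup_const_mul]
  refine essSup_congr_ae ?_
  filter_upwards [hg] with t h1
  rw [ENNReal.mul_iSup]
  refine iSup_congr fun y => ?_
  have : iteratedFDeriv ℝ n ((c • g) t) y = c • iteratedFDeriv ℝ n (g t) y :=
    iteratedFDeriv_const_smul_apply (a := c) (f := g t) (x := y) (h1.of_le hns).contDiffAt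
  rw [this, enorm_smul]

/-- The functions `g(t, y)` that are `s` times continuously differentiable in `y` for a.a. `t`,
measurable in `t` for each `y`, and of finite norm. -/
def gSubmodule (I : TimeInterval) (s nx nu np ng : ℕ) :
    Submodule ℝ (ℝ → Yn nx nu np → Rn ng) where
  carrier := {g | (∀ᵐ t ∂I.vol, ContDiff ℝ s (g t)) ∧
    (∀ y, AEStronglyMeasurable (fun t => g t y) I.vol) ∧ gNorm I s g < ∞}
  zero_mem' := by
    have h0 : ∀ᵐ t ∂I.vol, ContDiff ℝ s ((0 : ℝ → Yn nx nu np → Rn ng) t) :=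
      Eventually.of_forall fun t => contDiff_const
    refine ⟨h0, fun y => aestronglyMeasurable_const, ?_⟩
    have := gNorm_smul I s (0 : ℝ) h0
    rw [zero_smul] at this
    rw [this, enorm_zero, zero_mul]
    exact ENNReal.zero_lt_top
  add_mem' := by
    rintro g h ⟨h1, h2, h3⟩ ⟨k1, k2, k3⟩
    refine ⟨?_, fun y => (h2 y).add (k2 y), ?_⟩
    · filter_upwards [h1, k1] with t a b using a.add b
    · exact (gNorm_add_le I s h1 k1).trans_lt (ENNReal.add_lt_top.2 ⟨h3, k3⟩)
  smul_mem' := by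
    rintro c g ⟨h1, h2, h3⟩
    refine ⟨?_, fun y => (h2 y).const_smul c, ?_⟩
    · filter_upwards [h1] with t a using a.const_smul c
    · rw [gNorm_smul I s c h1]
      exact ENNReal.mul_lt_top enorm_lt_top h3

/-- The space `(𝒢^s(I))^{n_g}` of component functions. Its elements are genuine functions, so that
`‖·‖` is a seminorm; it identifies functions that agree for a.a. `t` and all `y`. -/
def GSpace (I : TimeInterval) (s nx nu np ng : ℕ) : Type := gSubmodule I s nx nu np ng

namespace GSpace

variable {I : TimeInterval} {s nx nu np ng : ℕ}

instance : AddCommGroup (GSpace I s nx nu np ng) :=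
  inferInstanceAs (AddCommGroup (gSubmodule I s nx nu np ng))

instance : Module ℝ (GSpace I s nx nu np ng) :=
  inferInstanceAs (Module ℝ (gSubmodule I s nx nu np ng))

/-- The function `(t, y) ↦ g(t, y)`. -/
def fn (g : GSpace I s nx nu np ng) : ℝ → Yn nx nu np → Rn ng :=
  Subtype.val (p := fun h => h ∈ gSubmodule I s nx nu np ng) g

theorem fn_mem (g : GSpace I s nx nu np ng) : g.fn ∈ gSubmodule I s nx nu np ng :=
  Subtype.property (p := fun h => h ∈ gSubmodule I s nx nu np ng) g

instance : Norm (GSpace I s nx nu np ng) := ⟨fun g => (gNorm I s g.fn).toReal⟩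

theorem core : SeminormedSpace.Core ℝ (GSpace I s nx nu np ng) where
  norm_nonneg _ := ENNReal.toReal_nonneg
  norm_smul c g := by
    change (gNorm I s (c • g.fn)).toReal = ‖c‖ * (gNorm I s g.fn).toReal
    rw [gNorm_smul I s c g.fn_mem.1, ENNReal.toReal_mul, toReal_enorm]
  norm_triangle g h := by
    change (gNorm I s (g.fn + h.fn)).toReal ≤ (gNorm I s g.fn).toReal + (gNorm I s h.fn).toReal
    rw [← ENNReal.toReal_add g.fn_mem.2.2.ne h.fn_mem.2.2.ne]
    exact ENNReal.toReal_mono (ENNReal.add_lt_top.2 ⟨g.fn_mem.2.2, h.fn_mem.2.2⟩).ne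
      (gNorm_add_le I s g.fn_mem.1 h.fn_mem.1)

instance : SeminormedAddCommGroup (GSpace I s nx nu np ng) := SeminormedAddCommGroup.ofCore core

instance : NormedSpace ℝ (GSpace I s nx nu np ng) where
  norm_smul_le c g := (core.norm_smul c g).le

end GSpace

/-! ### The optimal control problem and its first-order optimality system -/

/-- Data of the Bolza problem: minimize `φ(x(t_f), p) + ∫ l(t, y(t), g(t, y(t))) dt` subject to
`x'(t) = f(t, y(t), g(t, y(t)))`, `x(t₀) = x₀`, where `y = (x, u, p)`. -/
structure Bolza (nx nu np ng : ℕ) where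
  I : TimeInterval
  x0 : Rn nx
  φ : Rn nx × Rn np → ℝ
  l : ℝ → Yn nx nu np × Rn ng → ℝ
  f : ℝ → Yn nx nu np × Rn ng → Rn nx

/-- The smoothness required of the integrand-type functions `F(t, y, g)`: measurability in `t`,
`C²`-smoothness in `(y, g)`, bounds at the origin, and local Lipschitz continuity, uniformly in `t`,
of all derivatives up to order two. -/
def StrongSmooth (I : TimeInterval) {W V : Type*} [NormedAddCommGroup W] [NormedSpace ℝ W]
    [NormedAddCommGroup V] [NormedSpace ℝ V] (F : ℝ → W → V) : Prop :=
  (∀ w, AEStronglyMeasurable (fun t => F t w) I.vol) ∧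
  (∀ᵐ t ∂I.vol, ContDiff ℝ 2 (F t)) ∧
  (∃ K : ℝ, ∀ s : ℕ, s ≤ 2 → ∀ᵐ t ∂I.vol, ‖iteratedFDeriv ℝ s (F t) 0‖ ≤ K) ∧
  (∀ R : ℝ, 0 < R → ∃ L : ℝ, ∀ s : ℕ, s ≤ 2 → ∀ᵐ t ∂I.vol,
    ∀ w₁ ∈ Metric.closedBall (0 : W) R, ∀ w₂ ∈ Metric.closedBall (0 : W) R,
      ‖iteratedFDeriv ℝ s (F t) w₁ - iteratedFDeriv ℝ s (F t) w₂‖ ≤ L * ‖w₁ - w₂‖)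

section Coefficients

variable {nx nu np ng : ℕ} (P : Bolza nx nu np ng) (g : ℝ → Yn nx nu np → Rn ng)
  (y : YSpace P.I ∞ nx nu np)

/-- The point `(y(t), g(t, y(t)))` at which `f`, `l`, `ℓ` and their derivatives are evaluated. -/
def pt (t : ℝ) : Yn nx nu np × Rn ng := (curve y t, g t (curve y t))

/-- `g_a[t]`, a partial Jacobian of `g` along the curve. -/
def gjac {n : ℕ} (ι : Rn n →L[ℝ] Yn nx nu np) (t : ℝ) : Rn n →L[ℝ] Rn ng :=
  pjac ι (g t) (curve y t)

/-- `f_g[t]`. -/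
def fg (t : ℝ) : Rn ng →L[ℝ] Rn nx := pjac ιg (P.f t) (pt P g y t)

/-- `f_a[t] + f_g[t] g_a[t]`. -/
def fTot {n : ℕ} (ι : Rn n →L[ℝ] Yn nx nu np) (t : ℝ) : Rn n →L[ℝ] Rn nx :=
  pjac (ιY.comp ι) (P.f t) (pt P g y t) + (fg P g y t).comp (gjac P g y ι t)

def coefA (t : ℝ) : Rn nx →L[ℝ] Rn nx := fTot P g y ιx t

def coefB (t : ℝ) : Rn nu →L[ℝ] Rn nx := fTot P g y ιu t

def coefC (t : ℝ) : Rn np →L[ℝ] Rn nx := fTot P g y ιp t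

/-- `∇_a L[t] + g_a[t]ᵀ ∇_g L[t]` for a scalar integrand `L`. -/
def gradTot (L : ℝ → Yn nx nu np × Rn ng → ℝ) {n : ℕ} (ι : Rn n →L[ℝ] Yn nx nu np) (t : ℝ) : Rn n :=
  pgrad (ιY.comp ι) (L t) (pt P g y t) + adjoint (gjac P g y ι t) (pgrad ιg (L t) (pt P g y t))

/-- The pair `(x(t_f), p)`. -/
def endPt : Rn nx × Rn np := (y.1.val P.I.tf, y.2.2)

/-- `∇_x φ(x(t_f), p)` and `∇_p φ(x(t_f), p)`. -/
def endGradx (φ : Rn nx × Rn np → ℝ) : Rn nx :=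
  pgrad (ContinuousLinearMap.inl ℝ _ _) φ (endPt P y)

def endGradp (φ : Rn nx × Rn np → ℝ) : Rn np :=
  pgrad (ContinuousLinearMap.inr ℝ _ _) φ (endPt P y)

/-- The blocks of the Hessian of the terminal cost at `(x(t_f), p)`. -/
def φxx : Rn nx →L[ℝ] Rn nx :=
  phess (ContinuousLinearMap.inl ℝ _ _) (ContinuousLinearMap.inl ℝ _ _) P.φ (endPt P y)

def φxp : Rn np →L[ℝ] Rn nx :=
  phess (ContinuousLinearMap.inl ℝ _ _) (ContinuousLinearMap.inr ℝ _ _) P.φ (endPt P y)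

def φpx : Rn nx →L[ℝ] Rn np :=
  phess (ContinuousLinearMap.inr ℝ _ _) (ContinuousLinearMap.inl ℝ _ _) P.φ (endPt P y)

def φpp : Rn np →L[ℝ] Rn np :=
  phess (ContinuousLinearMap.inr ℝ _ _) (ContinuousLinearMap.inr ℝ _ _) P.φ (endPt P y)

/-- The first-order necessary optimality conditions for `((x, u, p), λ)` with component function `g`,
i.e. the equation `ψ(x, u, p, λ; g) = 0`. -/
def IsKKT (z : ZSpace P.I nx nu np) : Prop :=
  (∀ᵐ t ∂P.I.vol, z.1.1.der t = P.f t (pt P g z.1 t)) ∧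
  z.1.1.val P.I.t0 = P.x0 ∧
  (∀ᵐ t ∂P.I.vol,
    z.2.der t = -(adjoint (coefA P g z.1 t) (z.2.val t)) - gradTot P g z.1 P.l ιx t) ∧
  z.2.val P.I.tf = endGradx P z.1 P.φ ∧
  (∀ᵐ t ∂P.I.vol, adjoint (coefB P g z.1 t) (z.2.val t) + gradTot P g z.1 P.l ιu t = 0) ∧
  endGradp P z.1 P.φ
    + ∫ t, (adjoint (coefC P g z.1 t) (z.2.val t) + gradTot P g z.1 P.l ιp t) ∂P.I.vol = 0

end Coefficients

section SecondOrder

variable {nx nu np ng : ℕ} (P : Bolza nx nu np ng) (g : ℝ → Yn nx nu np → Rn ng)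
  (z : ZSpace P.I nx nu np)

/-- The Hamiltonian `H(t, y, g) = l(t, y, g) + λ(t)ᵀ f(t, y, g)`. -/
def ham (t : ℝ) (w : Yn nx nu np × Rn ng) : ℝ := P.l t w + ⟪z.2.val t, P.f t w⟫_ℝ

/-- `d[t] = ∇_g H[t] = ∇_g l[t] + f_g[t]ᵀ λ(t)`. -/
def coefd (t : ℝ) : Rn ng := pgrad ιg (ham P z t) (pt P g z.1 t)

/-- `∑_k (∇_g H[t])_k ∇²_{ab} g_k[t]`. -/
def gCurv {m n : ℕ} (ιa : Rn m →L[ℝ] Yn nx nu np) (ιb : Rn n →L[ℝ] Yn nx nu np) (t : ℝ) :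
    Rn n →L[ℝ] Rn m :=
  phess ιa ιb (fun y' => ⟪coefd P g z t, g t y'⟫_ℝ) (curve z.1 t)

/-- `H_{ab}[t] = ∇²_{ab}H + ∇²_{ag}H g_b + g_aᵀ ∇²_{gb}H + g_aᵀ ∇²_{gg}H g_b
+ ∑_k (∇_g H)_k ∇²_{ab} g_k` for `a, b ∈ {x, u, p}`. -/
def coefH {m n : ℕ} (ιa : Rn m →L[ℝ] Yn nx nu np) (ιb : Rn n →L[ℝ] Yn nx nu np) (t : ℝ) :
    Rn n →L[ℝ] Rn m :=
  phess (ιY.comp ιa) (ιY.comp ιb) (ham P z t) (pt P g z.1 t)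
    + (phess (ιY.comp ιa) ιg (ham P z t) (pt P g z.1 t)).comp (gjac P g z.1 ιb t)
    + (adjoint (gjac P g z.1 ιa t)).comp (phess ιg (ιY.comp ιb) (ham P z t) (pt P g z.1 t))
    + (adjoint (gjac P g z.1 ιa t)).comp
        ((phess ιg ιg (ham P z t) (pt P g z.1 t)).comp (gjac P g z.1 ιb t))
    + gCurv P g z ιa ιb t

/-- `H_{ga}[t] = ∇²_{ga}H + ∇²_{gg}H g_a` for `a ∈ {x, u, p}`. -/
def coefHg {n : ℕ} (ιa : Rn n →L[ℝ] Yn nx nu np) (t : ℝ) : Rn n →L[ℝ] Rn ng :=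
  phess ιg (ιY.comp ιa) (ham P z t) (pt P g z.1 t)
    + (phess ιg ιg (ham P z t) (pt P g z.1 t)).comp (gjac P g z.1 ιa t)

/-! ### The linear-quadratic problem -/

/-- The linear data `(r, r₀, c_x, c_u, σ_f, γ)` of the linear-quadratic problem. -/
structure LQData (nx nu np : ℕ) where
  r : ℝ → Rn nx
  r0 : Rn nx
  cx : ℝ → Rn nx
  cu : ℝ → Rn nu
  σf : Rn nx
  γ : Rn np

/-- `(δx, δx', δu, δp)` as functions of time. -/
abbrev Traj (nx nu np : ℕ) : Type := (ℝ → Rn nx) × (ℝ → Rn nx) × (ℝ → Rn nu) × Rn np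

/-- The functions of time belonging to an element of `W^{1,q} × L^q × ℝ^{n_p}`. -/
def toTraj {I : TimeInterval} {q : ℝ≥0∞} [Fact (1 ≤ q)] {nx nu np : ℕ}
    (y : YSpace I q nx nu np) : Traj nx nu np :=
  (y.1.val, y.1.der, ⇑y.2.1, y.2.2)

/-- The quadratic form in `(δx, δu, δp)` of the block matrix `(H_{ab}[t])`, `a, b ∈ {x, u, p}`. -/
def quadForm (t : ℝ) (v : Yn nx nu np) : ℝ :=
  ⟪v.1, coefH P g z ιx ιx t v.1 + coefH P g z ιx ιu t v.2.1 + coefH P g z ιx ιp t v.2.2⟫_ℝ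
  + ⟪v.2.1, coefH P g z ιu ιx t v.1 + coefH P g z ιu ιu t v.2.1 + coefH P g z ιu ιp t v.2.2⟫_ℝ
  + ⟪v.2.2, coefH P g z ιp ιx t v.1 + coefH P g z ιp ιu t v.2.1 + coefH P g z ιp ιp t v.2.2⟫_ℝ

/-- The quadratic form of the Hessian of the terminal cost at `(x(t_f), p)`. -/
def endQuadForm (v : Rn nx × Rn np) : ℝ :=
  ⟪v.1, φxx P z.1 v.1 + φxp P z.1 v.2⟫_ℝ + ⟪v.2, φpx P z.1 v.1 + φpp P z.1 v.2⟫_ℝ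

/-- The objective of the linear-quadratic problem. -/
def lqCost (c : LQData nx nu np) (w : Traj nx nu np) : ℝ :=
  ∫ t, (⟪c.cx t, w.1 t⟫_ℝ + ⟪c.cu t, w.2.2.1 t⟫_ℝ) ∂P.I.vol
  + (1 / 2) * ∫ t, quadForm P g z t (w.1 t, w.2.2.1 t, w.2.2.2) ∂P.I.vol
  + (⟪c.σf, w.1 P.I.tf⟫_ℝ + ⟪c.γ, w.2.2.2⟫_ℝ)
  + (1 / 2) * endQuadForm P z (w.1 P.I.tf, w.2.2.2)

/-- `A[t] δx(t) + B[t] δu(t) + C[t] δp + r(t)`. -/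
def lqRhs (c : LQData nx nu np) (w : Traj nx nu np) (t : ℝ) : Rn nx :=
  coefA P g z.1 t (w.1 t) + coefB P g z.1 t (w.2.2.1 t) + coefC P g z.1 t w.2.2.2 + c.r t

/-- The constraints of the linear-quadratic problem. -/
def LQFeasible (c : LQData nx nu np) (w : Traj nx nu np) : Prop :=
  (∀ᵐ t ∂P.I.vol, w.2.1 t = lqRhs P g z c w t) ∧ w.1 P.I.t0 = c.r0

/-- `y` solves the linear-quadratic problem posed in `W^{1,2} × L² × ℝ^{n_p}`. -/
def IsLQSolution (c : LQData nx nu np) {q : ℝ≥0∞} [Fact (1 ≤ q)]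
    (y : YSpace P.I q nx nu np) : Prop :=
  LQFeasible P g z c (toTraj y) ∧
  ∀ y' : YSpace P.I 2 nx nu np, LQFeasible P g z c (toTraj y') →
    lqCost P g z c (toTraj y) ≤ lqCost P g z c (toTraj y')

/-- The Lagrangian of the linear-quadratic problem with multiplier `μ` for the differential equation
and `μ₀` for the initial condition. -/
def lqLagrangian (c : LQData nx nu np) (μ : ℝ → Rn nx) (μ₀ : Rn nx) (w : Traj nx nu np) : ℝ :=
  lqCost P g z c w + ∫ t, ⟪μ t, lqRhs P g z c w t - w.2.1 t⟫_ℝ ∂P.I.vol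
    + ⟪μ₀, c.r0 - w.1 P.I.t0⟫_ℝ

/-- `μ` is a costate (Lagrange multiplier) for `y`: the Lagrangian is stationary at `y` in all
directions of `W^{1,2} × L² × ℝ^{n_p}`. -/
def IsLQCostate (c : LQData nx nu np) {q : ℝ≥0∞} [Fact (1 ≤ q)]
    (y : YSpace P.I q nx nu np) (μ : W1 P.I q nx) : Prop :=
  ∃ μ₀ : Rn nx, ∀ η : YSpace P.I 2 nx nu np,
    HasDerivAt (fun s : ℝ => lqLagrangian P g z c μ.val μ₀ (toTraj y + s • toTraj η)) 0 0

/-- The second-order sufficient optimality condition at `(z, g)`. -/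
def SSOC : Prop :=
  (∀ v : Rn nx × Rn np, 0 ≤ endQuadForm P z v) ∧
  (∃ ε : ℝ, 0 < ε ∧ ∀ η : YSpace P.I 2 nx nu np,
    LQFeasible P g z ⟨0, 0, 0, 0, 0, 0⟩ (toTraj η) →
      ε * (∫ t, ‖η.1.val t‖ ^ 2 ∂P.I.vol + ∫ t, ‖η.2.1 t‖ ^ 2 ∂P.I.vol + ‖η.2.2‖ ^ 2)
        ≤ ∫ t, quadForm P g z t (curve η t) ∂P.I.vol) ∧
  (∃ M : ℝ, 0 < M ∧ ∀ᵐ t ∂P.I.vol, ∃ T : Rn nu →L[ℝ] Rn nu,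
    T.comp (coefH P g z ιu ιu t) = ContinuousLinearMap.id ℝ _ ∧
    (coefH P g z ιu ιu t).comp T = ContinuousLinearMap.id ℝ _ ∧ ‖T‖ ≤ M)

end SecondOrder

/-! ### The quantity of interest and the adjoint system -/

/-- The terminal function and the integrand of the quantity of interest. -/
structure QoI (nx nu np ng : ℕ) where
  ϕ : Rn nx × Rn np → ℝ
  ℓ : ℝ → Yn nx nu np × Rn ng → ℝ

section Adjoint

variable {nx nu np ng : ℕ} (P : Bolza nx nu np ng) (Q : QoI nx nu np ng)
  (g : ℝ → Yn nx nu np → Rn ng)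

/-- `q(x, u, p; g) = ϕ(x(t_f), p) + ∫ ℓ(t, y(t), g(t, y(t))) dt`. -/
def qoi (y : YSpace P.I ∞ nx nu np) : ℝ :=
  Q.ϕ (endPt P y) + ∫ t, Q.ℓ t (pt P g y t) ∂P.I.vol

variable (z : ZSpace P.I nx nu np)

/-- `ζ = ((δx, δu, δp), δλ)` solves the adjoint equations at `(z, g)`. -/
def AdjointSystem (ζ : ZSpace P.I nx nu np) : Prop :=
  (∀ᵐ t ∂P.I.vol, ζ.1.1.der t =
    coefA P g z.1 t (ζ.1.1.val t) + coefB P g z.1 t (ζ.1.2.1 t) + coefC P g z.1 t ζ.1.2.2) ∧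
  ζ.1.1.val P.I.t0 = 0 ∧
  (∀ᵐ t ∂P.I.vol, ζ.2.der t =
    -(adjoint (coefA P g z.1 t) (ζ.2.val t)) - coefH P g z ιx ιx t (ζ.1.1.val t)
      - coefH P g z ιx ιu t (ζ.1.2.1 t) - coefH P g z ιx ιp t ζ.1.2.2
      - gradTot P g z.1 Q.ℓ ιx t) ∧
  ζ.2.val P.I.tf =
    endGradx P z.1 Q.ϕ + φxx P z.1 (ζ.1.1.val P.I.tf) + φxp P z.1 ζ.1.2.2 ∧
  (∀ᵐ t ∂P.I.vol,
    coefH P g z ιu ιx t (ζ.1.1.val t) + coefH P g z ιu ιu t (ζ.1.2.1 t)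
      + coefH P g z ιu ιp t ζ.1.2.2 + adjoint (coefB P g z.1 t) (ζ.2.val t)
      = -gradTot P g z.1 Q.ℓ ιu t) ∧
  φpx P z.1 (ζ.1.1.val P.I.tf)
    + ∫ t, (coefH P g z ιp ιx t (ζ.1.1.val t) + coefH P g z ιp ιu t (ζ.1.2.1 t)
        + adjoint (coefC P g z.1 t) (ζ.2.val t)) ∂P.I.vol
    + (φpp P z.1 ζ.1.2.2 + (∫ t, coefH P g z ιp ιp t ∂P.I.vol) ζ.1.2.2)
    = -endGradp P z.1 Q.ϕ - ∫ t, gradTot P g z.1 Q.ℓ ιp t ∂P.I.vol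

/-- The linear data for which the linear-quadratic problem has the adjoint system as its optimality
system. -/
def adjointData : LQData nx nu np where
  r := 0
  r0 := 0
  cx := gradTot P g z.1 Q.ℓ ιx
  cu := gradTot P g z.1 Q.ℓ ιu
  σf := endGradx P z.1 Q.ϕ
  γ := endGradp P z.1 Q.ϕ + ∫ t, gradTot P g z.1 Q.ℓ ιp t ∂P.I.vol

/-- The adjoint representation of the derivative of the quantity of interest in the direction
`δg`. -/
def adjointExpr (ζ : ZSpace P.I nx nu np) (δg : ℝ → Yn nx nu np → Rn ng) : ℝ :=
  ∫ t, ⟪coefHg P g z ιx t (ζ.1.1.val t) + coefHg P g z ιu t (ζ.1.2.1 t)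
      + coefHg P g z ιp t ζ.1.2.2 + adjoint (fg P g z.1 t) (ζ.2.val t)
      + pgrad ιg (Q.ℓ t) (pt P g z.1 t), δg t (curve z.1 t)⟫_ℝ ∂P.I.vol
  + ∫ t, (⟪coefd P g z t, gjac P δg z.1 ιx t (ζ.1.1.val t)⟫_ℝ
      + ⟪coefd P g z t, gjac P δg z.1 ιu t (ζ.1.2.1 t)⟫_ℝ
      + ⟪coefd P g z t, gjac P δg z.1 ιp t ζ.1.2.2⟫_ℝ) ∂P.I.vol

end Adjoint

end OCPSens

end

/-!
The theorem is an application of the implicit function theorem to the optimality system, followed by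
a duality argument for its linearization, which is the optimality system of a linear-quadratic
problem.

**The equation.** The optimality system is written as `ψ (g, z) = 0`, where `z = (x, u, p, λ)`
ranges over `W^{1,∞} × L^∞ × ℝ^{n_p} × W^{1,∞}` and the residuals over `RSpace`. Its integrands are
superposition operators `(g, w) ↦ J g (·, w(·))` on `L^∞`. They are continuously differentiable as
soon as `J g` depends linearly on `g` and its `w`-derivative is Lipschitz on balls with a constant
proportional to `‖g‖` (`IsC1Family.contDiff_op`); this covers the fixed functions `f`, `l` and their
derivatives as well as `g` and `g_y`, whose Lipschitz constants come from the norm of `𝒢³`.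
Composition gives a `C¹` map `ψ` (`exists_residual_mk`) and a `C¹` quantity of interest
(`exists_qoi`). The norm of `𝒢³` only sees functions up to null sets of times, so `ψ` is defined on
the separation quotient `GQuot`, whose completeness plays no role: the implicit function theorem
`exists_implicit_solution` solves for `z` by a contraction at fixed `g` and needs only the space of
`z` to be complete.

**The linearization.** By `isOperator_lqModel`, the partial derivative of `ψ` with respect to `z` is
the operator of the optimality system of the linear-quadratic problem `lqModel` with dynamics
`(A B C)` and Hessian `(H_{ab})`. It is bijective (`LQModel.IsOperator.bijective`). For injectivity,
testing the homogeneous system with its own solution and integrating by parts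
(`LQModel.System.weak`) shows that the Hessian form vanishes along an admissible direction, which is
zero by coercivity; the costate then vanishes because every function is a residual of the
differential equation (`LQModel.costate_eq_zero`). For surjectivity, the invertibility of `H_{uu}`
allows to eliminate the control, so that state and costate solve a linear differential equation for
arbitrary `λ(t₀)` and `p`; as many conditions remain, at the final time and for `p`, as there are
unknowns in `(λ(t₀), p)`, and a linear map between spaces of the same finite dimension is surjective
if it is injective.

**The adjoint system.** It is the optimality system of the same linear-quadratic problem with the
derivative of the quantity of interest as linear cost (`adjointSystem_iff`), hence uniquely
solvable. At one of its solutions the cost differs from the cost of any other admissible direction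
by half the Hessian form of the difference (`LQModel.System.cost_eq`), which gives minimality and
uniqueness of the minimizer, while the stationarity of the Lagrangian determines the costate
(`LQModel.System.costate_unique`).

**The derivative.** The derivative of `g ↦ z(g)` in direction `δg` solves the linearized system with
the inhomogeneities caused by `δg` (`system_of_tangent`). Since the Hessian form is symmetric,
testing this system with the adjoint solution, and the adjoint system with the derivative of `z`,
expresses the derivative of the quantity of interest by the adjoint solution
(`LQModel.System.lin_eq`, `adjointExpr_eq`).
-/

noncomputable section

namespace OCPSens

/-! ### Essentially bounded functions and Carathéodory measurability -/

section Linfty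

variable {α : Type*} {m : MeasurableSpace α} {μ : Measure α}
  {E : Type*} [NormedAddCommGroup E]

theorem ae_norm_le_eLpNorm_top {f : α → E} (hf : MemLp f ∞ μ) :
    ∀ᵐ t ∂μ, ‖f t‖ ≤ (eLpNorm f ∞ μ).toReal := by
  filter_upwards [ae_le_eLpNormEssSup (f := f) (μ := μ)] with t ht
  rw [← eLpNorm_exponent_top] at ht
  have := ENNReal.toReal_mono hf.2.ne ht
  simpa using this

theorem ae_norm_le_norm_top (f : Lp E ∞ μ) : ∀ᵐ t ∂μ, ‖f t‖ ≤ ‖f‖ :=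
  ae_norm_le_eLpNorm_top (Lp.memLp f)

theorem norm_le_of_ae_top {f : Lp E ∞ μ} {C : ℝ} (hC : 0 ≤ C) (h : ∀ᵐ t ∂μ, ‖f t‖ ≤ C) :
    ‖f‖ ≤ C := by
  rw [Lp.norm_def, eLpNorm_exponent_top]
  refine ENNReal.toReal_le_of_le_ofReal hC ?_
  refine eLpNormEssSup_le_of_ae_bound h

variable {W V : Type*} [NormedAddCommGroup W] [NormedAddCommGroup V]

/-- A function `(t, w) ↦ F t w`, measurable in `t` and continuous at the points of a measurable
curve, is measurable along that curve: approximate the curve by simple functions. -/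
theorem aestronglyMeasurable_comp_of_continuousAt {F : α → W → V} {w : α → W}
    (hF : ∀ v, AEStronglyMeasurable (fun t => F t v) μ) (hw : AEStronglyMeasurable w μ)
    (hc : ∀ᵐ t ∂μ, ContinuousAt (F t) (w t)) :
    AEStronglyMeasurable (fun t => F t (w t)) μ := by
  obtain ⟨w', hw', hww'⟩ := hw
  have hc' : ∀ᵐ t ∂μ, ContinuousAt (F t) (w' t) := by
    filter_upwards [hc, hww'] with t h1 h2 using h2 ▸ h1
  have hs : ∀ s : SimpleFunc α W, AEStronglyMeasurable (fun t => F t (s t)) μ := by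
    intro s
    have : (fun t => F t (s t))
        = ∑ v ∈ s.range, (s ⁻¹' {v}).indicator (fun t => F t v) := by
      funext t
      rw [Finset.sum_apply, Finset.sum_eq_single (s t)]
      · simp
      · intro v _ hv
        exact indicator_of_notMem (by simpa using hv.symm) _
      · intro h
        exact absurd (s.mem_range_self t) h
    rw [this]
    exact Finset.aestronglyMeasurable_sum _ fun v _ => (hF v).indicator (s.measurableSet_preimage _)
  have h := aestronglyMeasurable_of_tendsto_ae atTop (f := fun n t => F t (hw'.approx n t))
    (g := fun t => F t (w' t)) (fun n => hs _) ?_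
  · refine h.congr ?_
    filter_upwards [hww'] with t ht
    rw [ht]
  · filter_upwards [hc'] with t ht
    exact ht.tendsto.comp (hw'.tendsto_approx t)

variable [NormedSpace ℝ W] [NormedSpace ℝ V] [FiniteDimensional ℝ W]

/-- In finite dimensions, operator-valued functions are measurable as soon as they are pointwise. -/
theorem aestronglyMeasurable_clm {T : α → W →L[ℝ] V}
    (h : ∀ w, AEStronglyMeasurable (fun t => T t w) μ) : AEStronglyMeasurable T μ := by
  let b := Module.finBasis ℝ W
  have : T = fun t => ∑ i, (LinearMap.toContinuousLinearMap (b.coord i)).smulRight (T t (b i)) := by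
    funext t
    ext w
    conv_lhs => rw [← b.sum_repr w, map_sum]
    simp
  rw [this]
  refine Finset.aestronglyMeasurable_fun_sum _ fun i _ => ?_
  exact (ContinuousLinearMap.smulRightL ℝ W V
    (LinearMap.toContinuousLinearMap (b.coord i))).continuous.comp_aestronglyMeasurable (h _)

theorem aestronglyMeasurable_fderiv {F : α → W → V}
    (hF : ∀ v, AEStronglyMeasurable (fun t => F t v) μ) (hd : ∀ᵐ t ∂μ, Differentiable ℝ (F t))
    (w : W) : AEStronglyMeasurable (fun t => fderiv ℝ (F t) w) μ := by
  refine aestronglyMeasurable_clm fun v => ?_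
  refine aestronglyMeasurable_of_tendsto_ae atTop
    (f := fun (n : ℕ) t => ((n : ℝ) + 1) • (F t (w + ((n : ℝ) + 1)⁻¹ • v) - F t w))
    (fun n => ((hF _).sub (hF _)).const_smul _) ?_
  filter_upwards [hd] with t ht
  have h := ((ht w).hasFDerivAt).lim_real v
  have h2 : Tendsto (fun n : ℕ => (n : ℝ) + 1) atTop atTop :=
    tendsto_atTop_add_const_right _ _ tendsto_natCast_atTop_atTop
  exact h.comp h2

end Linfty

/-! ### Superposition operators on essentially bounded functions -/

section Nemytskii

variable {α : Type*} {m : MeasurableSpace α} (μ : Measure α)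
  {𝔾 W V : Type*} [NormedAddCommGroup 𝔾] [NormedSpace ℝ 𝔾] [NormedAddCommGroup W] [NormedSpace ℝ W]
  [NormedAddCommGroup V] [NormedSpace ℝ V] [FiniteDimensional ℝ W]

/-- A family of integrand-type functions `J g : (t, w) ↦ J g t w`, depending linearly on a parameter
`g`, differentiable in `w` with bounds and a Lipschitz estimate for the derivative on balls that are
uniform in `t` and proportional to `‖g‖`. A single function `F` corresponds to the family `c • F`
with `c ∈ ℝ`. -/
structure IsC1Family (J : 𝔾 → α → W → V) : Prop where
  add : ∀ g h, ∀ᵐ t ∂μ, J (g + h) t = J g t + J h t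
  smul : ∀ (c : ℝ) g, ∀ᵐ t ∂μ, J (c • g) t = c • J g t
  meas : ∀ g w, AEStronglyMeasurable (fun t => J g t w) μ
  diff : ∀ g, ∀ᵐ t ∂μ, Differentiable ℝ (J g t)
  bound : ∀ R : ℝ, ∃ C : ℝ, 0 ≤ C ∧ ∀ g, ∀ᵐ t ∂μ, ∀ w ∈ Metric.closedBall (0 : W) R,
    ‖J g t w‖ ≤ C * ‖g‖ ∧ ‖fderiv ℝ (J g t) w‖ ≤ C * ‖g‖ ∧
    ∀ w' ∈ Metric.closedBall (0 : W) R,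
      ‖fderiv ℝ (J g t) w - fderiv ℝ (J g t) w'‖ ≤ C * ‖g‖ * ‖w - w'‖

variable {μ} {J : 𝔾 → α → W → V}

namespace IsC1Family

variable (hJ : IsC1Family μ J)
include hJ

omit [FiniteDimensional ℝ W] in
theorem memLp (g : 𝔾) (w : Lp W ∞ μ) : MemLp (fun t => J g t (w t)) ∞ μ := by
  obtain ⟨C, _, hC⟩ := hJ.bound ‖w‖
  refine memLp_top_of_bound (aestronglyMeasurable_comp_of_continuousAt (hJ.meas g)
    (Lp.aestronglyMeasurable w) ?_) (C * ‖g‖) ?_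
  · filter_upwards [hJ.diff g] with t ht using ht.continuous.continuousAt
  · filter_upwards [hC g, ae_norm_le_norm_top w] with t h1 h2
    exact (h1 _ (by simpa using h2)).1

theorem memLp_fderiv (g : 𝔾) (w : Lp W ∞ μ) :
    MemLp (fun t => fderiv ℝ (J g t) (w t)) ∞ μ := by
  obtain ⟨C, _, hC⟩ := hJ.bound ‖w‖
  obtain ⟨C₁, hC₁0, hC₁⟩ := hJ.bound (‖w‖ + 1)
  refine memLp_top_of_bound (aestronglyMeasurable_comp_of_continuousAt
    (aestronglyMeasurable_fderiv (hJ.meas g) (hJ.diff g))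
    (Lp.aestronglyMeasurable w) ?_) (C * ‖g‖) ?_
  · filter_upwards [hC₁ g, ae_norm_le_norm_top w] with t h1 h2
    have hw : w t ∈ Metric.closedBall (0 : W) (‖w‖ + 1) := by
      rw [mem_closedBall_zero_iff]; linarith
    have hU : Metric.closedBall (0 : W) (‖w‖ + 1) ∈ 𝓝 (w t) := by
      refine Filter.mem_of_superset (Metric.ball_mem_nhds (w t) one_pos) fun v hv => ?_
      rw [mem_closedBall_zero_iff]
      rw [mem_ball_iff_norm] at hv
      calc ‖v‖ = ‖(v - w t) + w t‖ := by abel_nf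
        _ ≤ _ := norm_add_le _ _
        _ ≤ _ := by linarith
    refine ContinuousOn.continuousAt ?_ hU
    refine (LipschitzOnWith.of_dist_le_mul (K := ⟨C₁ * ‖g‖, by positivity⟩) ?_).continuousOn
    intro x hx y hy
    rw [dist_eq_norm, dist_eq_norm]
    exact (h1 x hx).2.2 y hy
  · filter_upwards [hC g, ae_norm_le_norm_top w] with t h1 h2
    exact (h1 _ (by simpa using h2)).2.1

/-- The superposition operator `(g, w) ↦ J g · (w ·)` on essentially bounded functions. -/
def op (p : 𝔾 × Lp W ∞ μ) : Lp V ∞ μ := (hJ.memLp p.1 p.2).toLp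

/-- The pointwise derivative of the superposition operator with respect to `w`. -/
def opD (p : 𝔾 × Lp W ∞ μ) : Lp (W →L[ℝ] V) ∞ μ := (hJ.memLp_fderiv p.1 p.2).toLp

omit [FiniteDimensional ℝ W] in
theorem coeFn_op (p : 𝔾 × Lp W ∞ μ) : hJ.op p =ᵐ[μ] fun t => J p.1 t (p.2 t) :=
  MemLp.coeFn_toLp _

theorem coeFn_opD (p : 𝔾 × Lp W ∞ μ) : hJ.opD p =ᵐ[μ] fun t => fderiv ℝ (J p.1 t) (p.2 t) :=
  MemLp.coeFn_toLp _

omit [FiniteDimensional ℝ W] in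
theorem exists_norm_op_le (w : Lp W ∞ μ) : ∃ C, 0 ≤ C ∧ ∀ g, ‖hJ.op (g, w)‖ ≤ C * ‖g‖ := by
  obtain ⟨C, hC0, hC⟩ := hJ.bound ‖w‖
  refine ⟨C, hC0, fun g => norm_le_of_ae_top (by positivity) ?_⟩
  filter_upwards [hC g, ae_norm_le_norm_top w, hJ.coeFn_op (g, w)] with t h1 h2 h3
  rw [h3]
  exact (h1 _ (by simpa using h2)).1

/-- The superposition operator as a continuous linear function of the parameter. -/
def opParam (w : Lp W ∞ μ) : 𝔾 →L[ℝ] Lp V ∞ μ :=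
  LinearMap.mkContinuousOfExistsBound
    { toFun := fun g => hJ.op (g, w)
      map_add' := fun g h => by
        refine Lp.ext ?_
        filter_upwards [hJ.coeFn_op (g + h, w), hJ.coeFn_op (g, w), hJ.coeFn_op (h, w),
          Lp.coeFn_add (hJ.op (g, w)) (hJ.op (h, w)), hJ.add g h] with t h1 h2 h3 h4 h5
        rw [h1, h4, Pi.add_apply, h2, h3, h5, Pi.add_apply]
      map_smul' := fun c g => by
        refine Lp.ext ?_
        filter_upwards [hJ.coeFn_op (c • g, w), hJ.coeFn_op (g, w),
          Lp.coeFn_smul c (hJ.op (g, w)), hJ.smul c g] with t h1 h2 h3 h4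
        rw [RingHom.id_apply, h1, h3, Pi.smul_apply, h2, h4, Pi.smul_apply] }
    (by
      obtain ⟨C, -, hC⟩ := hJ.exists_norm_op_le w
      exact ⟨C, hC⟩)

/-- The total derivative of the superposition operator. -/
def opDeriv (p : 𝔾 × Lp W ∞ μ) : 𝔾 × Lp W ∞ μ →L[ℝ] Lp V ∞ μ :=
  (hJ.opParam p.2).comp (ContinuousLinearMap.fst ℝ _ _) +
    ((ContinuousLinearMap.id ℝ (W →L[ℝ] V)).holderL μ ∞ ∞ ∞ (hJ.opD p)).comp
      (ContinuousLinearMap.snd ℝ _ _)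

theorem coeFn_opDeriv (p d : 𝔾 × Lp W ∞ μ) :
    hJ.opDeriv p d =ᵐ[μ] fun t => J d.1 t (p.2 t) + fderiv ℝ (J p.1 t) (p.2 t) (d.2 t) := by
  filter_upwards [hJ.coeFn_opD p, hJ.coeFn_op (d.1, p.2),
    (ContinuousLinearMap.id ℝ (W →L[ℝ] V)).coeFn_holder (r := ∞) (hJ.opD p) d.2,
    Lp.coeFn_add (hJ.op (d.1, p.2))
      ((ContinuousLinearMap.id ℝ (W →L[ℝ] V)).holder ∞ (hJ.opD p) d.2)] with t h1 h2 h3 h4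
  have : hJ.opDeriv p d = hJ.op (d.1, p.2) +
      (ContinuousLinearMap.id ℝ (W →L[ℝ] V)).holder ∞ (hJ.opD p) d.2 := rfl
  rw [this, h4, Pi.add_apply, h3, h2, h1]
  rfl

omit [FiniteDimensional ℝ W] in
theorem sub (g h : 𝔾) : ∀ᵐ t ∂μ, J (g - h) t = J g t - J h t := by
  have h0 := hJ.add g (-h)
  have h1 := hJ.smul (-1) h
  filter_upwards [h0, h1] with t h2 h3
  rw [sub_eq_add_neg, h2, ← neg_one_smul ℝ h, h3]
  simp [sub_eq_add_neg]

theorem hasFDerivAt_op (p : 𝔾 × Lp W ∞ μ) : HasFDerivAt hJ.op (hJ.opDeriv p) p := by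
  obtain ⟨g, w⟩ := p
  obtain ⟨C, hC0, hC⟩ := hJ.bound (‖w‖ + 1)
  have key : ∀ d : 𝔾 × Lp W ∞ μ, ‖d.2‖ ≤ 1 →
      ‖hJ.op ((g, w) + d) - hJ.op (g, w) - hJ.opDeriv (g, w) d‖
        ≤ C * (‖g‖ + 1) * ‖d‖ * ‖d‖ := by
    rintro ⟨dg, dw⟩ hd
    simp only at hd
    refine norm_le_of_ae_top (by positivity) ?_
    filter_upwards [hJ.coeFn_op ((g, w) + (dg, dw)), hJ.coeFn_op (g, w),
      hJ.coeFn_opDeriv (g, w) (dg, dw), hJ.add g dg,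
      Lp.coeFn_sub (hJ.op ((g, w) + (dg, dw)) - hJ.op (g, w)) (hJ.opDeriv (g, w) (dg, dw)),
      Lp.coeFn_sub (hJ.op ((g, w) + (dg, dw))) (hJ.op (g, w)), Lp.coeFn_add w dw,
      ae_norm_le_norm_top w, ae_norm_le_norm_top dw, hC g, hC dg, hJ.diff g, hJ.diff dg]
      with t h1 h2 h3 h4 h5 h6 h7 h8 h9 h10 h11 h12 h13
    rw [h5, Pi.sub_apply, h6, Pi.sub_apply, h1, h2, h3]
    simp only [Prod.mk_add_mk]
    rw [h4, h7, Pi.add_apply, Pi.add_apply]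
    -- all the points involved lie in the ball `s` of radius `‖dw‖` about `w t`
    set s := Metric.closedBall (w t) ‖dw‖ with hs
    have hsR : s ⊆ Metric.closedBall 0 (‖w‖ + 1) := by
      intro v hv
      rw [hs, mem_closedBall_iff_norm] at hv
      rw [mem_closedBall_zero_iff]
      calc ‖v‖ = ‖(v - w t) + w t‖ := by abel_nf
        _ ≤ _ := norm_add_le _ _
        _ ≤ _ := by linarith
    have hws : w t ∈ s := Metric.mem_closedBall_self (norm_nonneg _)
    have hws' : w t + dw t ∈ s := by
      rw [hs, mem_closedBall_iff_norm]; simpa using h9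
    have e1 : ‖J g t (w t + dw t) - J g t (w t) - fderiv ℝ (J g t) (w t) (w t + dw t - w t)‖
        ≤ C * ‖g‖ * ‖dw‖ * ‖w t + dw t - w t‖ := by
      refine Convex.norm_image_sub_le_of_norm_fderiv_le' (fun x _ => h12 x) (fun x hx => ?_)
        (convex_closedBall _ _) hws hws'
      refine ((h10 x (hsR hx)).2.2 _ (hsR hws)).trans ?_
      gcongr
      exact mem_closedBall_iff_norm.1 hx
    have e2 : ‖J dg t (w t + dw t) - J dg t (w t)‖ ≤ C * ‖dg‖ * ‖w t + dw t - w t‖ :=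
      Convex.norm_image_sub_le_of_norm_fderiv_le (fun x _ => h13 x)
        (fun x hx => (h11 x (hsR hx)).2.1) (convex_closedBall _ _) hws hws'
    rw [add_sub_cancel_left] at e1 e2
    have hdg : ‖dg‖ ≤ ‖(dg, dw)‖ := norm_fst_le (dg, dw)
    have hdw : ‖dw‖ ≤ ‖(dg, dw)‖ := norm_snd_le (dg, dw)
    calc ‖J g t (w t + dw t) + J dg t (w t + dw t) - J g t (w t)
          - (J dg t (w t) + fderiv ℝ (J g t) (w t) (dw t))‖
        = ‖(J g t (w t + dw t) - J g t (w t) - fderiv ℝ (J g t) (w t) (dw t))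
          + (J dg t (w t + dw t) - J dg t (w t))‖ := by congr 1; abel
      _ ≤ C * ‖g‖ * ‖dw‖ * ‖dw t‖ + C * ‖dg‖ * ‖dw t‖ := (norm_add_le _ _).trans (add_le_add e1 e2)
      _ ≤ C * ‖g‖ * ‖(dg, dw)‖ * ‖(dg, dw)‖ + C * ‖(dg, dw)‖ * ‖(dg, dw)‖ := by
          have := h9.trans hdw
          gcongr
      _ = _ := by ring
  rw [hasFDerivAt_iff_isLittleO_nhds_zero, Asymptotics.isLittleO_iff]
  intro c hc
  have hmem : Metric.ball (0 : 𝔾 × Lp W ∞ μ) (min 1 (c / (C * (‖g‖ + 1) + 1))) ∈ 𝓝 0 :=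
    Metric.ball_mem_nhds _ (by positivity)
  filter_upwards [hmem] with d hd
  rw [mem_ball_zero_iff, lt_min_iff] at hd
  refine (key d ((norm_snd_le d).trans hd.1.le)).trans ?_
  gcongr
  have h2 := hd.2.le
  rw [le_div_iff₀ (by positivity)] at h2
  nlinarith [norm_nonneg d]

theorem continuous_opDeriv : Continuous hJ.opDeriv := by
  rw [continuous_iff_continuousAt]
  rintro ⟨g, w⟩
  obtain ⟨C, hC0, hC⟩ := hJ.bound (‖w‖ + 1)
  have key : ∀ p : 𝔾 × Lp W ∞ μ, ‖p.2 - w‖ ≤ 1 →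
      ‖hJ.opDeriv p - hJ.opDeriv (g, w)‖ ≤ C * (‖g‖ + 2) * ‖p - (g, w)‖ := by
    rintro ⟨g', w'⟩ hd
    simp only at hd
    refine ContinuousLinearMap.opNorm_le_bound _ (by positivity) ?_
    rintro ⟨dg, dw⟩
    refine norm_le_of_ae_top (by positivity) ?_
    rw [_root_.sub_apply]
    filter_upwards [hJ.coeFn_opDeriv (g, w) (dg, dw), hJ.coeFn_opDeriv (g', w') (dg, dw),
      Lp.coeFn_sub (hJ.opDeriv (g', w') (dg, dw)) (hJ.opDeriv (g, w) (dg, dw)),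
      hJ.sub g' g, ae_norm_le_norm_top w, ae_norm_le_norm_top dw, ae_norm_le_norm_top (w' - w),
      Lp.coeFn_sub w' w, hC g, hC dg, hC (g' - g), hJ.diff g, hJ.diff dg, hJ.diff g']
      with t h1 h2 h3 h4 h5 h6 h7 h8 h9 h10 h11 h12 h13 h14
    rw [h3, Pi.sub_apply, h1, h2]
    rw [h8, Pi.sub_apply] at h7
    have hw : w t ∈ Metric.closedBall (0 : W) (‖w‖ + 1) := by
      rw [mem_closedBall_zero_iff]; linarith
    have hw' : w' t ∈ Metric.closedBall (0 : W) (‖w‖ + 1) := by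
      rw [mem_closedBall_zero_iff]
      calc ‖w' t‖ = ‖(w' t - w t) + w t‖ := by abel_nf
        _ ≤ _ := norm_add_le _ _
        _ ≤ _ := by linarith
    have e1 : ‖J dg t (w' t) - J dg t (w t)‖ ≤ C * ‖dg‖ * ‖w' t - w t‖ :=
      Convex.norm_image_sub_le_of_norm_fderiv_le (fun x _ => h13 x)
        (fun x hx => (h10 x hx).2.1) (convex_closedBall _ _) hw hw'
    have e2 : fderiv ℝ (J (g' - g) t) (w' t) = fderiv ℝ (J g' t) (w' t)
      - fderiv ℝ (J g t) (w' t) := by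
      rw [h4]
      exact fderiv_sub (h14 _) (h12 _)
    have e3 := (h11 _ hw').2.1
    rw [e2] at e3
    have e4 := (h9 _ hw').2.2 _ hw
    set δ := ‖(g', w') - (g, w)‖ with hδ
    have hg : ‖g' - g‖ ≤ δ := norm_fst_le ((g', w') - (g, w))
    have hw2 : ‖w' - w‖ ≤ δ := norm_snd_le ((g', w') - (g, w))
    have hδ0 : 0 ≤ δ := norm_nonneg _
    have hdg : ‖dg‖ ≤ ‖(dg, dw)‖ := norm_fst_le (dg, dw)
    have hdw : ‖dw‖ ≤ ‖(dg, dw)‖ := norm_snd_le (dg, dw)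
    have h7' := h7.trans hw2
    have h6' := h6.trans hdw
    calc ‖J dg t (w' t) + fderiv ℝ (J g' t) (w' t) (dw t)
          - (J dg t (w t) + fderiv ℝ (J g t) (w t) (dw t))‖
        = ‖(J dg t (w' t) - J dg t (w t))
            + (fderiv ℝ (J g' t) (w' t) - fderiv ℝ (J g t) (w' t)) (dw t)
            + (fderiv ℝ (J g t) (w' t) - fderiv ℝ (J g t) (w t)) (dw t)‖ := by
          congr 1
          simp only [_root_.sub_apply]
          abel
      _ ≤ C * ‖dg‖ * ‖w' t - w t‖ + C * ‖g' - g‖ * ‖dw t‖ + C * ‖g‖ * ‖w' t - w t‖ * ‖dw t‖ := by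
          refine norm_add₃_le.trans (add_le_add (add_le_add e1 ?_) ?_)
          · exact (ContinuousLinearMap.le_opNorm _ _).trans (by gcongr)
          · exact (ContinuousLinearMap.le_opNorm _ _).trans (by gcongr)
      _ ≤ C * ‖(dg, dw)‖ * δ + C * δ * ‖(dg, dw)‖ + C * ‖g‖ * δ * ‖(dg, dw)‖ := by gcongr
      _ = _ := by ring
  rw [ContinuousAt, tendsto_iff_norm_sub_tendsto_zero]
  have hlim : Tendsto (fun p : 𝔾 × Lp W ∞ μ => C * (‖g‖ + 2) * ‖p - (g, w)‖) (𝓝 (g, w)) (𝓝 0) := by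
    have : Continuous fun p : 𝔾 × Lp W ∞ μ => C * (‖g‖ + 2) * ‖p - (g, w)‖ := by fun_prop
    simpa using this.tendsto (g, w)
  refine squeeze_zero' (Eventually.of_forall fun _ => norm_nonneg _) ?_ hlim
  filter_upwards [Metric.ball_mem_nhds (g, w) one_pos] with p hp
  refine key p ?_
  rw [mem_ball_iff_norm] at hp
  exact (norm_snd_le (p - (g, w))).trans hp.le

/-- Superposition operators are continuously differentiable. -/
theorem contDiff_op : ContDiff ℝ 1 hJ.op :=
  contDiff_one_iff_hasFDerivAt.2 ⟨hJ.opDeriv, hJ.continuous_opDeriv, hJ.hasFDerivAt_op⟩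

end IsC1Family

end Nemytskii

/-! ### An implicit function theorem with an incomplete parameter space -/

section Implicit

variable {𝔾 Z R : Type*} [NormedAddCommGroup 𝔾] [NormedSpace ℝ 𝔾] [NormedAddCommGroup Z]
  [NormedSpace ℝ Z] [CompleteSpace Z] [NormedAddCommGroup R] [NormedSpace ℝ R]

/-- The implicit function theorem for `ψ (g, z) = 0`, with a continuously differentiable solution
map. Only the space of the unknown `z` has to be complete: for fixed `g` the map `ψ (g, ·)` is close
to a linear isomorphism, so that the solution comes from a contraction in `z` alone. -/
theorem exists_implicit_solution {ψ : 𝔾 × Z → R} (hψ : ContDiff ℝ 1 ψ) {g₀ : 𝔾} {z₀ : Z}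
    (h0 : ψ (g₀, z₀) = 0) (T : Z ≃L[ℝ] R)
    (hT : (fderiv ℝ ψ (g₀, z₀)).comp (ContinuousLinearMap.inr ℝ 𝔾 Z) = T) :
    ∃ (Ng : Set 𝔾) (Nz : Set Z) (z : 𝔾 → Z) (z' : 𝔾 → 𝔾 →L[ℝ] Z),
      IsOpen Ng ∧ g₀ ∈ Ng ∧ IsOpen Nz ∧ z₀ ∈ Nz ∧ z g₀ = z₀ ∧
      (∀ g ∈ Ng, ∀ w ∈ Nz, ψ (g, w) = 0 ↔ w = z g) ∧ (∀ g ∈ Ng, z g ∈ Nz) ∧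
      (∀ g ∈ Ng, HasFDerivAt z (z' g) g) ∧ ContinuousOn z' Ng ∧
      ∀ g ∈ Ng, (fderiv ℝ ψ (g, z g)).comp ((ContinuousLinearMap.id ℝ 𝔾).prod (z' g)) = 0 := by
  classical
  have hd : Differentiable ℝ ψ := hψ.differentiable one_ne_zero
  have hdc : Continuous (fderiv ℝ ψ) := hψ.continuous_fderiv one_ne_zero
  set Dz : 𝔾 × Z → Z →L[ℝ] R := fun p => (fderiv ℝ ψ p).comp (ContinuousLinearMap.inr ℝ 𝔾 Z)
    with hDz
  have hDzc : Continuous Dz := hdc.clm_comp continuous_const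
  set N : NNReal := ‖(T.symm : R →L[ℝ] Z)‖₊ + 1 with hN
  have hNpos : 0 < N := by positivity
  set c : NNReal := N⁻¹ / 2 with hc
  have hcpos : 0 < c := by positivity
  -- a product neighbourhood on which the partial derivative is invertible and close to `T`
  have hU : ∀ᶠ p in 𝓝 (g₀, z₀), ‖Dz p - T‖ ≤ c ∧ ∃ S : Z ≃L[ℝ] R, (S : Z →L[ℝ] R) = Dz p := by
    refine Filter.Eventually.and ?_ ?_
    · have h1 : Tendsto (fun p => ‖Dz p - T‖) (𝓝 (g₀, z₀)) (𝓝 0) := by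
        have h2 : Continuous fun p => ‖Dz p - T‖ := by fun_prop
        have h3 := h2.tendsto (g₀, z₀)
        have h4 : Dz (g₀, z₀) = T := hT
        rwa [h4, sub_self, norm_zero] at h3
      exact h1.eventually_le_const (by exact_mod_cast hcpos)
    · have h1 : Tendsto Dz (𝓝 (g₀, z₀)) (𝓝 (T : Z →L[ℝ] R)) := by
        have h2 := hDzc.tendsto (g₀, z₀)
        have h4 : Dz (g₀, z₀) = T := hT
        rwa [h4] at h2
      exact h1.eventually (ContinuousLinearEquiv.nhds T)
  rw [nhds_prod_eq, Filter.eventually_prod_iff] at hU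
  obtain ⟨pa, hpa, pb, hpb, hU⟩ := hU
  obtain ⟨δ, hδ, hδa⟩ := Metric.eventually_nhds_iff_ball.1 hpa
  obtain ⟨r, hr, hrb⟩ := Metric.eventually_nhds_iff_ball.1 hpb
  have hU' : ∀ g ∈ Metric.ball g₀ δ, ∀ w ∈ Metric.ball z₀ r,
      ‖Dz (g, w) - T‖ ≤ c ∧ ∃ S : Z ≃L[ℝ] R, (S : Z →L[ℝ] R) = Dz (g, w) :=
    fun g hg w hw => hU (hδa g hg) (hrb w hw)
  have hpart : ∀ g w, HasFDerivAt (fun v => ψ (g, v)) (Dz (g, w)) w := fun g w =>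
    (hd (g, w)).hasFDerivAt.comp w (hasFDerivAt_prodMk_right g w)
  have happ : ∀ g ∈ Metric.ball g₀ δ,
      ApproximatesLinearOn (fun v => ψ (g, v)) (T : Z →L[ℝ] R) (Metric.ball z₀ r) c := by
    intro g hg x hx y hy
    exact Convex.norm_image_sub_le_of_norm_hasFDerivWithin_le'
      (fun w _ => (hpart g w).hasFDerivWithinAt) (fun w hw => (hU' g hg w hw).1)
      (convex_ball _ _) hy hx
  -- stability of the solution, which contains its uniqueness
  have hstab : ∀ g ∈ Metric.ball g₀ δ, ∀ x ∈ Metric.ball z₀ r, ∀ y ∈ Metric.ball z₀ r,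
      ‖x - y‖ ≤ 2 * N * ‖ψ (g, x) - ψ (g, y)‖ := by
    intro g hg x hx y hy
    have h1 := happ g hg x hx y hy
    have h2 : ‖x - y‖ ≤ N * ‖(T : Z →L[ℝ] R) (x - y)‖ := by
      have h3 := (T.symm : R →L[ℝ] Z).le_opNorm (T (x - y))
      simp only [ContinuousLinearEquiv.coe_coe, ContinuousLinearEquiv.symm_apply_apply] at h3 ⊢
      refine h3.trans ?_
      gcongr
      rw [hN]
      push_cast
      simp
    have h4 : ‖(T : Z →L[ℝ] R) (x - y)‖ ≤ ‖ψ (g, x) - ψ (g, y)‖ + c * ‖x - y‖ := by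
      calc ‖(T : Z →L[ℝ] R) (x - y)‖
          = ‖(ψ (g, x) - ψ (g, y)) - (ψ (g, x) - ψ (g, y) - (T : Z →L[ℝ] R) (x - y))‖ := by
            congr 1; abel
        _ ≤ _ := (norm_sub_le _ _).trans (by gcongr)
    have h5 : (N : ℝ) * c = 1 / 2 := by
      rw [hc]
      push_cast
      have : (N : ℝ) ≠ 0 := by exact_mod_cast hNpos.ne'
      field_simp
    have h6 : (N : ℝ) * ‖(T : Z →L[ℝ] R) (x - y)‖
        ≤ N * (‖ψ (g, x) - ψ (g, y)‖ + c * ‖x - y‖) := by gcongr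
    have h7 : (N : ℝ) * (‖ψ (g, x) - ψ (g, y)‖ + c * ‖x - y‖)
        = N * ‖ψ (g, x) - ψ (g, y)‖ + 1 / 2 * ‖x - y‖ := by rw [← h5]; ring
    linarith
  let Tinv : (T : Z →L[ℝ] R).NonlinearRightInverse :=
    { toFun := T.symm
      nnnorm := N
      bound' := fun y => by
        refine ((T.symm : R →L[ℝ] Z).le_opNorm y).trans ?_
        gcongr
        rw [hN]
        push_cast
        simp
      right_inv' := fun y => by simp }
  set Ng : Set 𝔾 := Metric.ball g₀ δ ∩ {g | ‖ψ (g, z₀)‖ < c * (r / 2)} with hNg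
  have hNgo : IsOpen Ng := by
    refine Metric.isOpen_ball.inter (isOpen_lt ?_ continuous_const)
    have := hψ.continuous
    fun_prop
  have hex : ∀ g ∈ Ng, ∃ w ∈ Metric.ball z₀ r, ψ (g, w) = 0 := by
    intro g hg
    have hsub : Metric.closedBall z₀ (r / 2) ⊆ Metric.ball z₀ r :=
      Metric.closedBall_subset_ball (by linarith)
    have h1 := (happ g hg.1).surjOn_closedBall_of_nonlinearRightInverse Tinv (by positivity) hsub
    have h2 : (0 : R) ∈ Metric.closedBall (ψ (g, z₀)) (((N⁻¹ : NNReal) - c : ℝ) * (r / 2)) := by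
      rw [mem_closedBall_iff_norm, zero_sub, norm_neg]
      have h3 : ((N⁻¹ : NNReal) : ℝ) - c = c := by
        rw [hc]; push_cast; ring
      rw [h3]
      exact hg.2.le
    obtain ⟨w, hw, hw0⟩ := h1 h2
    exact ⟨w, hsub hw, hw0⟩
  choose! z hzmem hz0 using hex
  have hg₀ : g₀ ∈ Ng := by
    refine ⟨Metric.mem_ball_self hδ, ?_⟩
    simp only [mem_ofPred_eq, h0, norm_zero]
    positivity
  have huniq : ∀ g ∈ Ng, ∀ w ∈ Metric.ball z₀ r, ψ (g, w) = 0 ↔ w = z g := by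
    intro g hg w hw
    constructor
    · intro h
      have := hstab g hg.1 w hw (z g) (hzmem g hg)
      rw [h, hz0 g hg, sub_zero, norm_zero, mul_zero] at this
      exact sub_eq_zero.1 (norm_le_zero_iff.1 this)
    · rintro rfl
      exact hz0 g hg
  have hO : ∀ g ∈ Ng, (fun h => z h - z g) =O[𝓝 g] fun h => h - g := by
    intro g hg
    have hdg : HasFDerivAt (fun h => ψ (h, z g))
        ((fderiv ℝ ψ (g, z g)).comp (ContinuousLinearMap.inl ℝ 𝔾 Z)) g :=
      (hd (g, z g)).hasFDerivAt.comp g (hasFDerivAt_prodMk_left g (z g))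
    refine Asymptotics.IsBigO.trans (Asymptotics.IsBigO.of_bound (2 * N) ?_) hdg.isBigO_sub
    filter_upwards [hNgo.mem_nhds hg] with h hh
    refine (hstab h hh.1 _ (hzmem h hh) _ (hzmem g hg)).trans ?_
    rw [hz0 h hh, hz0 g hg, zero_sub, sub_zero, norm_neg]
  have hcont : ∀ g ∈ Ng, ContinuousAt z g := by
    intro g hg
    have h1 : Tendsto (fun h => h - g) (𝓝 g) (𝓝 0) := by
      have : Continuous fun h : 𝔾 => h - g := by fun_prop
      simpa using this.tendsto g
    have h2 := (hO g hg).trans_tendsto h1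
    have h3 := h2.add_const (z g)
    simpa [ContinuousAt] using h3
  refine ⟨Ng, Metric.ball z₀ r, z,
    fun g => -((Dz (g, z g)).inverse.comp
      ((fderiv ℝ ψ (g, z g)).comp (ContinuousLinearMap.inl ℝ 𝔾 Z))),
    hNgo, hg₀, Metric.isOpen_ball, Metric.mem_ball_self hr,
    ((huniq g₀ hg₀ z₀ (Metric.mem_ball_self hr)).1 h0).symm, huniq, hzmem, ?_, ?_, ?_⟩
  · intro g hg
    obtain ⟨S, hS⟩ := (hU' g hg.1 _ (hzmem g hg)).2
    rw [hasFDerivAt_iff_isLittleO]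
    have h1 : (fun h => ψ (h, z h) - ψ (g, z g) - fderiv ℝ ψ (g, z g) ((h, z h) - (g, z g)))
        =o[𝓝 g] fun h => h - g := by
      have h2 := hasFDerivAt_iff_isLittleO.1 (hd (g, z g)).hasFDerivAt
      have h3 : Tendsto (fun h => (h, z h)) (𝓝 g) (𝓝 (g, z g)) :=
        (continuousAt_id.prodMk (hcont g hg)).tendsto
      refine (h2.comp_tendsto h3).trans_isBigO ?_
      exact (Asymptotics.isBigO_refl _ _).prod_left (hO g hg)
    have h4 := ((S.symm : R →L[ℝ] Z).isBigO_comp _ (𝓝 g)).trans_isLittleO h1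
    refine h4.neg_left.congr' ?_ EventuallyEq.rfl
    filter_upwards [hNgo.mem_nhds hg] with h hh
    rw [hz0 h hh, hz0 g hg, sub_zero, zero_sub, map_neg, neg_neg]
    have h5 : fderiv ℝ ψ (g, z g) ((h, z h) - (g, z g))
        = (fderiv ℝ ψ (g, z g)).comp (ContinuousLinearMap.inl ℝ 𝔾 Z) (h - g)
          + (S : Z →L[ℝ] R) (z h - z g) := by
      rw [hS, hDz]
      simp only [ContinuousLinearMap.comp_apply, ContinuousLinearMap.inl_apply,
        ContinuousLinearMap.inr_apply, ← map_add]
      simp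
    rw [h5, ← hS, ContinuousLinearMap.inverse_equiv, map_add]
    simp only [ContinuousLinearEquiv.coe_coe, ContinuousLinearEquiv.symm_apply_apply,
      _root_.neg_apply, ContinuousLinearMap.comp_apply]
    abel
  · intro g hg
    refine ContinuousAt.continuousWithinAt ?_
    obtain ⟨S, hS⟩ := (hU' g hg.1 _ (hzmem g hg)).2
    have h3 : ContinuousAt (fun h => (h, z h)) g := continuousAt_id.prodMk (hcont g hg)
    have h4 : ContinuousAt (fun h => (Dz (h, z h)).inverse) g := by
      have h5 : ContinuousAt ContinuousLinearMap.inverse (Dz (g, z g)) := by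
        rw [← hS]
        exact (contDiffAt_map_inverse (n := 0) S).continuousAt
      exact ContinuousAt.comp (f := fun h => Dz (h, z h)) h5
        (ContinuousAt.comp (f := fun h => (h, z h)) hDzc.continuousAt h3)
    have h6 : ContinuousAt (fun h => (fderiv ℝ ψ (h, z h)).comp
      (ContinuousLinearMap.inl ℝ 𝔾 Z)) g :=
      (ContinuousAt.comp (f := fun h => (h, z h)) hdc.continuousAt h3).clm_comp continuousAt_const
    exact (h4.clm_comp h6).neg
  · intro g hg
    obtain ⟨S, hS⟩ := (hU' g hg.1 _ (hzmem g hg)).2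
    ext h
    have h5 : ∀ v, fderiv ℝ ψ (g, z g) (h, v)
        = (fderiv ℝ ψ (g, z g)).comp (ContinuousLinearMap.inl ℝ 𝔾 Z) h + (S : Z →L[ℝ] R) v := by
      intro v
      rw [hS, hDz]
      simp only [ContinuousLinearMap.comp_apply, ContinuousLinearMap.inl_apply,
        ContinuousLinearMap.inr_apply, ← map_add]
      simp
    rw [ContinuousLinearMap.comp_apply, ContinuousLinearMap.prod_apply]
    rw [ContinuousLinearMap.id_apply, h5]
    beta_reduce
    rw [← hS, ContinuousLinearMap.inverse_equiv]
    simp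

end Implicit

/-! ### Absolutely continuous functions -/

namespace TimeInterval

variable (I : TimeInterval) {E : Type*} [NormedAddCommGroup E]

theorem vol_eq : I.vol = volume.restrict (Ioc I.t0 I.tf) := by
  rw [vol, Measure.restrict_congr_set Ioo_ae_eq_Ioc]

theorem left_mem : I.t0 ∈ Icc I.t0 I.tf := left_mem_Icc.2 I.lt.le

theorem right_mem : I.tf ∈ Icc I.t0 I.tf := right_mem_Icc.2 I.lt.le

theorem ae_mem_Icc : ∀ᵐ t ∂I.vol, t ∈ Icc I.t0 I.tf :=
  (ae_restrict_mem measurableSet_Ioo).mono fun _ h => Ioo_subset_Icc_self h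

theorem integral_vol [NormedSpace ℝ E] (f : ℝ → E) :
    ∫ t, f t ∂I.vol = ∫ t in I.t0..I.tf, f t := by
  rw [vol_eq, intervalIntegral.integral_of_le I.lt.le]

theorem intervalIntegral_vol [NormedSpace ℝ E] (f : ℝ → E) {t : ℝ} (ht : t ∈ Icc I.t0 I.tf) :
    ∫ s in I.t0..t, f s ∂I.vol = ∫ s in I.t0..t, f s := by
  rw [intervalIntegral.integral_of_le ht.1, intervalIntegral.integral_of_le ht.1, vol_eq,
    Measure.restrict_restrict measurableSet_Ioc, inter_eq_left.2 (Ioc_subset_Ioc_right ht.2)]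

theorem intervalIntegrable_of_vol {f : ℝ → E} (hf : Integrable f I.vol) {t : ℝ}
    (ht : t ∈ Icc I.t0 I.tf) : IntervalIntegrable f volume I.t0 t := by
  rw [vol_eq] at hf
  have h : IntervalIntegrable f volume I.t0 I.tf :=
    (intervalIntegrable_iff_integrableOn_Ioc_of_le I.lt.le).2 hf
  refine h.mono_set ?_
  rw [uIcc_of_le ht.1, uIcc_of_le I.lt.le]
  exact Icc_subset_Icc_right ht.2

/-- `x` is the primitive of `v` on the interval. -/
def IsPrimitive [NormedSpace ℝ E] (x v : ℝ → E) : Prop :=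
  Integrable v I.vol ∧ ∀ t ∈ Icc I.t0 I.tf, x t = x I.t0 + ∫ s in I.t0..t, v s

namespace IsPrimitive

variable {I} [NormedSpace ℝ E] {x v y w : ℝ → E}

theorem continuousOn (h : I.IsPrimitive x v) : ContinuousOn x (Icc I.t0 I.tf) := by
  have h1 : ContinuousOn (fun t => ∫ s in I.t0..t, v s) (uIcc I.t0 I.tf) := by
    refine intervalIntegral.continuousOn_primitive_interval ?_
    have h2 := h.1
    rw [vol_eq] at h2
    rw [uIcc_of_le I.lt.le, integrableOn_Icc_iff_integrableOn_Ioc]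
    exact h2
  rw [uIcc_of_le I.lt.le] at h1
  exact (continuousOn_const.add h1).congr h.2

theorem memLp (h : I.IsPrimitive x v) (p : ℝ≥0∞) : MemLp x p I.vol := by
  obtain ⟨C, hC⟩ := isCompact_Icc.exists_bound_of_continuousOn h.continuousOn
  refine MemLp.of_bound ?_ C ?_
  · exact (h.continuousOn.aestronglyMeasurable measurableSet_Icc).mono_measure
      (Measure.restrict_mono Ioo_subset_Icc_self le_rfl)
  · filter_upwards [I.ae_mem_Icc] with t ht using hC t ht

theorem add (h : I.IsPrimitive x v) (k : I.IsPrimitive y w) : I.IsPrimitive (x + y) (v + w) := by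
  refine ⟨h.1.add k.1, fun t ht => ?_⟩
  have := intervalIntegral.integral_add (I.intervalIntegrable_of_vol h.1 ht)
    (I.intervalIntegrable_of_vol k.1 ht)
  simp only [Pi.add_apply]
  rw [this, h.2 t ht, k.2 t ht]
  abel

theorem const_smul (c : ℝ) (h : I.IsPrimitive x v) : I.IsPrimitive (c • x) (c • v) := by
  refine ⟨h.1.smul c, fun t ht => ?_⟩
  simp only [Pi.smul_apply]
  rw [intervalIntegral.integral_smul, h.2 t ht, smul_add]

theorem clm_comp {F : Type*} [NormedAddCommGroup F] [NormedSpace ℝ F] [CompleteSpace E]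
    [CompleteSpace F] (h : I.IsPrimitive x v) (T : E →L[ℝ] F) :
    I.IsPrimitive (fun t => T (x t)) (fun t => T (v t)) := by
  refine ⟨T.integrable_comp h.1, fun t ht => ?_⟩
  rw [T.intervalIntegral_comp_comm (I.intervalIntegrable_of_vol h.1 ht), ← map_add, ← h.2 t ht]

/-- A primitive agrees with an absolutely continuous function that has the given derivative. -/
theorem exists_absolutelyContinuous {f f' : ℝ → ℝ} (h : I.IsPrimitive f f') :
    ∃ F : ℝ → ℝ, AbsolutelyContinuousOnInterval F I.t0 I.tf ∧ EqOn F f (Icc I.t0 I.tf) ∧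
      ∀ᵐ t ∂I.vol, deriv F t = f' t := by
  have hi := I.intervalIntegrable_of_vol h.1 I.right_mem
  refine ⟨fun t => f I.t0 + ∫ s in I.t0..t, f' s, ?_, fun t ht => (h.2 t ht).symm, ?_⟩
  · have h1 : AbsolutelyContinuousOnInterval (fun _ : ℝ => f I.t0) I.t0 I.tf :=
      (LipschitzWith.const (f I.t0)).lipschitzOnWith.absolutelyContinuousOnInterval
    exact h1.add (hi.absolutelyContinuousOnInterval_intervalIntegral left_mem_uIcc)
  · have h2 := hi.ae_hasDerivAt_integral
    rw [vol_eq]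
    filter_upwards [ae_restrict_of_ae h2, ae_restrict_mem measurableSet_Ioc] with t h3 h4
    have h5 : t ∈ uIcc I.t0 I.tf := by
      rw [uIcc_of_le I.lt.le]; exact Ioc_subset_Icc_self h4
    exact ((h3 h5 I.t0 left_mem_uIcc).const_add _).deriv

theorem integral_mul_add {f f' g g' : ℝ → ℝ} (hf : I.IsPrimitive f f') (hg : I.IsPrimitive g g') :
    ∫ t, (f' t * g t + f t * g' t) ∂I.vol = f I.tf * g I.tf - f I.t0 * g I.t0 := by
  obtain ⟨F, hF, hFf, hF'⟩ := hf.exists_absolutelyContinuous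
  obtain ⟨G, hG, hGg, hG'⟩ := hg.exists_absolutelyContinuous
  rw [← hFf I.right_mem, ← hFf I.left_mem, ← hGg I.right_mem, ← hGg I.left_mem,
    ← hF.integral_deriv_mul_eq_sub hG, ← I.integral_vol]
  refine integral_congr_ae ?_
  filter_upwards [hF', hG', I.ae_mem_Icc] with t h1 h2 h3
  rw [h1, h2, hFf h3, hGg h3]

theorem integrable_mul_left {f f' g g' : ℝ → ℝ} (hf : I.IsPrimitive f f')
    (hg : I.IsPrimitive g g') : Integrable (fun t => f' t * g t) I.vol := by
  have h1 := hg.memLp ∞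
  exact hf.1.mul_bdd (c := (eLpNorm g ∞ I.vol).toReal) h1.1 (ae_norm_le_eLpNorm_top h1)

/-- Integration by parts. -/
theorem integral_inner_add {n : ℕ} {x v y w : ℝ → Rn n} (hx : I.IsPrimitive x v)
    (hy : I.IsPrimitive y w) :
    ∫ t, (⟪v t, y t⟫_ℝ + ⟪x t, w t⟫_ℝ) ∂I.vol = ⟪x I.tf, y I.tf⟫_ℝ - ⟪x I.t0, y I.t0⟫_ℝ := by
  have hc : ∀ (i : Fin n) {z z' : ℝ → Rn n}, I.IsPrimitive z z' →
      I.IsPrimitive (fun t => z t i) (fun t => z' t i) := fun i z z' h =>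
    h.clm_comp (EuclideanSpace.proj (𝕜 := ℝ) i)
  have e : ∀ a b : Rn n, ⟪a, b⟫_ℝ = ∑ i, a i * b i := fun a b => by
    simp [PiLp.inner_apply, mul_comm]
  simp_rw [e, ← Finset.sum_add_distrib, ← Finset.sum_sub_distrib]
  rw [integral_finsetSum]
  · exact Finset.sum_congr rfl fun i _ => (hc i hx).integral_mul_add (hc i hy)
  · intro i _
    refine ((hc i hx).integrable_mul_left (hc i hy)).add ?_
    simpa only [mul_comm] using (hc i hy).integrable_mul_left (hc i hx)

end IsPrimitive

end TimeInterval

/-! ### Sobolev spaces -/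

namespace W1

variable {I : TimeInterval} {q : ℝ≥0∞} [hq : Fact (1 ≤ q)] {n : ℕ}

theorem val_apply (x : W1 I q n) (t : Icc I.t0 I.tf) : x.val t = x.pair.1 t :=
  IccExtend_val _ _ _

theorem continuous_val (x : W1 I q n) : Continuous x.val :=
  x.pair.1.continuous.Icc_extend'

theorem memLp_der (x : W1 I q n) : MemLp x.der q I.vol := Lp.memLp _

theorem isPrimitive (x : W1 I q n) : I.IsPrimitive x.val x.der := by
  refine ⟨x.memLp_der.integrable hq.out, fun t ht => ?_⟩
  rw [← I.intervalIntegral_vol _ ht]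
  have := x.2 ⟨t, ht⟩
  rw [x.val_apply ⟨t, ht⟩, x.val_apply ⟨I.t0, I.left_mem⟩]
  exact this

/-- The element of `W^{1,q}` with given values and derivative. -/
def ofPrimitive (x v : ℝ → Rn n) (h : I.IsPrimitive x v) (hv : MemLp v q I.vol) : W1 I q n :=
  ⟨(⟨(Icc I.t0 I.tf).domRestrict x, h.continuousOn.domRestrict⟩, hv.toLp), by
    intro t
    have h1 : ∫ s in I.t0..t, (hv.toLp : ℝ → Rn n) s ∂I.vol = ∫ s in I.t0..t, v s ∂I.vol :=
      intervalIntegral.integral_congr_ae (hv.coeFn_toLp.mono fun s hs _ => hs)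
    change x t = x I.t0 + ∫ s in I.t0..t, (hv.toLp : ℝ → Rn n) s ∂I.vol
    rw [h1, I.intervalIntegral_vol _ t.2]
    exact h.2 t t.2⟩

theorem ofPrimitive_val {x v : ℝ → Rn n} (h : I.IsPrimitive x v) (hv : MemLp v q I.vol) {t : ℝ}
    (ht : t ∈ Icc I.t0 I.tf) : (ofPrimitive x v h hv).val t = x t :=
  (ofPrimitive x v h hv).val_apply ⟨t, ht⟩

theorem ofPrimitive_der {x v : ℝ → Rn n} (h : I.IsPrimitive x v) (hv : MemLp v q I.vol) :
    (ofPrimitive x v h hv).der =ᵐ[I.vol] v := hv.coeFn_toLp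

theorem ext_of_val {x y : W1 I q n} (h : ∀ t ∈ Icc I.t0 I.tf, x.val t = y.val t)
    (h' : x.der =ᵐ[I.vol] y.der) : x = y := by
  refine Subtype.ext (Prod.ext ?_ ?_)
  · ext1 t
    have := h t t.2
    rwa [val_apply, val_apply] at this
  · exact Lp.ext h'

@[simp] theorem val_sub (x y : W1 I q n) (t : ℝ) : (x - y).val t = x.val t - y.val t := rfl

@[simp] theorem val_zero (t : ℝ) : (0 : W1 I q n).val t = 0 := rfl

theorem der_sub (x y : W1 I q n) : (x - y).der =ᵐ[I.vol] x.der - y.der := Lp.coeFn_sub _ _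

/-- The derivative of an element of `W^{1,q}` is determined by its values. -/
theorem eq_of_val {x y : W1 I q n} (h : ∀ t ∈ Icc I.t0 I.tf, x.val t = y.val t) : x = y := by
  refine ext_of_val h ?_
  have hd : Integrable (x - y).der I.vol := (x - y).memLp_der.integrable hq.out
  have hI : ∀ t ∈ Icc I.t0 I.tf, ∫ s in I.t0..t, (x - y).der s = 0 := by
    intro t ht
    have h1 := (x - y).isPrimitive.2 t ht
    rw [val_sub, val_sub, h t ht, h _ I.left_mem, sub_self, sub_self, zero_add] at h1
    exact h1.symm
  have h0 : ∀ᵐ t ∂I.vol, (x - y).der t = 0 := by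
    have h2 := (I.intervalIntegrable_of_vol hd I.right_mem).ae_hasDerivAt_integral
    rw [TimeInterval.vol, ae_restrict_iff' measurableSet_Ioo]
    filter_upwards [h2] with t ht hm
    have h3 := ht (by rw [uIcc_of_le I.lt.le]; exact Ioo_subset_Icc_self hm) I.t0 left_mem_uIcc
    have h4 : (fun t => ∫ s in I.t0..t, (x - y).der s) =ᶠ[𝓝 t] fun _ => 0 := by
      filter_upwards [Ioo_mem_nhds hm.1 hm.2] with s hs using hI s (Ioo_subset_Icc_self hs)
    exact h3.unique ((hasDerivAt_const t (0 : Rn n)).congr_of_eventuallyEq h4)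
  filter_upwards [h0, der_sub x y] with t h1 h2
  rw [h2] at h1
  exact sub_eq_zero.1 h1

theorem norm_val_le (x : W1 I q n) (t : ℝ) : ‖x.val t‖ ≤ ‖x‖ :=
  (x.pair.1.norm_coe_le_norm (projIcc I.t0 I.tf I.lt.le t)).trans (norm_fst_le x.pair)

/-- Evaluation at a time. -/
def evalL (t : ℝ) : W1 I q n →L[ℝ] Rn n :=
  LinearMap.mkContinuous
    { toFun := fun x => x.val t, map_add' := fun _ _ => rfl, map_smul' := fun _ _ => rfl } 1
    fun x => (x.norm_val_le t).trans (one_mul ‖x‖).ge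

/-- The derivative as a continuous linear map into `L^q`. -/
def derL : W1 I q n →L[ℝ] Lq I q n :=
  LinearMap.mkContinuous
    { toFun := fun x => x.pair.2, map_add' := fun _ _ => rfl, map_smul' := fun _ _ => rfl } 1
    fun x => (norm_snd_le x.pair).trans (one_mul ‖x‖).ge

theorem memLp_val (x : W1 I q n) (p : ℝ≥0∞) : MemLp x.val p I.vol := x.isPrimitive.memLp p

/-- The inclusion of `W^{1,q}` into `L^∞`. -/
def valL : W1 I q n →L[ℝ] Lq I ∞ n :=
  LinearMap.mkContinuous
    { toFun := fun x => (x.memLp_val ∞).toLp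
      map_add' := fun x y => by
        rw [← MemLp.toLp_add]
        rfl
      map_smul' := fun c x => by
        rw [RingHom.id_apply, ← MemLp.toLp_const_smul]
        rfl } 1
    fun x => by
      refine norm_le_of_ae_top (by positivity) ?_
      filter_upwards [(x.memLp_val ∞).coeFn_toLp] with t ht
      simp only [LinearMap.coe_mk, AddHom.coe_mk]
      rw [ht, one_mul]
      exact x.norm_val_le t

theorem coeFn_valL (x : W1 I q n) : valL x =ᵐ[I.vol] x.val := (x.memLp_val ∞).coeFn_toLp

instance : CompleteSpace (W1 I q n) := by
  have hcl : IsClosed (w1Submodule I q n : Set (C(Icc I.t0 I.tf, Rn n) × Lq I q n)) := by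
    have : (w1Submodule I q n : Set (C(Icc I.t0 I.tf, Rn n) × Lq I q n)) =
        ⋂ t : Icc I.t0 I.tf, {z | z.1 t = z.1 ⟨I.t0, left_mem_Icc.2 I.lt.le⟩
          + ∫ s in I.t0..t, z.2 s ∂I.vol} := by
      ext z
      rw [mem_iInter]
      rfl
    rw [this]
    refine isClosed_iInter fun t => isClosed_eq (by fun_prop) (Continuous.add (by fun_prop) ?_)
    have hc : Continuous fun v : Lq I q n => ∫ s in I.t0..t, v s ∂I.vol := by
      let T : Lq I q n →ₗ[ℝ] Rn n :=
        { toFun := fun v => ∫ s in I.t0..t, v s ∂I.vol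
          map_add' := fun a b => by
            have hint : ∀ c : Lq I q n, IntervalIntegrable c I.vol I.t0 t := fun c =>
              ((Lp.memLp c).integrable hq.out).intervalIntegrable
            rw [← intervalIntegral.integral_add (hint _) (hint _)]
            exact intervalIntegral.integral_congr_ae ((Lp.coeFn_add a b).mono fun s hs _ => hs)
          map_smul' := fun c a => by
            rw [RingHom.id_apply, ← intervalIntegral.integral_smul]
            exact intervalIntegral.integral_congr_ae ((Lp.coeFn_smul c a).mono fun s hs _ => hs) }
      refine (T.mkContinuousOfExistsBound ?_).continuous
      refine ⟨(I.vol univ ^ (1 / (1 : ℝ≥0∞).toReal - 1 / q.toReal)).toReal, fun v => ?_⟩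
      have h1 : ‖∫ s in I.t0..t, v s ∂I.vol‖ ≤ ∫ s, ‖v s‖ ∂I.vol := by
        refine (intervalIntegral.norm_integral_le_integral_norm_uIoc).trans ?_
        exact setIntegral_le_integral ((Lp.memLp v).integrable hq.out).norm
          (Eventually.of_forall fun _ => norm_nonneg _)
      refine h1.trans ?_
      rw [integral_norm_eq_lintegral_enorm (Lp.aestronglyMeasurable v),
        ← eLpNorm_one_eq_lintegral_enorm, Lp.norm_def, mul_comm, ← ENNReal.toReal_mul]
      refine ENNReal.toReal_mono (ENNReal.mul_ne_top (Lp.eLpNorm_ne_top v) ?_)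
        (eLpNorm_le_eLpNorm_mul_rpow_measure_univ hq.out (Lp.aestronglyMeasurable v))
      refine ENNReal.rpow_ne_top_of_nonneg ?_ (measure_ne_top _ _)
      rcases eq_or_ne q ∞ with rfl | hq'
      · simp
      · have : 1 ≤ q.toReal := by
          have := ENNReal.toReal_mono hq' hq.out
          simpa using this
        rw [ENNReal.toReal_one, sub_nonneg]
        exact one_div_le_one_div_of_le one_pos this
    exact hc.comp continuous_snd
  exact hcl.completeSpace_coe

end W1

/-! ### Linear differential equations with bounded measurable coefficients -/

/-- Existence for linear Carathéodory equations: some iterate of the integral operator is a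
contraction. -/
theorem exists_linear_ode (I : TimeInterval) {E : Type*} [NormedAddCommGroup E] [NormedSpace ℝ E]
    [CompleteSpace E] {M : ℝ → E →L[ℝ] E} {h : ℝ → E} (hM : MemLp M ∞ I.vol)
    (hh : Integrable h I.vol) (X₀ : E) :
    ∃ X : ℝ → E, Continuous X ∧ X I.t0 = X₀ ∧ I.IsPrimitive X (fun t => M t (X t) + h t) := by
  set K : ℝ := (eLpNorm M ∞ I.vol).toReal with hK
  have hK0 : 0 ≤ K := ENNReal.toReal_nonneg
  have hMK : ∀ᵐ t ∂I.vol, ‖M t‖ ≤ K := ae_norm_le_eLpNorm_top hM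
  have hint : ∀ X : C(Icc I.t0 I.tf, E), Integrable (fun t => M t
    (IccExtend I.lt.le X t)) I.vol := by
    intro X
    have hX : Continuous (IccExtend I.lt.le X) := X.continuous.Icc_extend'
    refine Integrable.of_bound (C := K * ‖X‖) ?_ ?_
    · exact (ContinuousLinearMap.id ℝ (E →L[ℝ] E)).aestronglyMeasurable_comp₂ hM.1
        hX.aestronglyMeasurable
    · filter_upwards [hMK] with t ht
      refine (ContinuousLinearMap.le_opNorm _ _).trans ?_
      gcongr
      exact X.norm_coe_le_norm _
  have hprim : ∀ X : C(Icc I.t0 I.tf, E), I.IsPrimitive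
      (fun t => X₀ + ∫ s in I.t0..t, (M s (IccExtend I.lt.le X s) + h s))
      (fun t => M t (IccExtend I.lt.le X t) + h t) := by
    intro X
    refine ⟨(hint X).add hh, fun t _ => ?_⟩
    simp
  let T : C(Icc I.t0 I.tf, E) → C(Icc I.t0 I.tf, E) := fun X =>
    ⟨(Icc I.t0 I.tf).domRestrict fun t => X₀ + ∫ s in I.t0..t, (M s (IccExtend I.lt.le X s) + h s),
      (hprim X).continuousOn.domRestrict⟩
  have hTdiff : ∀ X Y : C(Icc I.t0 I.tf, E), ∀ t : Icc I.t0 I.tf,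
      T X t - T Y t = ∫ s in I.t0..t, M s (IccExtend I.lt.le X s - IccExtend I.lt.le Y s) := by
    intro X Y t
    have e : T X t - T Y t = (X₀ + ∫ s in I.t0..t, (M s (IccExtend I.lt.le X s) + h s))
      - (X₀ + ∫ s in I.t0..t, (M s (IccExtend I.lt.le Y s) + h s)) := rfl
    have hi : ∀ Z : C(Icc I.t0 I.tf, E), IntervalIntegrable
        (fun s => M s (IccExtend I.lt.le Z s) + h s) volume I.t0 t :=
      fun Z => I.intervalIntegrable_of_vol ((hint Z).add hh) t.2
    rw [e, add_sub_add_left_eq_sub, ← intervalIntegral.integral_sub (hi X) (hi Y)]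
    refine intervalIntegral.integral_congr fun s _ => ?_
    simp only [map_sub]
    abel
  have hiter : ∀ (k : ℕ) (X Y : C(Icc I.t0 I.tf, E)) (t : Icc I.t0 I.tf),
      ‖T^[k] X t - T^[k] Y t‖ ≤ (K * (t - I.t0)) ^ k / k.factorial * dist X Y := by
    intro k X Y
    induction k with
    | zero =>
      intro t
      simpa [dist_eq_norm] using ContinuousMap.norm_coe_le_norm (X - Y) t
    | succ k ih =>
      intro t
      rw [Function.iterate_succ_apply', Function.iterate_succ_apply', hTdiff]
      have hint2 : IntervalIntegrable (fun s : ℝ => K ^ (k + 1) / k.factorial * dist X Y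
          * (s - I.t0) ^ k) volume I.t0 t := by
        refine Continuous.intervalIntegrable ?_ _ _
        fun_prop
      have hb : ∀ᵐ s ∂volume, s ∈ Ioc I.t0 (t : ℝ) →
          ‖M s (IccExtend I.lt.le (T^[k] X) s - IccExtend I.lt.le (T^[k] Y) s)‖
            ≤ K ^ (k + 1) / k.factorial * dist X Y * (s - I.t0) ^ k := by
        have h1 := hMK
        rw [I.vol_eq, ae_restrict_iff' measurableSet_Ioc] at h1
        filter_upwards [h1] with s hs hst
        have hsI : s ∈ Icc I.t0 I.tf := ⟨hst.1.le, hst.2.trans t.2.2⟩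
        refine (ContinuousLinearMap.le_opNorm _ _).trans ?_
        have h2 := ih ⟨s, hsI⟩
        rw [← IccExtend_of_mem I.lt.le (T^[k] X) hsI,
          ← IccExtend_of_mem I.lt.le (T^[k] Y) hsI] at h2
        calc ‖M s‖ * ‖IccExtend I.lt.le (T^[k] X) s - IccExtend I.lt.le (T^[k] Y) s‖
            ≤ K * ((K * (s - I.t0)) ^ k / k.factorial * dist X Y) := by
              gcongr
              exact hs ⟨hst.1, hsI.2⟩
          _ = _ := by rw [mul_pow]; ring
      refine (intervalIntegral.norm_integral_le_of_norm_le t.2.1 hb hint2).trans (le_of_eq ?_)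
      rw [intervalIntegral.integral_const_mul, intervalIntegral.integral_comp_sub_right
        (fun s => s ^ k), sub_self, integral_pow, mul_pow, Nat.factorial_succ]
      push_cast
      field_simp
      simp
  have hlim := FloorSemiring.tendsto_pow_div_factorial_atTop (K * (I.tf - I.t0))
  obtain ⟨k, hk⟩ := (hlim.eventually_lt_const (one_half_pos (α := ℝ))).exists
  have hcontr : ContractingWith (1 / 2) T^[k] := by
    refine ⟨by norm_num [← NNReal.coe_lt_coe], LipschitzWith.of_dist_le_mul fun X Y => ?_⟩
    refine (ContinuousMap.dist_le (by positivity)).2 fun t => ?_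
    rw [dist_eq_norm]
    refine (hiter k X Y t).trans ?_
    gcongr
    refine le_trans ?_ (le_of_lt (by simpa using hk))
    have h1 : (0 : ℝ) ≤ t - I.t0 := sub_nonneg.2 t.2.1
    have h2 : (t : ℝ) ≤ I.tf := t.2.2
    gcongr
  have hfix := hcontr.isFixedPt_fixedPoint_iterate
  set X := ContractingWith.fixedPoint T^[k] hcontr
  have hval : ∀ t ∈ Icc I.t0 I.tf, IccExtend I.lt.le X t
      = X₀ + ∫ s in I.t0..t, (M s (IccExtend I.lt.le X s) + h s) := by
    intro t ht
    rw [IccExtend_of_mem _ _ ht]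
    conv_lhs => rw [← hfix.eq]
    rfl
  have h0 : IccExtend I.lt.le X I.t0 = X₀ := by
    rw [hval _ I.left_mem]; simp
  refine ⟨IccExtend I.lt.le X, X.continuous.Icc_extend', h0, (hint X).add hh, fun t ht => ?_⟩
  rw [h0]
  exact hval t ht

/-! ### Pairings and bounds in Lebesgue spaces -/

section MemLp

variable {α : Type*} {m : MeasurableSpace α} {μ : Measure α} {E F G : Type*}
  [NormedAddCommGroup E] [NormedSpace ℝ E] [NormedAddCommGroup F] [NormedSpace ℝ F]
  [NormedAddCommGroup G] [NormedSpace ℝ G]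

theorem memLp_clm_apply {p q : ℝ≥0∞} (r : ℝ≥0∞) [ENNReal.HolderTriple p q r] {T : α → E →L[ℝ] F}
    {v : α → E} (hT : MemLp T p μ) (hv : MemLp v q μ) : MemLp (fun t => T t (v t)) r μ :=
  (ContinuousLinearMap.id ℝ (E →L[ℝ] F)).memLp_of_bilin r hT hv

theorem memLp_map {p : ℝ≥0∞} (L : E →L[ℝ] F) {v : α → E} (hv : MemLp v p μ) :
    MemLp (fun t => L (v t)) p μ := L.comp_memLp' hv

theorem integral_inner_const {n : ℕ} {f : α → Rn n} (hf : Integrable f μ) (c : Rn n) :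
    ∫ t, ⟪f t, c⟫_ℝ ∂μ = ⟪∫ t, f t ∂μ, c⟫_ℝ := by
  rw [real_inner_comm, ← integral_inner (𝕜 := ℝ) hf]
  exact integral_congr_ae (Eventually.of_forall fun t => real_inner_comm _ _)

omit [NormedSpace ℝ E] in
theorem memLp_add {p : ℝ≥0∞} {v w : α → E} (hv : MemLp v p μ) (hw : MemLp w p μ) :
    MemLp (fun t => v t + w t) p μ := hv.add hw

theorem memLp_prodMk {p : ℝ≥0∞} {v : α → E} {w : α → F} (hv : MemLp v p μ) (hw : MemLp w p μ) :
    MemLp (fun t => (v t, w t)) p μ := by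
  have h := ((ContinuousLinearMap.inl ℝ E F).comp_memLp' hv).add
    ((ContinuousLinearMap.inr ℝ E F).comp_memLp' hw)
  refine (memLp_congr_ae (Eventually.of_forall fun t => ?_)).1 h
  simp

theorem memLp_top_clm_comp {S : α → F →L[ℝ] G} {T : α → E →L[ℝ] F} (hS : MemLp S ∞ μ)
    (hT : MemLp T ∞ μ) : MemLp (fun t => (S t).comp (T t)) ∞ μ :=
  (ContinuousLinearMap.compL ℝ E F G).memLp_of_bilin ∞ hS hT

end MemLp

section Pairing

variable {n : ℕ} {W : Type*} [NormedAddCommGroup W] [NormedSpace ℝ W]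

/-- The vector in `ℝⁿ` that represents the functional `h ∘ ι`. -/
def rz (ι : Rn n →L[ℝ] W) : (W →L[ℝ] ℝ) →L[ℝ] Rn n :=
  LinearMap.mkContinuous
    { toFun := fun h => (InnerProductSpace.toDual ℝ (Rn n)).symm (h.comp ι)
      map_add' := fun h k => by simp
      map_smul' := fun c h => by simp } ‖ι‖
    fun h => by
      simp only [LinearMap.coe_mk, AddHom.coe_mk, LinearIsometryEquiv.norm_map]
      rw [mul_comm]
      exact h.opNorm_comp_le ι

theorem rz_apply (ι : Rn n →L[ℝ] W) (h : W →L[ℝ] ℝ) :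
    rz ι h = (InnerProductSpace.toDual ℝ (Rn n)).symm (h.comp ι) := rfl

@[simp] theorem inner_rz (ι : Rn n →L[ℝ] W) (h : W →L[ℝ] ℝ) (v : Rn n) :
    ⟪rz ι h, v⟫_ℝ = h (ι v) := by
  rw [rz_apply, InnerProductSpace.toDual_symm_apply]
  rfl

theorem eq_rz_iff {ι : Rn n →L[ℝ] W} {h : W →L[ℝ] ℝ} {a : Rn n} :
    a = rz ι h ↔ ∀ v, ⟪a, v⟫_ℝ = h (ι v) := by
  constructor
  · rintro rfl v
    exact inner_rz ι h v
  · intro H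
    refine ext_inner_right ℝ fun v => ?_
    rw [H v, inner_rz]

/-- The inner product of `ℝⁿ` as a continuous bilinear map. -/
def ipL (n : ℕ) : Rn n →L[ℝ] Rn n →L[ℝ] ℝ :=
  (isBoundedBilinearMap_inner (𝕜 := ℝ) (E := Rn n)).toContinuousLinearMap

@[simp] theorem ipL_apply (v w : Rn n) : ipL n v w = ⟪v, w⟫_ℝ := rfl

/-- `(a, T) ↦ ⟪a, T ·⟫`. -/
def pairL : Rn n →L[ℝ] (W →L[ℝ] Rn n) →L[ℝ] (W →L[ℝ] ℝ) :=
  (ContinuousLinearMap.compL ℝ W (Rn n) ℝ).comp (ipL n)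

@[simp] theorem pairL_apply (a : Rn n) (T : W →L[ℝ] Rn n) (w : W) :
    pairL a T w = ⟪a, T w⟫_ℝ := rfl

/-- `T ↦ (a ↦ ⟪a, T ·⟫)`. -/
def coL : (W →L[ℝ] Rn n) →L[ℝ] Rn n →L[ℝ] (W →L[ℝ] ℝ) :=
  (pairL (n := n) (W := W)).flip

theorem coL_apply (T : W →L[ℝ] Rn n) (a : Rn n) : coL T a = pairL a T := rfl

theorem memLp_coL {α : Type*} {m : MeasurableSpace α} {μ : Measure α} {p : ℝ≥0∞}
    {T : α → W →L[ℝ] Rn n} (hT : MemLp T p μ) :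
    MemLp (fun t => (coL (T t) : Rn n →L[ℝ] W →L[ℝ] ℝ)) p μ := by
  have h := memLp_map (E := W →L[ℝ] Rn n) (F := Rn n →L[ℝ] W →L[ℝ] ℝ) (coL (W := W) (n := n)) hT
  exact h

end Pairing

section YSplit

variable {nx nu np : ℕ}

@[simp] theorem ιx_apply (v : Rn nx) : (ιx v : Yn nx nu np) = (v, 0, 0) := rfl

@[simp] theorem ιu_apply (v : Rn nu) : (ιu v : Yn nx nu np) = (0, v, 0) := rfl

@[simp] theorem ιp_apply (v : Rn np) : (ιp v : Yn nx nu np) = (0, 0, v) := rfl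

theorem Yn_split (v : Yn nx nu np) : v = ιx v.1 + ιu v.2.1 + ιp v.2.2 := by
  simp

theorem clm_Yn_apply {V : Type*} [NormedAddCommGroup V] [NormedSpace ℝ V]
    (T : Yn nx nu np →L[ℝ] V) (v : Yn nx nu np) :
    T v = T (ιx v.1) + T (ιu v.2.1) + T (ιp v.2.2) := by
  conv_lhs => rw [Yn_split v, map_add, map_add]

end YSplit

/-! ### Square integrable trajectories -/

section Trajectories

variable {nx nu np : ℕ}

/-- The curve `t ↦ (x(t), u(t), p)` of a trajectory. -/
def curveT (w : Traj nx nu np) (t : ℝ) : Yn nx nu np := (w.1 t, w.2.2.1 t, w.2.2.2)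

/-- The end point `(x(t_f), p)` of a trajectory. -/
def endT (I : TimeInterval) (w : Traj nx nu np) : Rn nx × Rn np := (w.1 I.tf, w.2.2.2)

theorem curveT_add (w w' : Traj nx nu np) (t : ℝ) : curveT (w + w') t = curveT w t + curveT w' t :=
  rfl

theorem curveT_smul (c : ℝ) (w : Traj nx nu np) (t : ℝ) : curveT (c • w) t = c • curveT w t := rfl

/-- Functions of time that come from an element of `W^{1,2} × L² × ℝ^{n_p}`. -/
structure IsTraj (I : TimeInterval) (w : Traj nx nu np) : Prop where
  prim : I.IsPrimitive w.1 w.2.1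
  der : MemLp w.2.1 2 I.vol
  control : MemLp w.2.2.1 2 I.vol

variable {I : TimeInterval}

theorem isTraj_toTraj {q : ℝ≥0∞} [Fact (1 ≤ q)] (hq : 2 ≤ q) (y : YSpace I q nx nu np) :
    IsTraj I (toTraj y) :=
  ⟨y.1.isPrimitive, y.1.memLp_der.mono_exponent hq, (Lp.memLp y.2.1).mono_exponent hq⟩

namespace IsTraj

variable {w w' : Traj nx nu np}

theorem add (h : IsTraj I w) (h' : IsTraj I w') : IsTraj I (w + w') :=
  ⟨h.prim.add h'.prim, h.der.add h'.der, h.control.add h'.control⟩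

theorem const_smul (c : ℝ) (h : IsTraj I w) : IsTraj I (c • w) :=
  ⟨h.prim.const_smul c, h.der.const_smul c, h.control.const_smul c⟩

theorem memLp_curveT (h : IsTraj I w) : MemLp (curveT w) 2 I.vol :=
  memLp_prodMk (h.prim.memLp 2) (memLp_prodMk h.control (memLp_const _))

/-- The element of `W^{1,2} × L² × ℝ^{n_p}` with the given functions of time. -/
theorem exists_ySpace (h : IsTraj I w) : ∃ y : YSpace I 2 nx nu np,
    (∀ t ∈ Icc I.t0 I.tf, y.1.val t = w.1 t) ∧ y.1.der =ᵐ[I.vol] w.2.1 ∧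
    y.2.1 =ᵐ[I.vol] w.2.2.1 ∧ y.2.2 = w.2.2.2 :=
  ⟨(W1.ofPrimitive w.1 w.2.1 h.prim h.der, h.control.toLp, w.2.2.2),
    fun _ ht => W1.ofPrimitive_val h.prim h.der ht, W1.ofPrimitive_der h.prim h.der,
    h.control.coeFn_toLp, rfl⟩

end IsTraj

theorem memLp_curve (y : YSpace I ∞ nx nu np) : MemLp (curve y) ∞ I.vol :=
  memLp_prodMk (y.1.memLp_val ∞) (memLp_prodMk (Lp.memLp y.2.1) (memLp_const _))

end Trajectories

/-! ### Linear-quadratic problems and their optimality systems -/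

/-- The coefficients of a linear-quadratic optimal control problem: the matrix `(A B C)` of the
differential equation, the Hessian of the integrand, and the Hessian of the terminal cost. -/
structure LQModel (I : TimeInterval) (nx nu np : ℕ) where
  dyn : ℝ → Yn nx nu np →L[ℝ] Rn nx
  hess : ℝ → Yn nx nu np →L[ℝ] Yn nx nu np →L[ℝ] ℝ
  endHess : (Rn nx × Rn np) →L[ℝ] (Rn nx × Rn np) →L[ℝ] ℝ
  memLp_dyn : MemLp dyn ∞ I.vol
  memLp_hess : MemLp hess ∞ I.vol
  hess_symm : ∀ᵐ t ∂I.vol, ∀ v w, hess t v w = hess t w v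
  endHess_symm : ∀ v w, endHess v w = endHess w v

namespace LQModel

variable {I : TimeInterval} {nx nu np : ℕ} (D : LQModel I nx nu np)

/-- The linear dependence on `(δx, δu, δp, δλ)` of the gradient of the Lagrangian integrand. -/
def grad (ζ : ZSpace I nx nu np) (t : ℝ) : Yn nx nu np →L[ℝ] ℝ :=
  D.hess t (curve ζ.1 t) + pairL (W := Yn nx nu np) (ζ.2.val t) (D.dyn t)

/-- The optimality system of the linear-quadratic problem with inhomogeneity `r` and initial value
`r₀` in the differential equation, linear cost `θ` and linear terminal cost `κ`. -/
structure System (r : ℝ → Rn nx) (r0 : Rn nx) (θ : ℝ → Yn nx nu np →L[ℝ] ℝ)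
    (κ : (Rn nx × Rn np) →L[ℝ] ℝ) (ζ : ZSpace I nx nu np) : Prop where
  state : ∀ᵐ t ∂I.vol, ζ.1.1.der t = D.dyn t (curve ζ.1 t) + r t
  init : ζ.1.1.val I.t0 = r0
  costate : ∀ᵐ t ∂I.vol, ζ.2.der t = -rz ιx (D.grad ζ t + θ t)
  term : ζ.2.val I.tf =
    rz (ContinuousLinearMap.inl ℝ _ _) (D.endHess (endT I (toTraj ζ.1)) + κ)
  ctrl : ∀ᵐ t ∂I.vol, rz ιu (D.grad ζ t + θ t) = 0
  param : rz (ContinuousLinearMap.inr ℝ _ _) (D.endHess (endT I (toTraj ζ.1)) + κ)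
    + ∫ t, rz ιp (D.grad ζ t + θ t) ∂I.vol = 0

/-- The bilinear form of the cost. -/
def bil (w w' : Traj nx nu np) : ℝ :=
  ∫ t, D.hess t (curveT w t) (curveT w' t) ∂I.vol + D.endHess (endT I w) (endT I w')

/-- The linear part of the cost. -/
def lin (_D : LQModel I nx nu np) (θ : ℝ → Yn nx nu np →L[ℝ] ℝ) (κ : (Rn nx × Rn np) →L[ℝ] ℝ)
    (w : Traj nx nu np) : ℝ :=
  ∫ t, θ t (curveT w t) ∂I.vol + κ (endT I w)

/-- The pairing of a costate with the residual of the differential equation. -/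
def res (μ : ℝ → Rn nx) (w : Traj nx nu np) : ℝ :=
  ∫ t, ⟪μ t, D.dyn t (curveT w t) - w.2.1 t⟫_ℝ ∂I.vol

/-- Solutions of the homogeneous differential equation with initial value zero. -/
def Admissible (w : Traj nx nu np) : Prop :=
  (∀ᵐ t ∂I.vol, w.2.1 t = D.dyn t (curveT w t)) ∧ w.1 I.t0 = 0

/-- Coercivity of the Hessian on the admissible directions. -/
def Coercive : Prop :=
  (∀ v, 0 ≤ D.endHess v v) ∧ ∃ ε : ℝ, 0 < ε ∧ ∀ w : Traj nx nu np, IsTraj I w → D.Admissible w →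
    ε * (∫ t, ‖w.1 t‖ ^ 2 ∂I.vol + ∫ t, ‖w.2.2.1 t‖ ^ 2 ∂I.vol + ‖w.2.2.2‖ ^ 2)
      ≤ ∫ t, D.hess t (curveT w t) (curveT w t) ∂I.vol

section Integrability

variable {D} {w w' : Traj nx nu np}

theorem memLp_hess_apply (h : IsTraj I w) : MemLp (fun t => D.hess t (curveT w t)) 2 I.vol :=
  memLp_clm_apply 2 D.memLp_hess h.memLp_curveT

theorem integrable_apply {θ : ℝ → Yn nx nu np →L[ℝ] ℝ} (hθ : MemLp θ 2 I.vol) (h : IsTraj I w) :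
    Integrable (fun t => θ t (curveT w t)) I.vol :=
  memLp_one_iff_integrable.1 (memLp_clm_apply 1 hθ h.memLp_curveT)

theorem integrable_hess (h : IsTraj I w) (h' : IsTraj I w') :
    Integrable (fun t => D.hess t (curveT w t) (curveT w' t)) I.vol :=
  integrable_apply (memLp_hess_apply h) h'

theorem integrable_res {μ : ℝ → Rn nx} (hμ : MemLp μ 2 I.vol) (h : IsTraj I w) :
    Integrable (fun t => ⟪μ t, D.dyn t (curveT w t) - w.2.1 t⟫_ℝ) I.vol := by
  have h1 : MemLp (fun t => D.dyn t (curveT w t)) 2 I.vol :=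
    memLp_clm_apply 2 D.memLp_dyn h.memLp_curveT
  exact memLp_one_iff_integrable.1 ((ipL nx).memLp_of_bilin 1 hμ (h1.sub h.der))

theorem memLp_grad (ζ : ZSpace I nx nu np) : MemLp (D.grad ζ) ∞ I.vol :=
  memLp_add (memLp_clm_apply ∞ D.memLp_hess (memLp_curve ζ.1))
    ((pairL (n := nx) (W := Yn nx nu np)).memLp_of_bilin ∞ (ζ.2.memLp_val ∞) D.memLp_dyn)

end Integrability

variable {D}

/-- The optimality system in weak form: the Lagrangian is stationary in all directions. Integration
by parts moves the derivative from the costate to the direction. -/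
theorem System.weak {r : ℝ → Rn nx} {r0 : Rn nx} {θ : ℝ → Yn nx nu np →L[ℝ] ℝ}
    {κ : (Rn nx × Rn np) →L[ℝ] ℝ} {ζ : ZSpace I nx nu np} (h : D.System r r0 θ κ ζ)
    (hθ : MemLp θ ∞ I.vol) {w : Traj nx nu np} (hw : IsTraj I w) :
    D.bil (toTraj ζ.1) w + D.lin θ κ w + D.res ζ.2.val w = ⟪ζ.2.val I.t0, w.1 I.t0⟫_ℝ := by
  have hζ : IsTraj I (toTraj ζ.1) := isTraj_toTraj le_top ζ.1
  have hG : MemLp (fun t => D.grad ζ t + θ t) ∞ I.vol := memLp_add (memLp_grad ζ) hθ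
  have hi : Integrable (fun t => rz ιp (D.grad ζ t + θ t)) I.vol :=
    (((rz ιp).comp_memLp' hG).integrable le_top)
  have hibp := ζ.2.isPrimitive.integral_inner_add hw.prim
  have hp : ∫ t, ⟪rz ιp (D.grad ζ t + θ t), w.2.2.2⟫_ℝ ∂I.vol
      = -(D.endHess (endT I (toTraj ζ.1)) + κ) (0, w.2.2.2) := by
    rw [integral_inner_const hi, eq_neg_of_add_eq_zero_right h.param, inner_neg_left, inner_rz]
    rfl
  have hterm : ⟪ζ.2.val I.tf, w.1 I.tf⟫_ℝ
      = (D.endHess (endT I (toTraj ζ.1)) + κ) (w.1 I.tf, 0) := by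
    rw [h.term, inner_rz]
    rfl
  have hend : (D.endHess (endT I (toTraj ζ.1)) + κ) (endT I w)
      = (D.endHess (endT I (toTraj ζ.1)) + κ) (w.1 I.tf, 0)
        + (D.endHess (endT I (toTraj ζ.1)) + κ) (0, w.2.2.2) := by
    rw [← map_add]
    simp [endT]
  have hi3 : Integrable (fun t => ⟪ζ.2.val t, D.dyn t (curveT w t) - w.2.1 t⟫_ℝ) I.vol :=
    integrable_res (ζ.2.memLp_val 2) hw
  have hi1 : Integrable (fun t => D.hess t (curveT (toTraj ζ.1) t) (curveT w t)) I.vol :=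
    integrable_hess hζ hw
  have hi2 : Integrable (fun t => θ t (curveT w t)) I.vol :=
    integrable_apply (hθ.mono_exponent le_top) hw
  have hsum : ∫ t, D.hess t (curveT (toTraj ζ.1) t) (curveT w t) ∂I.vol
      + ∫ t, θ t (curveT w t) ∂I.vol + D.res ζ.2.val w
      = ∫ t, ⟪rz ιp (D.grad ζ t + θ t), w.2.2.2⟫_ℝ ∂I.vol
        - ∫ t, (⟪ζ.2.der t, w.1 t⟫_ℝ + ⟪ζ.2.val t, w.2.1 t⟫_ℝ) ∂I.vol := by
    have hi4 : Integrable (fun t => ⟪ζ.2.der t, w.1 t⟫_ℝ + ⟪ζ.2.val t, w.2.1 t⟫_ℝ) I.vol := by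
      refine (memLp_one_iff_integrable.1 ((ipL nx).memLp_of_bilin 1
        (ζ.2.memLp_der.mono_exponent le_top : MemLp _ 2 _) (hw.prim.memLp 2))).add
        (memLp_one_iff_integrable.1 ((ipL nx).memLp_of_bilin 1 (ζ.2.memLp_val 2) hw.der))
    have hi5 : Integrable (fun t => ⟪rz ιp (D.grad ζ t + θ t), w.2.2.2⟫_ℝ) I.vol :=
      hi.inner_const (𝕜 := ℝ) w.2.2.2
    have hi6 : Integrable (fun t => D.hess t (curveT (toTraj ζ.1) t) (curveT w t)
        + θ t (curveT w t)) I.vol := hi1.add hi2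
    rw [res, ← integral_add hi1 hi2, ← integral_add hi6 hi3, ← integral_sub hi5 hi4]
    refine integral_congr_ae ?_
    filter_upwards [h.costate, h.ctrl] with t h1 h2
    have h3 : (D.grad ζ t + θ t) (ιu (w.2.2.1 t)) = 0 := by
      rw [← inner_rz, h2, inner_zero_left]
    have h4 := clm_Yn_apply (D.grad ζ t + θ t) (curveT w t)
    have h5 : (D.grad ζ t + θ t) (curveT w t) = D.hess t (curveT (toTraj ζ.1) t) (curveT w t)
        + ⟪ζ.2.val t, D.dyn t (curveT w t)⟫_ℝ + θ t (curveT w t) := rfl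
    simp only [curveT] at h3 h4 h5 ⊢
    rw [h1, inner_neg_left, inner_rz, inner_rz, inner_sub_right]
    linarith
  have hres : D.bil (toTraj ζ.1) w + D.lin θ κ w + D.res ζ.2.val w =
      (∫ t, D.hess t (curveT (toTraj ζ.1) t) (curveT w t) ∂I.vol
      + ∫ t, θ t (curveT w t) ∂I.vol + D.res ζ.2.val w)
      + (D.endHess (endT I (toTraj ζ.1)) + κ) (endT I w) := by
    simp only [bil, lin, _root_.add_apply]
    ring
  rw [hres, hsum, hp, hibp, hterm, hend]
  ring

variable (D)

/-- The cost of a linear-quadratic problem. -/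
def cost (θ : ℝ → Yn nx nu np →L[ℝ] ℝ) (κ : (Rn nx × Rn np) →L[ℝ] ℝ) (w : Traj nx nu np) : ℝ :=
  D.lin θ κ w + (1 / 2) * D.bil w w

variable {D} {θ : ℝ → Yn nx nu np →L[ℝ] ℝ} {κ : (Rn nx × Rn np) →L[ℝ] ℝ}
  {w w' : Traj nx nu np}

theorem lin_add_smul (hθ : MemLp θ ∞ I.vol) (h : IsTraj I w) (h' : IsTraj I w') (s : ℝ) :
    D.lin θ κ (w + s • w') = D.lin θ κ w + s * D.lin θ κ w' := by
  have hi : ∀ {v : Traj nx nu np}, IsTraj I v → Integrable (fun t => θ t (curveT v t)) I.vol :=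
    fun hv => integrable_apply (hθ.mono_exponent le_top) hv
  have h1 : endT I (w + s • w') = endT I w + s • endT I w' := rfl
  simp only [lin, curveT_add, curveT_smul, map_add, map_smul, h1]
  have h2 : Integrable (fun t => s • θ t (curveT w' t)) I.vol := (hi h').smul s
  rw [integral_add (hi h) h2, integral_smul]
  simp only [smul_eq_mul]
  ring

theorem bil_add_smul (h : IsTraj I w) (h' : IsTraj I w') (s : ℝ) :
    D.bil (w + s • w') (w + s • w')
      = D.bil w w + 2 * s * D.bil w w' + s ^ 2 * D.bil w' w' := by
  have h1 : endT I (w + s • w') = endT I w + s • endT I w' := rfl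
  have h2 : ∫ t, D.hess t (curveT (w + s • w') t) (curveT (w + s • w') t) ∂I.vol
      = ∫ t, (D.hess t (curveT w t) (curveT w t) + (2 * s) * D.hess t (curveT w t) (curveT w' t)
        + s ^ 2 * D.hess t (curveT w' t) (curveT w' t)) ∂I.vol := by
    refine integral_congr_ae ?_
    filter_upwards [D.hess_symm] with t ht
    simp only [curveT_add, curveT_smul, map_add, map_smul, _root_.add_apply, _root_.smul_apply,
      smul_eq_mul]
    rw [ht (curveT w' t) (curveT w t)]
    ring
  have h3 := integrable_hess (D := D) h h
  have h4 := (integrable_hess (D := D) h h').const_mul (2 * s)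
  have h5 := (integrable_hess (D := D) h' h').const_mul (s ^ 2)
  have h6 : Integrable (fun t => D.hess t (curveT w t) (curveT w t)
      + 2 * s * D.hess t (curveT w t) (curveT w' t)) I.vol := h3.add h4
  simp only [bil]
  rw [h2, integral_add h6 h5, integral_add h3 h4, integral_const_mul, integral_const_mul]
  simp only [h1, map_add, map_smul, _root_.add_apply, _root_.smul_apply, smul_eq_mul]
  rw [D.endHess_symm (endT I w') (endT I w)]
  ring

theorem res_add_smul {μ : ℝ → Rn nx} (hμ : MemLp μ 2 I.vol) (h : IsTraj I w) (h' : IsTraj I w')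
    (s : ℝ) : D.res μ (w + s • w') = D.res μ w + s * D.res μ w' := by
  have h2 := integrable_res (D := D) hμ h
  have h3 := (integrable_res (D := D) hμ h').const_mul s
  rw [res, res, res, ← integral_const_mul, ← integral_add h2 h3]
  refine integral_congr_ae (Eventually.of_forall fun t => ?_)
  simp only [curveT_add, curveT_smul, map_add, map_smul, Prod.snd_add, Prod.fst_add, Prod.smul_snd,
    Prod.smul_fst, Pi.add_apply, Pi.smul_apply, inner_sub_right, inner_add_right, inner_smul_right]
  ring

theorem cost_add_smul (hθ : MemLp θ ∞ I.vol) (h : IsTraj I w) (h' : IsTraj I w') (s : ℝ) :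
    D.cost θ κ (w + s • w') = D.cost θ κ w + s * (D.bil w w' + D.lin θ κ w')
      + s ^ 2 * (1 / 2 * D.bil w' w') := by
  rw [cost, lin_add_smul hθ h h', bil_add_smul h h', cost]
  ring

/-- The derivative of the Lagrangian of the linear-quadratic problem. -/
theorem hasDerivAt_lagrangian (hθ : MemLp θ ∞ I.vol) {μ : ℝ → Rn nx} (hμ : MemLp μ 2 I.vol)
    (μ₀ : Rn nx) (h : IsTraj I w) (h' : IsTraj I w') :
    HasDerivAt (fun s : ℝ => D.cost θ κ (w + s • w') + D.res μ (w + s • w')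
        + ⟪μ₀, 0 - (w + s • w').1 I.t0⟫_ℝ)
      (D.bil w w' + D.lin θ κ w' + D.res μ w' - ⟪μ₀, w'.1 I.t0⟫_ℝ) 0 := by
  have h1 : (fun s : ℝ => D.cost θ κ (w + s • w') + D.res μ (w + s • w')
        + ⟪μ₀, 0 - (w + s • w').1 I.t0⟫_ℝ)
      = fun s : ℝ => (D.cost θ κ w + D.res μ w - ⟪μ₀, w.1 I.t0⟫_ℝ)
        + s * (D.bil w w' + D.lin θ κ w' + D.res μ w' - ⟪μ₀, w'.1 I.t0⟫_ℝ)
        + s ^ 2 * (1 / 2 * D.bil w' w') := by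
    funext s
    have h2 : (w + s • w').1 I.t0 = w.1 I.t0 + s • w'.1 I.t0 := rfl
    rw [cost_add_smul hθ h h', res_add_smul hμ h h', h2, zero_sub, inner_neg_right, inner_add_right,
      inner_smul_right]
    ring
  rw [h1]
  have h3 : HasDerivAt (fun s : ℝ => (D.cost θ κ w + D.res μ w - ⟪μ₀, w.1 I.t0⟫_ℝ)
        + s * (D.bil w w' + D.lin θ κ w' + D.res μ w' - ⟪μ₀, w'.1 I.t0⟫_ℝ)
        + s ^ 2 * (1 / 2 * D.bil w' w')) _ 0 := (((hasDerivAt_id (0 : ℝ)).mul_const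
    (D.bil w w' + D.lin θ κ w' + D.res μ w' - ⟪μ₀, w'.1 I.t0⟫_ℝ)).const_add
    (D.cost θ κ w + D.res μ w - ⟪μ₀, w.1 I.t0⟫_ℝ)).add
    (((hasDerivAt_id (0 : ℝ)).pow 2).mul_const (1 / 2 * D.bil w' w'))
  simpa using h3

theorem ae_eq_zero_of_integral_norm_sq {n : ℕ} {v : ℝ → Rn n} (hv : MemLp v 2 I.vol)
    (h : ∫ t, ‖v t‖ ^ 2 ∂I.vol = 0) : v =ᵐ[I.vol] 0 := by
  have h1 := (integral_eq_zero_iff_of_nonneg (fun t => sq_nonneg ‖v t‖)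
    (hv.integrable_norm_pow two_ne_zero)).1 h
  filter_upwards [h1] with t ht
  simpa using ht

/-- A continuous function that vanishes almost everywhere on the interval vanishes on it. -/
theorem eq_zero_of_ae_eq_zero {n : ℕ} {v : ℝ → Rn n} (hv : Continuous v) (h : v =ᵐ[I.vol] 0)
    {t : ℝ} (ht : t ∈ Icc I.t0 I.tf) : v t = 0 := by
  have h1 : EqOn v 0 (Ioo I.t0 I.tf) :=
    Measure.eqOn_open_of_ae_eq h isOpen_Ioo hv.continuousOn continuousOn_const
  have h2 := h1.closure hv continuous_const
  rw [closure_Ioo I.lt.ne] at h2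
  exact h2 ht

/-- An admissible direction along which the Hessian form is not positive vanishes. -/
theorem Coercive.eq_zero (hD : D.Coercive) (hw : IsTraj I w) (ha : D.Admissible w)
    (hb : D.bil w w ≤ 0) :
    w.1 =ᵐ[I.vol] 0 ∧ w.2.2.1 =ᵐ[I.vol] 0 ∧ w.2.2.2 = 0 := by
  obtain ⟨hend, ε, hε, hco⟩ := hD
  have h1 := hco w hw ha
  have h2 := hend (endT I w)
  have h3 : 0 ≤ ∫ t, ‖w.1 t‖ ^ 2 ∂I.vol := integral_nonneg fun t => sq_nonneg _
  have h4 : 0 ≤ ∫ t, ‖w.2.2.1 t‖ ^ 2 ∂I.vol := integral_nonneg fun t => sq_nonneg _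
  have h5 := sq_nonneg ‖w.2.2.2‖
  have h6 : ε * (∫ t, ‖w.1 t‖ ^ 2 ∂I.vol + ∫ t, ‖w.2.2.1 t‖ ^ 2 ∂I.vol + ‖w.2.2.2‖ ^ 2) ≤ 0 := by
    rw [bil] at hb
    linarith
  have h7 : ∫ t, ‖w.1 t‖ ^ 2 ∂I.vol + ∫ t, ‖w.2.2.1 t‖ ^ 2 ∂I.vol + ‖w.2.2.2‖ ^ 2 ≤ 0 := by
    by_contra! h8
    exact absurd h6 (not_le.2 (mul_pos hε h8))
  refine ⟨ae_eq_zero_of_integral_norm_sq (hw.prim.memLp 2) (by linarith),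
    ae_eq_zero_of_integral_norm_sq hw.control (by linarith), ?_⟩
  have h8 : ‖w.2.2.2‖ ^ 2 = 0 := by linarith
  simpa using h8

/-- A costate whose pairing with all residuals of the differential equation vanishes is zero: test
with the solution of `x' = A x - μ`. -/
theorem costate_eq_zero (μ : W1 I ∞ nx)
    (h : ∀ w : Traj nx nu np, IsTraj I w → w.1 I.t0 = 0 → D.res μ.val w = 0) {t : ℝ}
    (ht : t ∈ Icc I.t0 I.tf) : μ.val t = 0 := by
  have hM : MemLp (fun t => (D.dyn t).comp ιx) ∞ I.vol :=
    (((ContinuousLinearMap.compL ℝ (Rn nx) (Yn nx nu np) (Rn nx)).flip ιx).comp_memLp'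
      D.memLp_dyn)
  obtain ⟨X, hXc, hX0, hX⟩ := exists_linear_ode I hM
    ((μ.memLp_val ∞).neg.integrable le_top) 0
  have hder : MemLp (fun t => (D.dyn t).comp ιx (X t) + -μ.val t) 2 I.vol :=
    (memLp_clm_apply 2 hM (hX.memLp 2)).add (μ.memLp_val 2).neg
  have hw : IsTraj I (X, (fun t => (D.dyn t).comp ιx (X t) + -μ.val t), (0 : ℝ → Rn nu),
      (0 : Rn np)) := ⟨hX, hder, MemLp.zero⟩
  have h1 := h _ hw hX0
  have h2 : ∫ t, ‖μ.val t‖ ^ 2 ∂I.vol = 0 := by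
    rw [← h1, res]
    refine integral_congr_ae (Eventually.of_forall fun s => ?_)
    simp [curveT]
  exact eq_zero_of_ae_eq_zero μ.continuous_val
    (ae_eq_zero_of_integral_norm_sq (μ.memLp_val 2) h2) ht

end LQModel

/-! ### Solvability of the optimality system -/

/-- The space of residuals of the optimality system: differential equation, initial condition,
adjoint equation, terminal condition, stationarity in the control and in the parameter. -/
abbrev RSpace (I : TimeInterval) (nx nu np : ℕ) : Type :=
  Lq I ∞ nx × Rn nx × Lq I ∞ nx × Rn nx × Lq I ∞ nu × Rn np

/-- Elimination of the control. Let `H`, `Q`, `A` be the Hessian, the costate part of the gradient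
and the dynamics. If `T` inverts the `u`-block of `H`, the stationarity condition for `u` turns
state and costate equation into a linear differential equation, which is solvable for any initial
value. -/
theorem exists_solution_eliminate_control {X U Y G : Type*} [NormedAddCommGroup X] [NormedSpace ℝ X]
    [CompleteSpace X] [NormedAddCommGroup U] [NormedSpace ℝ U] [NormedAddCommGroup Y]
    [NormedSpace ℝ Y] [NormedAddCommGroup G] [NormedSpace ℝ G] (I : TimeInterval)
    (jx : X →L[ℝ] Y) (ju : U →L[ℝ] Y) (rx : G →L[ℝ] X) (ru : G →L[ℝ] U)
    {H : ℝ → Y →L[ℝ] G} {Q : ℝ → X →L[ℝ] G} {A : ℝ → Y →L[ℝ] X} {T : ℝ → U →L[ℝ] U}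
    (hH : MemLp H ∞ I.vol) (hQ : MemLp Q ∞ I.vol) (hA : MemLp A ∞ I.vol) (hT : MemLp T ∞ I.vol)
    (hTH : ∀ᵐ t ∂I.vol, ∀ v, ru (H t (ju (T t v))) = v)
    {a b : ℝ → X} {c : ℝ → U} (ha : MemLp a ∞ I.vol) (hb : MemLp b ∞ I.vol) (hc : MemLp c ∞ I.vol)
    (x0 l0 : X) (y0 : Y) :
    ∃ (x l dx dl : ℝ → X) (u : ℝ → U), I.IsPrimitive x dx ∧ I.IsPrimitive l dl ∧
      MemLp dx ∞ I.vol ∧ MemLp dl ∞ I.vol ∧ MemLp u ∞ I.vol ∧ x I.t0 = x0 ∧ l I.t0 = l0 ∧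
      (∀ᵐ t ∂I.vol, dx t = A t (jx (x t) + ju (u t) + y0) + a t) ∧
      (∀ᵐ t ∂I.vol, dl t = b t - rx (H t (jx (x t) + ju (u t) + y0) + Q t (l t))) ∧
      (∀ᵐ t ∂I.vol, c t = ru (H t (jx (x t) + ju (u t) + y0) + Q t (l t))) := by
  let X1 : X × X →L[ℝ] X := ContinuousLinearMap.fst ℝ _ _
  let X2 : X × X →L[ℝ] X := ContinuousLinearMap.snd ℝ _ _
  let Y1 : X × X →L[ℝ] Y := jx.comp X1
  have hQ2 : MemLp (fun t => (Q t).comp X2) ∞ I.vol := memLp_top_clm_comp hQ (memLp_const X2)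
  -- the control as a feedback of state and costate
  let V : ℝ → X × X →L[ℝ] U := fun t => -((T t).comp (ru.comp ((H t).comp Y1 + (Q t).comp X2)))
  have hV : MemLp V ∞ I.vol := (memLp_top_clm_comp hT (memLp_top_clm_comp (memLp_const ru)
    (memLp_add (memLp_top_clm_comp hH (memLp_const Y1)) hQ2))).neg
  let u0 : ℝ → U := fun t => T t (c t - ru (H t y0))
  have hHy0 : MemLp (fun t => H t y0) ∞ I.vol :=
    memLp_clm_apply (q := ∞) ∞ hH (memLp_const y0)
  have hu0 : MemLp u0 ∞ I.vol := memLp_clm_apply (q := ∞) ∞ hT (hc.sub (memLp_map ru hHy0))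
  let W : ℝ → X × X →L[ℝ] Y := fun t => Y1 + ju.comp (V t)
  have hW : MemLp W ∞ I.vol :=
    memLp_add (memLp_const Y1) (memLp_top_clm_comp (memLp_const ju) hV)
  let w0 : ℝ → Y := fun t => ju (u0 t) + y0
  have hw0 : MemLp w0 ∞ I.vol := memLp_add (memLp_map ju hu0) (memLp_const y0)
  let M : ℝ → X × X →L[ℝ] X × X := fun t => (ContinuousLinearMap.inl ℝ _ _).comp ((A t).comp (W t))
    + (ContinuousLinearMap.inr ℝ _ _).comp ((-rx).comp ((H t).comp (W t) + (Q t).comp X2))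
  have hM : MemLp M ∞ I.vol :=
    memLp_add (memLp_top_clm_comp (memLp_const _) (memLp_top_clm_comp hA hW))
      (memLp_top_clm_comp (memLp_const _) (memLp_top_clm_comp (memLp_const (-rx))
        (memLp_add (memLp_top_clm_comp hH hW) hQ2)))
  let h : ℝ → X × X := fun t => (A t (w0 t) + a t, b t + (-rx) (H t (w0 t)))
  have hh : MemLp h ∞ I.vol :=
    memLp_prodMk (memLp_add (memLp_clm_apply ∞ hA hw0) ha)
      (memLp_add hb (memLp_map (-rx) (memLp_clm_apply ∞ hH hw0)))
  obtain ⟨S, -, hS0, hS⟩ := exists_linear_ode I hM (hh.integrable le_top) (x0, l0)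
  have hSb : MemLp S ∞ I.vol := hS.memLp ∞
  have hS' : MemLp (fun t => M t (S t) + h t) ∞ I.vol := memLp_add (memLp_clm_apply ∞ hM hSb) hh
  have hsplit : ∀ t, jx (S t).1 + ju (V t (S t) + u0 t) + y0 = W t (S t) + w0 t := by
    intro t
    have h1 : W t (S t) = jx (S t).1 + ju (V t (S t)) := rfl
    rw [h1, map_add]
    simp only [w0]
    abel
  refine ⟨fun t => (S t).1, fun t => (S t).2, fun t => X1 (M t (S t) + h t),
    fun t => X2 (M t (S t) + h t), fun t => V t (S t) + u0 t, hS.clm_comp X1, hS.clm_comp X2,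
    memLp_map X1 hS', memLp_map X2 hS', memLp_add (memLp_clm_apply ∞ hV hSb) hu0,
    congrArg Prod.fst hS0, congrArg Prod.snd hS0, Eventually.of_forall fun t => ?_,
      Eventually.of_forall fun t => ?_, ?_⟩
  · rw [hsplit, map_add (A t), add_assoc]
    simp [M, h, X1]
  · rw [hsplit]
    simp only [M, h, X2, map_add, ContinuousLinearMap.coe_snd', _root_.add_apply,
      ContinuousLinearMap.comp_apply, ContinuousLinearMap.inl_apply, ContinuousLinearMap.inr_apply,
      _root_.neg_apply]
    abel
  · filter_upwards [hTH] with t ht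
    have h5 : V t (S t) + u0 t
        = T t (c t - ru (H t y0) - ru (H t (jx (S t).1) + Q t (S t).2)) := by
      simp only [map_sub, V, u0, _root_.neg_apply, ContinuousLinearMap.comp_apply,
        _root_.add_apply, Y1, X1, X2, ContinuousLinearMap.coe_fst', ContinuousLinearMap.coe_snd']
      abel
    rw [h5]
    simp only [map_add, ht]
    abel

namespace LQModel

variable {I : TimeInterval} {nx nu np : ℕ} (D : LQModel I nx nu np)

/-- The `u`-block of the Hessian. -/
def huu (t : ℝ) : Rn nu →L[ℝ] Rn nu := (rz ιu).comp ((D.hess t).comp ιu)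

/-- The `u`-block of the Hessian is uniformly invertible. -/
def ControlInvertible : Prop :=
  ∃ M : ℝ, ∀ᵐ t ∂I.vol, ∃ T : Rn nu →L[ℝ] Rn nu, T.comp (D.huu t) = ContinuousLinearMap.id ℝ _ ∧
    (D.huu t).comp T = ContinuousLinearMap.id ℝ _ ∧ ‖T‖ ≤ M

/-- `L` is the linear operator on the left-hand side of the optimality system. -/
structure IsOperator (L : ZSpace I nx nu np →ₗ[ℝ] RSpace I nx nu np) : Prop where
  state : ∀ ζ, ∀ᵐ t ∂I.vol, (L ζ).1 t = ζ.1.1.der t - D.dyn t (curve ζ.1 t)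
  init : ∀ ζ, (L ζ).2.1 = ζ.1.1.val I.t0
  costate : ∀ ζ, ∀ᵐ t ∂I.vol, (L ζ).2.2.1 t = ζ.2.der t + rz ιx (D.grad ζ t)
  term : ∀ ζ, (L ζ).2.2.2.1 = ζ.2.val I.tf
    - rz (ContinuousLinearMap.inl ℝ _ _) (D.endHess (endT I (toTraj ζ.1)))
  ctrl : ∀ ζ, ∀ᵐ t ∂I.vol, (L ζ).2.2.2.2.1 t = rz ιu (D.grad ζ t)
  param : ∀ ζ, (L ζ).2.2.2.2.2 =
    rz (ContinuousLinearMap.inr ℝ _ _) (D.endHess (endT I (toTraj ζ.1)))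
      + ∫ t, rz ιp (D.grad ζ t) ∂I.vol

variable {D}

theorem memLp_huu : MemLp D.huu ∞ I.vol :=
  memLp_top_clm_comp (E := Rn nu) (F := Yn nx nu np →L[ℝ] ℝ) (G := Rn nu)
    (memLp_const (rz ιu)) (memLp_top_clm_comp (E := Rn nu) (F := Yn nx nu np)
      (G := Yn nx nu np →L[ℝ] ℝ)
      D.memLp_hess (memLp_const ιu))

theorem ControlInvertible.memLp_inverse (hD : D.ControlInvertible) :
    MemLp (fun t => Ring.inverse (D.huu t)) ∞ I.vol ∧
      ∀ᵐ t ∂I.vol, ∀ v, D.huu t (Ring.inverse (D.huu t) v) = v := by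
  obtain ⟨M, hM⟩ := hD
  have hunit : ∀ᵐ t ∂I.vol, ∃ U : (Rn nu →L[ℝ] Rn nu)ˣ, (U : Rn nu →L[ℝ] Rn nu) = D.huu t ∧
      ‖((U⁻¹ : (Rn nu →L[ℝ] Rn nu)ˣ) : Rn nu →L[ℝ] Rn nu)‖ ≤ M := by
    filter_upwards [hM] with t ⟨T, h1, h2, h3⟩
    exact ⟨⟨D.huu t, T, h2, h1⟩, rfl, h3⟩
  refine ⟨memLp_top_of_bound ?_ M ?_, ?_⟩
  · refine aestronglyMeasurable_comp_of_continuousAt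
      (F := fun (_ : ℝ) (S : Rn nu →L[ℝ] Rn nu) => Ring.inverse S)
      (fun _ => aestronglyMeasurable_const) memLp_huu.1 ?_
    filter_upwards [hunit] with t ⟨U, hU, _⟩
    rw [← hU]
    exact NormedRing.inverse_continuousAt U
  · filter_upwards [hunit] with t ⟨U, hU, hUM⟩
    rw [← hU, Ring.inverse_unit]
    exact hUM
  · filter_upwards [hunit] with t ⟨U, hU, _⟩ v
    rw [← hU, Ring.inverse_unit]
    exact DFunLike.congr_fun U.mul_inv v

/-- The system without the conditions at the final time and for the parameter is solvable for
arbitrary initial costate and parameter. -/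
theorem exists_initial_value_solution (hD : D.ControlInvertible) {a b : ℝ → Rn nx} {c : ℝ → Rn nu}
    (ha : MemLp a ∞ I.vol) (hb : MemLp b ∞ I.vol) (hc : MemLp c ∞ I.vol) (r0 l0 : Rn nx)
    (p : Rn np) :
    ∃ ζ : ZSpace I nx nu np,
      (∀ᵐ t ∂I.vol, a t = ζ.1.1.der t - D.dyn t (curve ζ.1 t)) ∧ ζ.1.1.val I.t0 = r0 ∧
      (∀ᵐ t ∂I.vol, b t = ζ.2.der t + rz ιx (D.grad ζ t)) ∧
      (∀ᵐ t ∂I.vol, c t = rz ιu (D.grad ζ t)) ∧ ζ.2.val I.t0 = l0 ∧ ζ.1.2.2 = p := by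
  obtain ⟨hT, hTinv⟩ := hD.memLp_inverse
  obtain ⟨x, l, dx, dl, u, hx, hl, hdx, hdl, hu, hx0, hl0, e1, e2, e3⟩ :=
    exists_solution_eliminate_control (X := Rn nx) (U := Rn nu) (Y := Yn nx nu np)
      (G := Yn nx nu np →L[ℝ] ℝ) I ιx ιu (rz ιx) (rz ιu) (H := D.hess)
      (Q := fun t => coL (D.dyn t)) (A := D.dyn) (T := fun t => Ring.inverse (D.huu t))
      D.memLp_hess (memLp_coL D.memLp_dyn) D.memLp_dyn hT hTinv ha hb hc r0 l0 (ιp p)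
  let ζ : ZSpace I nx nu np :=
    ((W1.ofPrimitive _ _ hx hdx, hu.toLp, p), W1.ofPrimitive _ _ hl hdl)
  have hcurve : ∀ᵐ t ∂I.vol, curve ζ.1 t = ιx (x t) + ιu (u t) + ιp p ∧ ζ.2.val t = l t := by
    filter_upwards [hu.coeFn_toLp, I.ae_mem_Icc] with t h1 h2
    have h3 : ζ.1.1.val t = x t := W1.ofPrimitive_val hx hdx h2
    have h4 : ζ.2.val t = l t := W1.ofPrimitive_val hl hdl h2
    have h5 : ζ.1.2.1 t = u t := h1
    refine ⟨?_, h4⟩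
    rw [Yn_split (curve ζ.1 t)]
    simp only [curve, h3, h5]
    rfl
  have hgrad : ∀ᵐ t ∂I.vol,
      D.grad ζ t = D.hess t (ιx (x t) + ιu (u t) + ιp p) + coL (D.dyn t) (l t) := by
    filter_upwards [hcurve] with t ⟨h1, h2⟩
    rw [grad, h1, h2, coL_apply]
  refine ⟨ζ, ?_, (W1.ofPrimitive_val hx hdx I.left_mem).trans hx0, ?_, ?_,
    (W1.ofPrimitive_val hl hdl I.left_mem).trans hl0, rfl⟩
  · filter_upwards [hcurve, W1.ofPrimitive_der hx hdx, e1] with t ⟨h1, _⟩ h2 h3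
    have h4 : ζ.1.1.der t = dx t := h2
    rw [h1, h4, h3, add_sub_cancel_left]
  · filter_upwards [hgrad, W1.ofPrimitive_der hl hdl, e2] with t h1 h2 h3
    have h4 : ζ.2.der t = dl t := h2
    rw [h1, h4, h3, sub_add_cancel]
  · filter_upwards [hgrad, e3] with t h1 h3
    rw [h1, h3]

/-- Only the zero function solves the homogeneous optimality system. -/
theorem System.eq_zero (hD : D.Coercive) {ζ : ZSpace I nx nu np}
    (h : D.System (fun _ => 0) 0 (fun _ => 0) 0 ζ) :
    ζ = 0 := by
  have hζ : IsTraj I (toTraj ζ.1) := isTraj_toTraj le_top ζ.1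
  have h0 : MemLp (fun _ => 0 : ℝ → Yn nx nu np →L[ℝ] ℝ) ∞ I.vol := memLp_const 0
  have hlin : ∀ w : Traj nx nu np, D.lin (fun _ => 0) 0 w = 0 := fun w => by simp [lin]
  have hadm : D.Admissible (toTraj ζ.1) := by
    refine ⟨?_, h.init⟩
    filter_upwards [h.state] with t ht
    exact ht.trans (add_zero _)
  have hres : D.res ζ.2.val (toTraj ζ.1) = 0 := by
    rw [res, integral_eq_zero_of_ae]
    filter_upwards [hadm.1] with t ht
    rw [← ht, sub_self, inner_zero_right, Pi.zero_apply]
  have hw := h.weak h0 hζ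
  rw [hlin, hres, show (toTraj ζ.1).1 I.t0 = 0 from h.init, inner_zero_right] at hw
  obtain ⟨hx, hu, hp⟩ := hD.eq_zero hζ hadm (by linarith)
  have hx0 : ∀ t ∈ Icc I.t0 I.tf, ζ.1.1.val t = 0 := fun t ht =>
    eq_zero_of_ae_eq_zero ζ.1.1.continuous_val hx ht
  have hcurve : ∀ᵐ t ∂I.vol, curveT (toTraj ζ.1) t = 0 := by
    filter_upwards [hx, hu] with t h1 h2
    simp only [curveT, h1, h2, hp]
    rfl
  have hend : endT I (toTraj ζ.1) = 0 := by
    simp only [endT, hp]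
    rw [show (toTraj ζ.1).1 I.tf = 0 from hx0 _ I.right_mem]
    rfl
  have hl : ζ.2 = 0 := by
    refine W1.eq_of_val fun t ht => ?_
    rw [W1.val_zero]
    refine costate_eq_zero (D := D) ζ.2 (fun w hw hw0 => ?_) ht
    have h1 := h.weak h0 hw
    rw [hlin, hw0, inner_zero_right, add_zero] at h1
    have h2 : D.bil (toTraj ζ.1) w = 0 := by
      rw [bil, hend, integral_eq_zero_of_ae]
      · simp
      · filter_upwards [hcurve] with t ht
        rw [ht]
        simp
    rwa [h2, zero_add] at h1
  have hx' : ζ.1.1 = 0 := W1.eq_of_val fun t ht => by rw [hx0 t ht, W1.val_zero]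
  have hu' : ζ.1.2.1 = 0 := by
    refine Lp.ext ?_
    filter_upwards [hu, Lp.coeFn_zero (Rn nu) ∞ I.vol] with t h1 h2
    rw [h2]
    exact h1
  exact Prod.ext (Prod.ext hx' (Prod.ext hu' hp)) hl

/-- Elements of the kernel solve the homogeneous optimality system. -/
theorem IsOperator.system {L : ZSpace I nx nu np →ₗ[ℝ] RSpace I nx nu np} (hL : D.IsOperator L)
    {ζ : ZSpace I nx nu np} (h : L ζ = 0) : D.System (fun _ => 0) 0 (fun _ => 0) 0 ζ := by
  have h1 := hL.state ζ
  have h2 := hL.init ζ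
  have h3 := hL.costate ζ
  have h4 := hL.term ζ
  have h5 := hL.ctrl ζ
  have h6 := hL.param ζ
  rw [h] at h1 h2 h3 h4 h5 h6
  refine ⟨?_, h2.symm, ?_, ?_, ?_, ?_⟩
  · filter_upwards [h1, Lp.coeFn_zero (Rn nx) ∞ I.vol] with t k1 k2
    have k3 : ((0 : RSpace I nx nu np).1 : ℝ → Rn nx) t = 0 := k2
    rw [k3] at k1
    rw [add_zero, eq_of_sub_eq_zero k1.symm]
  · filter_upwards [h3, Lp.coeFn_zero (Rn nx) ∞ I.vol] with t k1 k2
    have k3 : ((0 : RSpace I nx nu np).2.2.1 : ℝ → Rn nx) t = 0 := k2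
    rw [k3] at k1
    rw [add_zero, eq_neg_of_add_eq_zero_left k1.symm]
  · rw [add_zero]
    exact eq_of_sub_eq_zero h4.symm
  · filter_upwards [h5, Lp.coeFn_zero (Rn nu) ∞ I.vol] with t k1 k2
    have k3 : ((0 : RSpace I nx nu np).2.2.2.2.1 : ℝ → Rn nu) t = 0 := k2
    rw [k3] at k1
    rw [add_zero, ← k1]
  · simp only [add_zero]
    exact h6.symm

/-- The operator of the optimality system is bijective. Up to the finitely many unknowns `λ(t₀)` and
`p` and the equally many conditions at the final time and for `p`, it is given by a solvable initial
value problem, so that surjectivity follows from injectivity. -/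
theorem IsOperator.bijective {L : ZSpace I nx nu np →ₗ[ℝ] RSpace I nx nu np}
    (hL : D.IsOperator L) (hD : D.Coercive) (hD' : D.ControlInvertible) :
    Function.Bijective L := by
  have hinj : ∀ ζ, L ζ = 0 → ζ = 0 := fun ζ h => (hL.system h).eq_zero hD
  refine ⟨(injective_iff_map_eq_zero L).2 hinj, ?_⟩
  -- the space of solutions of the homogeneous initial value problem
  let K : Submodule ℝ (ZSpace I nx nu np) :=
    { carrier := {ζ | (L ζ).1 = 0 ∧ (L ζ).2.1 = 0 ∧ (L ζ).2.2.1 = 0 ∧ (L ζ).2.2.2.2.1 = 0}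
      zero_mem' := by simp
      add_mem' := by
        rintro ζ η ⟨h1, h2, h3, h4⟩ ⟨k1, k2, k3, k4⟩
        simp [h1, h2, h3, h4, k1, k2, k3, k4]
      smul_mem' := by
        rintro c ζ ⟨h1, h2, h3, h4⟩
        simp [h1, h2, h3, h4] }
  let L1 : K →ₗ[ℝ] Rn nx × Rn np :=
    { toFun := fun ζ => ((L ζ).2.2.2.1, (L ζ).2.2.2.2.2)
      map_add' := fun ζ η => by simp
      map_smul' := fun c ζ => by simp }
  let S1 : K →ₗ[ℝ] Rn nx × Rn np :=
    { toFun := fun ζ => (ζ.1.2.val I.t0, ζ.1.1.2.2)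
      map_add' := fun ζ η => rfl
      map_smul' := fun c ζ => rfl }
  have hL1 : Function.Injective L1 := by
    rw [injective_iff_map_eq_zero]
    rintro ⟨ζ, h1, h2, h3, h4⟩ h
    have h5 := congrArg Prod.fst h
    have h6 := congrArg Prod.snd h
    refine Subtype.ext (hinj ζ ?_)
    exact Prod.ext h1 (Prod.ext h2 (Prod.ext h3 (Prod.ext h5 (Prod.ext h4 h6))))
  have hsol : ∀ (ρ : RSpace I nx nu np) (v : Rn nx × Rn np), ∃ ζ, (L ζ).1 = ρ.1 ∧
      (L ζ).2.1 = ρ.2.1 ∧ (L ζ).2.2.1 = ρ.2.2.1 ∧ (L ζ).2.2.2.2.1 = ρ.2.2.2.2.1 ∧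
      ζ.2.val I.t0 = v.1 ∧ ζ.1.2.2 = v.2 := by
    intro ρ v
    obtain ⟨ζ, h1, h2, h3, h4, h5, h6⟩ := exists_initial_value_solution hD' (Lp.memLp ρ.1)
      (Lp.memLp ρ.2.2.1) (Lp.memLp ρ.2.2.2.2.1) ρ.2.1 v.1 v.2
    refine ⟨ζ, Lp.ext ?_, (hL.init ζ).trans h2, Lp.ext ?_, Lp.ext ?_, h5, h6⟩
    · filter_upwards [h1, hL.state ζ] with t k1 k2 using k2.trans k1.symm
    · filter_upwards [h3, hL.costate ζ] with t k1 k2 using k2.trans k1.symm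
    · filter_upwards [h4, hL.ctrl ζ] with t k1 k2 using k2.trans k1.symm
  have hS1 : Function.Surjective S1 := by
    intro v
    obtain ⟨ζ, h1, h2, h3, h4, h5, h6⟩ := hsol 0 v
    exact ⟨⟨ζ, h1, h2, h3, h4⟩, Prod.ext h5 h6⟩
  have : FiniteDimensional ℝ K := FiniteDimensional.of_injective L1 hL1
  have hdim : Module.finrank ℝ K = Module.finrank ℝ (Rn nx × Rn np) :=
    le_antisymm (LinearMap.finrank_le_finrank_of_injective hL1)
      (LinearMap.finrank_le_finrank_of_surjective hS1)
  have hL1s : Function.Surjective L1 :=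
    (LinearMap.injective_iff_surjective_of_finrank_eq_finrank hdim).1 hL1
  intro ρ
  obtain ⟨ζ, h1, h2, h3, h4, -, -⟩ := hsol ρ 0
  obtain ⟨⟨η, k1, k2, k3, k4⟩, hη⟩ :=
    hL1s (ρ.2.2.2.1 - (L ζ).2.2.2.1, ρ.2.2.2.2.2 - (L ζ).2.2.2.2.2)
  have k5 : (L η).2.2.2.1 = ρ.2.2.2.1 - (L ζ).2.2.2.1 := congrArg Prod.fst hη
  have k6 : (L η).2.2.2.2.2 = ρ.2.2.2.2.2 - (L ζ).2.2.2.2.2 := congrArg Prod.snd hη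
  refine ⟨ζ + η, ?_⟩
  rw [map_add]
  refine Prod.ext ?_ (Prod.ext ?_ (Prod.ext ?_ (Prod.ext ?_ (Prod.ext ?_ ?_))))
  · simp [h1, k1]
  · simp [h2, k2]
  · simp [h3, k3]
  · simp [k5]
  · simp [h4, k4]
  · simp [k6]

end LQModel

/-! ### Smooth operators with values in essentially bounded functions -/

section C1Op

variable {α : Type*} {m : MeasurableSpace α} {μ : Measure α} {P E V V' V'' : Type*}
  [NormedAddCommGroup P] [NormedSpace ℝ P] [NormedAddCommGroup E] [NormedSpace ℝ E]
  [NormedAddCommGroup V] [NormedSpace ℝ V]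
  [NormedAddCommGroup V'] [NormedSpace ℝ V'] [NormedAddCommGroup V''] [NormedSpace ℝ V'']

/-- A continuously differentiable map `Φ` into `L^∞` together with pointwise expressions `v` and
`v'` for its values and its derivative. -/
structure IsC1Op (Φ : P → Lp V ∞ μ) (v : P → α → V) (v' : P → P → α → V) : Prop where
  contDiff : ContDiff ℝ 1 Φ
  val : ∀ p, Φ p =ᵐ[μ] v p
  deriv : ∀ p d, fderiv ℝ Φ p d =ᵐ[μ] v' p d

namespace IsC1Op

variable {Φ Ψ : P → Lp V ∞ μ} {v w : P → α → V} {v' w' : P → P → α → V}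

theorem hasFDerivAt (h : IsC1Op Φ v v') (p : P) : HasFDerivAt Φ (fderiv ℝ Φ p) p :=
  (h.contDiff.differentiable one_ne_zero p).hasFDerivAt

theorem of_clm (L : P →L[ℝ] Lp V ∞ μ) {v : P → α → V} (h : ∀ p, L p =ᵐ[μ] v p) :
    IsC1Op L v (fun _ d => v d) where
  contDiff := L.contDiff
  val := h
  deriv p d := by
    rw [L.fderiv]
    exact h d

theorem add (h : IsC1Op Φ v v') (k : IsC1Op Ψ w w') :
    IsC1Op (fun p => Φ p + Ψ p) (fun p t => v p t + w p t) (fun p d t => v' p d t + w' p d t) where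
  contDiff := h.contDiff.add k.contDiff
  val p := by
    filter_upwards [Lp.coeFn_add (Φ p) (Ψ p), h.val p, k.val p] with t h1 h2 h3
    rw [h1, Pi.add_apply, h2, h3]
  deriv p d := by
    have h0 : fderiv ℝ (fun p => Φ p + Ψ p) p d = fderiv ℝ Φ p d + fderiv ℝ Ψ p d := by
      exact DFunLike.congr_fun ((h.hasFDerivAt p).add (k.hasFDerivAt p)).fderiv d
    rw [h0]
    filter_upwards [Lp.coeFn_add (fderiv ℝ Φ p d) (fderiv ℝ Ψ p d), h.deriv p d, k.deriv p d]
      with t h1 h2 h3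
    rw [h1, Pi.add_apply, h2, h3]

theorem map (h : IsC1Op Φ v v') (M : V →L[ℝ] V') :
    IsC1Op (fun p => M.compLpL ∞ μ (Φ p)) (fun p t => M (v p t)) (fun p d t => M (v' p d t)) where
  contDiff := (M.compLpL ∞ μ).contDiff.comp h.contDiff
  val p := by
    filter_upwards [M.coeFn_compLpL (p := ∞) (Φ p), h.val p] with t h1 h2
    rw [h1, h2]
  deriv p d := by
    have h0 : fderiv ℝ (fun p => M.compLpL ∞ μ (Φ p)) p d = M.compLpL ∞ μ (fderiv ℝ Φ p d) := by
      exact DFunLike.congr_fun ((M.compLpL ∞ μ).hasFDerivAt.comp p (h.hasFDerivAt p)).fderiv d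
    rw [h0]
    filter_upwards [M.coeFn_compLpL (p := ∞) (fderiv ℝ Φ p d), h.deriv p d] with t h1 h2
    rw [h1, h2]

theorem bilin {Φ : P → Lp V ∞ μ} {Ψ : P → Lp V' ∞ μ} {v : P → α → V} {w : P → α → V'}
    {v' : P → P → α → V} {w' : P → P → α → V'} (B : V →L[ℝ] V' →L[ℝ] V'')
    (h : IsC1Op Φ v v') (k : IsC1Op Ψ w w') :
    IsC1Op (fun p => B.holderL μ ∞ ∞ ∞ (Φ p) (Ψ p)) (fun p t => B (v p t) (w p t))
      (fun p d t => B (v p t) (w' p d t) + B (v' p d t) (w p t)) where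
  contDiff := (B.holderL μ ∞ ∞ ∞).isBoundedBilinearMap.contDiff.comp
    (h.contDiff.prodMk k.contDiff)
  val p := by
    filter_upwards [B.coeFn_holder (r := ∞) (Φ p) (Ψ p), h.val p, k.val p] with t h1 h2 h3
    rw [← h2, ← h3, ← h1]
    rfl
  deriv p d := by
    have h0 : fderiv ℝ (fun p => B.holderL μ ∞ ∞ ∞ (Φ p) (Ψ p)) p d
        = B.holder ∞ (Φ p) (fderiv ℝ Ψ p d) + B.holder ∞ (fderiv ℝ Φ p d) (Ψ p) := by
      exact DFunLike.congr_fun ((B.holderL μ ∞ ∞ ∞).hasFDerivAt_of_bilinear (h.hasFDerivAt p)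
        (k.hasFDerivAt p)).fderiv d
    rw [h0]
    filter_upwards [B.coeFn_holder (r := ∞) (Φ p) (fderiv ℝ Ψ p d),
      B.coeFn_holder (r := ∞) (fderiv ℝ Φ p d) (Ψ p), h.val p, k.val p, h.deriv p d, k.deriv p d,
      Lp.coeFn_add (B.holder ∞ (Φ p) (fderiv ℝ Ψ p d)) (B.holder ∞ (fderiv ℝ Φ p d) (Ψ p))]
      with t h1 h2 h3 h4 h5 h6 h7
    rw [h7, Pi.add_apply, h1, h2, h3, h4, h5, h6]

/-- Superposition operators with a parameter. -/
theorem superpose [FiniteDimensional ℝ V] {J : E → α → V → V'} (hJ : IsC1Family μ J)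
    (h : IsC1Op Φ v v') (γ : P →L[ℝ] E) :
    IsC1Op (fun p => hJ.op (γ p, Φ p)) (fun p t => J (γ p) t (v p t))
      (fun p d t => J (γ d) t (v p t) + fderiv ℝ (J (γ p) t) (v p t) (v' p d t)) where
  contDiff := hJ.contDiff_op.comp (γ.contDiff.prodMk h.contDiff)
  val p := by
    filter_upwards [hJ.coeFn_op (γ p, Φ p), h.val p] with t h1 h2
    rw [h1, h2]
  deriv p d := by
    have h0 : fderiv ℝ (fun p => hJ.op (γ p, Φ p)) p d
        = hJ.opDeriv (γ p, Φ p) (γ d, fderiv ℝ Φ p d) := by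
      have h1 : HasFDerivAt (fun p => (γ p, Φ p)) (γ.prod (fderiv ℝ Φ p)) p :=
        γ.hasFDerivAt.prodMk (h.hasFDerivAt p)
      exact DFunLike.congr_fun ((hJ.hasFDerivAt_op (γ p, Φ p)).comp p h1).fderiv d
    rw [h0]
    filter_upwards [hJ.coeFn_opDeriv (γ p, Φ p) (γ d, fderiv ℝ Φ p d), h.val p, h.deriv p d]
      with t h1 h2 h3
    rw [h1, h2, h3]

/-- The superposition operator of a single function. -/
theorem superpose_const [FiniteDimensional ℝ V] {F : α → V → V'}
    (hF : IsC1Family μ fun (c : ℝ) t w => c • F t w) (h : IsC1Op Φ v v') :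
    IsC1Op (fun p => hF.op (1, Φ p)) (fun p t => F t (v p t))
      (fun p d t => fderiv ℝ (F t) (v p t) (v' p d t)) where
  contDiff := hF.contDiff_op.comp (contDiff_const.prodMk h.contDiff)
  val p := by
    filter_upwards [hF.coeFn_op (1, Φ p), h.val p] with t h1 h2
    rw [h1, h2, one_smul]
  deriv p d := by
    have h0 : fderiv ℝ (fun p => hF.op (1, Φ p)) p d
        = hF.opDeriv (1, Φ p) (0, fderiv ℝ Φ p d) := by
      have h1 : HasFDerivAt (fun p => ((1 : ℝ), Φ p)) ((0 : P →L[ℝ] ℝ).prod (fderiv ℝ Φ p)) p :=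
        (hasFDerivAt_const (1 : ℝ) p).prodMk (h.hasFDerivAt p)
      exact DFunLike.congr_fun ((hF.hasFDerivAt_op (1, Φ p)).comp p h1).fderiv d
    rw [h0]
    filter_upwards [hF.coeFn_opDeriv (1, Φ p) (0, fderiv ℝ Φ p d), h.val p, h.deriv p d]
      with t h1 h2 h3
    rw [h1, h2, h3, zero_smul, zero_add]
    simp only [one_smul]

end IsC1Op

end C1Op

/-- The gradient along a curve of the integrand of the Lagrangian, `DH[t] ∘ (id, g_y[t])` with
`H = l + λᵀ f`, depends smoothly on curve, costate and component function. -/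
theorem exists_isC1Op_gradient {α : Type*} {m : MeasurableSpace α} {μ : Measure α} {n : ℕ}
    {P 𝔾 Y G : Type*} [NormedAddCommGroup P] [NormedSpace ℝ P] [NormedAddCommGroup 𝔾]
    [NormedSpace ℝ 𝔾] [NormedAddCommGroup Y] [NormedSpace ℝ Y] [FiniteDimensional ℝ Y]
    [NormedAddCommGroup G] [NormedSpace ℝ G] [FiniteDimensional ℝ G]
    {g : 𝔾 → α → Y → G} {f : α → Y × G → Rn n} {l : α → Y × G → ℝ}
    (hg' : IsC1Family μ fun c t => fderiv ℝ (g c t))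
    (hf' : IsC1Family μ fun (c : ℝ) t w => c • fderiv ℝ (f t) w)
    (hl' : IsC1Family μ fun (c : ℝ) t w => c • fderiv ℝ (l t) w)
    (γ : P →L[ℝ] 𝔾) {Φw : P → Lp Y ∞ μ} {w : P → α → Y} {w' : P → P → α → Y}
    (hw : IsC1Op Φw w w') {Φv : P → Lp (Y × G) ∞ μ} {v : P → α → Y × G} {v' : P → P → α → Y × G}
    (hv : IsC1Op Φv v v') {Φμ : P → Lp (Rn n) ∞ μ} {lam : P → α → Rn n} {lam' : P → P → α → Rn n}
    (hlam : IsC1Op Φμ lam lam') :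
    ∃ Θ : P → Lp (Y →L[ℝ] ℝ) ∞ μ, IsC1Op Θ
      (fun p t => (fderiv ℝ (l t) (v p t) + pairL (lam p t) (fderiv ℝ (f t) (v p t))).comp
        ((ContinuousLinearMap.id ℝ Y).prod (fderiv ℝ (g (γ p) t) (w p t))))
      (fun p d t =>
        (fderiv ℝ (fderiv ℝ (l t)) (v p t) (v' p d t)
          + pairL (lam p t) (fderiv ℝ (fderiv ℝ (f t)) (v p t) (v' p d t))
          + pairL (lam' p d t) (fderiv ℝ (f t) (v p t))).comp
          ((ContinuousLinearMap.id ℝ Y).prod (fderiv ℝ (g (γ p) t) (w p t)))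
        + ((fderiv ℝ (l t) (v p t) + pairL (lam p t) (fderiv ℝ (f t) (v p t))).comp
            (ContinuousLinearMap.inr ℝ Y G)).comp
          (fderiv ℝ (g (γ d) t) (w p t) + fderiv ℝ (fderiv ℝ (g (γ p) t)) (w p t) (w' p d t))) := by
  have hH := (IsC1Op.superpose_const hl' hv).add
    (IsC1Op.bilin (pairL (n := n) (W := Y × G)) hlam (IsC1Op.superpose_const hf' hv))
  have hΓ := IsC1Op.superpose hg' hw γ
  have h1 := hH.map ((ContinuousLinearMap.compL ℝ Y (Y × G) ℝ).flip (ContinuousLinearMap.inl ℝ Y G))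
  have h2 := hH.map ((ContinuousLinearMap.compL ℝ G (Y × G) ℝ).flip (ContinuousLinearMap.inr ℝ Y G))
  have h3 := h1.add (IsC1Op.bilin (ContinuousLinearMap.compL ℝ Y G ℝ) h2 hΓ)
  have hsplit : ∀ (h : Y × G →L[ℝ] ℝ) (Γ : Y →L[ℝ] G),
      h.comp (ContinuousLinearMap.inl ℝ Y G) + (h.comp (ContinuousLinearMap.inr ℝ Y G)).comp Γ
        = h.comp ((ContinuousLinearMap.id ℝ Y).prod Γ) := by
    intro h Γ
    ext y
    have : (y, Γ y) = (y, 0) + (0, Γ y) := by simp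
    simp only [_root_.add_apply, ContinuousLinearMap.comp_apply, ContinuousLinearMap.inl_apply,
      ContinuousLinearMap.inr_apply, ContinuousLinearMap.prod_apply, ContinuousLinearMap.id_apply]
    rw [this, map_add]
  refine ⟨_, h3.contDiff, fun p => ?_, fun p d => ?_⟩
  · filter_upwards [h3.val p] with t ht
    rw [ht, ← hsplit]
    rfl
  · filter_upwards [h3.deriv p d] with t ht
    rw [ht, ← hsplit]
    simp only [ContinuousLinearMap.flip_apply, ContinuousLinearMap.compL_apply]
    ext y
    simp only [_root_.add_apply, ContinuousLinearMap.comp_apply]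
    ring

/-! ### The data of the problem as superposition operators -/

section

set_option maxSynthPendingDepth 3


section IteratedDerivatives

variable {W V : Type*} [NormedAddCommGroup W] [NormedSpace ℝ W] [NormedAddCommGroup V]
  [NormedSpace ℝ V] (F : W → V) (w w' : W)

theorem norm_iteratedFDeriv_succ_sub (n : ℕ) :
    ‖iteratedFDeriv ℝ (n + 1) F w - iteratedFDeriv ℝ (n + 1) F w'‖
      = ‖iteratedFDeriv ℝ n (fderiv ℝ F) w - iteratedFDeriv ℝ n (fderiv ℝ F) w'‖ := by
  rw [iteratedFDeriv_succ_eq_comp_right, iteratedFDeriv_succ_eq_comp_right, ← dist_eq_norm,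
    ← dist_eq_norm]
  exact (continuousMultilinearCurryRightEquiv' ℝ n W V).symm.dist_map _ _

theorem norm_iteratedFDeriv_zero_sub :
    ‖iteratedFDeriv ℝ 0 F w - iteratedFDeriv ℝ 0 F w'‖ = ‖F w - F w'‖ := by
  rw [iteratedFDeriv_zero_eq_comp, Function.comp_apply, Function.comp_apply, ← map_sub,
    LinearIsometryEquiv.norm_map]

theorem norm_iteratedFDeriv_two : ‖iteratedFDeriv ℝ 2 F w‖ = ‖fderiv ℝ (fderiv ℝ F) w‖ := by
  rw [← norm_iteratedFDeriv_fderiv, norm_iteratedFDeriv_one]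

theorem norm_iteratedFDeriv_three :
    ‖iteratedFDeriv ℝ 3 F w‖ = ‖fderiv ℝ (fderiv ℝ (fderiv ℝ F)) w‖ := by
  rw [← norm_iteratedFDeriv_fderiv, norm_iteratedFDeriv_two]

end IteratedDerivatives

/-- A single function with locally uniform bounds defines a family parametrized by `ℝ`. -/
theorem isC1Family_smul {α : Type*} {m : MeasurableSpace α} {μ : Measure α} {W V : Type*}
    [NormedAddCommGroup W] [NormedSpace ℝ W] [NormedAddCommGroup V] [NormedSpace ℝ V]
    {F : α → W → V} (hm : ∀ w, AEStronglyMeasurable (fun t => F t w) μ)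
    (hd : ∀ᵐ t ∂μ, Differentiable ℝ (F t))
    (hb : ∀ R : ℝ, ∃ C : ℝ, 0 ≤ C ∧ ∀ᵐ t ∂μ, ∀ w ∈ Metric.closedBall (0 : W) R,
      ‖F t w‖ ≤ C ∧ ‖fderiv ℝ (F t) w‖ ≤ C ∧ ∀ w' ∈ Metric.closedBall (0 : W) R,
        ‖fderiv ℝ (F t) w - fderiv ℝ (F t) w'‖ ≤ C * ‖w - w'‖) :
    IsC1Family μ fun (c : ℝ) t w => c • F t w where
  add c d := Eventually.of_forall fun t => by
    funext w
    exact add_smul c d (F t w)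
  smul c d := Eventually.of_forall fun t => by
    funext w
    exact mul_smul c d (F t w)
  meas c w := (hm w).const_smul c
  diff c := by filter_upwards [hd] with t ht using ht.const_smul c
  bound R := by
    obtain ⟨C, hC0, hC⟩ := hb R
    refine ⟨C, hC0, fun c => ?_⟩
    filter_upwards [hC, hd] with t h1 h2 w hw
    have h3 : ∀ w, fderiv ℝ (fun w => c • F t w) w = c • fderiv ℝ (F t) w := fun w =>
      fderiv_const_smul (h2 w) c
    obtain ⟨k1, k2, k3⟩ := h1 w hw
    have hc := norm_nonneg c
    refine ⟨?_, ?_, fun w' hw' => ?_⟩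
    · rw [norm_smul, mul_comm]
      gcongr
    · rw [h3, norm_smul, mul_comm]
      gcongr
    · rw [h3, h3, ← smul_sub, norm_smul]
      calc ‖c‖ * ‖fderiv ℝ (F t) w - fderiv ℝ (F t) w'‖ ≤ ‖c‖ * (C * ‖w - w'‖) := by
            gcongr
            exact k3 w' hw'
        _ = _ := by ring

section StrongSmooth

variable {I : TimeInterval} {W V : Type*} [NormedAddCommGroup W] [NormedSpace ℝ W]
  [NormedAddCommGroup V] [NormedSpace ℝ V] {F : ℝ → W → V} (hF : StrongSmooth I F)
include hF

theorem StrongSmooth.exists_bound (R : ℝ) : ∃ C : ℝ, 0 ≤ C ∧ ∀ s : ℕ, s ≤ 2 → ∀ᵐ t ∂I.vol,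
    ∀ w ∈ Metric.closedBall (0 : W) R, ‖iteratedFDeriv ℝ s (F t) w‖ ≤ C ∧
      ∀ w' ∈ Metric.closedBall (0 : W) R,
        ‖iteratedFDeriv ℝ s (F t) w - iteratedFDeriv ℝ s (F t) w'‖ ≤ C * ‖w - w'‖ := by
  obtain ⟨-, -, ⟨K, hK⟩, hL⟩ := hF
  obtain ⟨L, hL⟩ := hL (max R 1) (by positivity)
  refine ⟨|K| + |L| * max R 1, by positivity, fun s hs => ?_⟩
  filter_upwards [hK s hs, hL s hs] with t h1 h2 w hw
  have hsub : Metric.closedBall (0 : W) R ⊆ Metric.closedBall 0 (max R 1) :=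
    Metric.closedBall_subset_closedBall (le_max_left _ _)
  have h0 : (0 : W) ∈ Metric.closedBall 0 (max R 1) := Metric.mem_closedBall_self (by positivity)
  have hw1 : ‖w‖ ≤ max R 1 := mem_closedBall_zero_iff.1 (hsub hw)
  have hmul : 1 ≤ max R 1 := le_max_right _ _
  constructor
  · calc ‖iteratedFDeriv ℝ s (F t) w‖
        = ‖iteratedFDeriv ℝ s (F t) 0
            + (iteratedFDeriv ℝ s (F t) w - iteratedFDeriv ℝ s (F t) 0)‖ := by
          rw [add_sub_cancel]
      _ ≤ K + L * ‖w - 0‖ := (norm_add_le _ _).trans (add_le_add h1 (h2 w (hsub hw) 0 h0))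
      _ ≤ |K| + |L| * max R 1 := by
          rw [sub_zero]
          exact add_le_add (le_abs_self K)
            (mul_le_mul (le_abs_self L) hw1 (norm_nonneg _) (abs_nonneg _))
  · intro w' hw'
    refine (h2 w (hsub hw) w' (hsub hw')).trans ?_
    gcongr
    calc L ≤ |L| * 1 := by rw [mul_one]; exact le_abs_self L
      _ ≤ |L| * max R 1 := by gcongr
      _ ≤ |K| + |L| * max R 1 := le_add_of_nonneg_left (abs_nonneg _)

theorem StrongSmooth.differentiable : ∀ᵐ t ∂I.vol, Differentiable ℝ (F t) := by
  filter_upwards [hF.2.1] with t ht using ht.differentiable two_ne_zero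

theorem StrongSmooth.differentiable_fderiv : ∀ᵐ t ∂I.vol, Differentiable ℝ (fderiv ℝ (F t)) := by
  filter_upwards [hF.2.1] with t ht
  exact (ht.fderiv_right (m := 1) (by norm_num)).differentiable one_ne_zero

theorem StrongSmooth.isC1Family : IsC1Family I.vol fun (c : ℝ) t w => c • F t w := by
  refine isC1Family_smul hF.1 hF.differentiable fun R => ?_
  obtain ⟨C, hC0, hC⟩ := hF.exists_bound R
  refine ⟨C, hC0, ?_⟩
  filter_upwards [hC 0 (by norm_num), hC 1 (by norm_num)] with t h0 h1 w hw
  refine ⟨?_, ?_, fun w' hw' => ?_⟩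
  · rw [← norm_iteratedFDeriv_zero (𝕜 := ℝ)]
    exact (h0 w hw).1
  · rw [← norm_iteratedFDeriv_one]
    exact (h1 w hw).1
  · have h2 := (h1 w hw).2 w' hw'
    rwa [norm_iteratedFDeriv_succ_sub, norm_iteratedFDeriv_zero_sub] at h2

theorem StrongSmooth.isC1Family_fderiv [FiniteDimensional ℝ W] :
    IsC1Family I.vol fun (c : ℝ) t w => c • fderiv ℝ (F t) w := by
  refine isC1Family_smul (F := fun t => fderiv ℝ (F t))
    (aestronglyMeasurable_fderiv hF.1 hF.differentiable) hF.differentiable_fderiv fun R => ?_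
  obtain ⟨C, hC0, hC⟩ := hF.exists_bound R
  refine ⟨C, hC0, ?_⟩
  filter_upwards [hC 1 (by norm_num), hC 2 (by norm_num)] with t h1 h2 w hw
  refine ⟨?_, ?_, fun w' hw' => ?_⟩
  · rw [← norm_iteratedFDeriv_one]
    exact (h1 w hw).1
  · rw [← norm_iteratedFDeriv_two]
    exact (h2 w hw).1
  · have h3 := (h2 w hw).2 w' hw'
    rwa [norm_iteratedFDeriv_succ_sub, norm_iteratedFDeriv_succ_sub,
      norm_iteratedFDeriv_zero_sub] at h3

end StrongSmooth

namespace GSpace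

variable {I : TimeInterval} {nx nu np ng : ℕ}

theorem ae_norm_iteratedFDeriv_le {s : ℕ} (g : GSpace I s nx nu np ng) {n : ℕ} (hn : n ≤ s) :
    ∀ᵐ t ∂I.vol, ∀ y, ‖iteratedFDeriv ℝ n (g.fn t) y‖ ≤ ‖g‖ := by
  have h1 : essSup (fun t => ⨆ y, ‖iteratedFDeriv ℝ n (g.fn t) y‖ₑ) I.vol ≤ gNorm I s g.fn :=
    Finset.single_le_sum (f := fun n => essSup (fun t => ⨆ y,
      ‖iteratedFDeriv ℝ n (g.fn t) y‖ₑ) I.vol)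
      (fun _ _ => zero_le) (Finset.mem_range.2 (Nat.lt_succ_of_le hn))
  filter_upwards [ENNReal.ae_le_essSup
    (fun t => ⨆ y, ‖iteratedFDeriv ℝ n (g.fn t) y‖ₑ)] with t ht y
  have h2 : ‖iteratedFDeriv ℝ n (g.fn t) y‖ₑ ≤ gNorm I s g.fn :=
    (le_iSup (fun y => ‖iteratedFDeriv ℝ n (g.fn t) y‖ₑ) y).trans (ht.trans h1)
  have h3 := ENNReal.toReal_mono g.fn_mem.2.2.ne h2
  rwa [toReal_enorm] at h3

variable (g : GSpace I 3 nx nu np ng)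

theorem contDiff : ∀ᵐ t ∂I.vol, ContDiff ℝ 3 (g.fn t) := g.fn_mem.1

theorem differentiable : ∀ᵐ t ∂I.vol, Differentiable ℝ (g.fn t) := by
  filter_upwards [g.contDiff] with t ht using ht.differentiable three_ne_zero

theorem contDiff_fderiv : ∀ᵐ t ∂I.vol, ContDiff ℝ 2 (fderiv ℝ (g.fn t)) := by
  filter_upwards [g.contDiff] with t ht using ht.fderiv_right (m := 2) (by norm_num)

theorem differentiable_fderiv : ∀ᵐ t ∂I.vol, Differentiable ℝ (fderiv ℝ (g.fn t)) := by
  filter_upwards [g.contDiff_fderiv] with t ht using ht.differentiable two_ne_zero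

theorem differentiable_fderiv_fderiv :
    ∀ᵐ t ∂I.vol, Differentiable ℝ (fderiv ℝ (fderiv ℝ (g.fn t))) := by
  filter_upwards [g.contDiff_fderiv] with t ht
  exact (ht.fderiv_right (m := 1) (by norm_num)).differentiable one_ne_zero

theorem ae_norm_le : ∀ᵐ t ∂I.vol, ∀ y, ‖g.fn t y‖ ≤ ‖g‖ ∧ ‖fderiv ℝ (g.fn t) y‖ ≤ ‖g‖ ∧
    ‖fderiv ℝ (fderiv ℝ (g.fn t)) y‖ ≤ ‖g‖ ∧
    (∀ y', ‖fderiv ℝ (g.fn t) y - fderiv ℝ (g.fn t) y'‖ ≤ ‖g‖ * ‖y - y'‖) ∧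
    ∀ y', ‖fderiv ℝ (fderiv ℝ (g.fn t)) y - fderiv ℝ (fderiv ℝ (g.fn t)) y'‖ ≤ ‖g‖ * ‖y - y'‖ := by
  filter_upwards [g.ae_norm_iteratedFDeriv_le (n := 0) (by norm_num),
    g.ae_norm_iteratedFDeriv_le (n := 1) (by norm_num),
    g.ae_norm_iteratedFDeriv_le (n := 2) (by norm_num),
    g.ae_norm_iteratedFDeriv_le (n := 3) (by norm_num), g.differentiable_fderiv,
    g.differentiable_fderiv_fderiv] with t h0 h1 h2 h3 k1 k2 y
  refine ⟨?_, ?_, ?_, fun y' => ?_, fun y' => ?_⟩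
  · rw [← norm_iteratedFDeriv_zero (𝕜 := ℝ)]
    exact h0 y
  · rw [← norm_iteratedFDeriv_one]
    exact h1 y
  · rw [← norm_iteratedFDeriv_two]
    exact h2 y
  · refine Convex.norm_image_sub_le_of_norm_fderiv_le (fun x _ => k1 x) (fun x _ => ?_) convex_univ
      (mem_univ _) (mem_univ _)
    rw [← norm_iteratedFDeriv_two]
    exact h2 x
  · refine Convex.norm_image_sub_le_of_norm_fderiv_le (fun x _ => k2 x) (fun x _ => ?_) convex_univ
      (mem_univ _) (mem_univ _)
    rw [← norm_iteratedFDeriv_three]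
    exact h3 x

/-- Component functions of distance zero agree for almost all `t`. -/
theorem ae_eq_of_norm_sub_eq_zero {g h : GSpace I 3 nx nu np ng} (hgh : ‖g - h‖ = 0) :
    ∀ᵐ t ∂I.vol, g.fn t = h.fn t := by
  filter_upwards [(g - h).ae_norm_le] with t ht
  funext y
  have h1 := (ht y).1
  rw [hgh] at h1
  exact sub_eq_zero.1 (norm_le_zero_iff.1 h1)

end GSpace

/-- The normed space associated with the seminormed space of component functions. -/
abbrev GQuot (I : TimeInterval) (nx nu np ng : ℕ) : Type :=
  SeparationQuotient (GSpace I 3 nx nu np ng)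

namespace GQuot

variable {I : TimeInterval} {nx nu np ng : ℕ}

/-- A representative of a class of component functions, depending linearly on the class. -/
def rep (c : GQuot I nx nu np ng) : ℝ → Yn nx nu np → Rn ng :=
  (SeparationQuotient.outCLM ℝ (GSpace I 3 nx nu np ng) c).fn

theorem norm_out (c : GQuot I nx nu np ng) :
    ‖SeparationQuotient.outCLM ℝ (GSpace I 3 nx nu np ng) c‖ = ‖c‖ := by
  conv_rhs => rw [← SeparationQuotient.mk_outCLM ℝ c]
  exact (SeparationQuotient.norm_mk _).symm

theorem rep_add (c d : GQuot I nx nu np ng) : (c + d).rep = c.rep + d.rep := by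
  rw [rep, map_add]
  rfl

theorem rep_smul (r : ℝ) (c : GQuot I nx nu np ng) : (r • c).rep = r • c.rep := by
  rw [rep, map_smul]
  rfl

theorem rep_mk (g : GSpace I 3 nx nu np ng) :
    ∀ᵐ t ∂I.vol, rep (I := I) (SeparationQuotient.mk g) t = g.fn t := by
  refine GSpace.ae_eq_of_norm_sub_eq_zero ?_
  rw [← SeparationQuotient.norm_mk, SeparationQuotient.mk_sub, SeparationQuotient.mk_outCLM,
    sub_self, norm_zero]

theorem isC1Family_rep : IsC1Family I.vol (rep (I := I) (nx := nx) (nu := nu) (np := np)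
    (ng := ng)) where
  add g h := Eventually.of_forall fun t => congrFun (rep_add g h) t
  smul c g := Eventually.of_forall fun t => congrFun (rep_smul c g) t
  meas g y := (GSpace.fn_mem _).2.1 y
  diff g := GSpace.differentiable _
  bound R := by
    refine ⟨1, zero_le_one, fun g => ?_⟩
    filter_upwards [(SeparationQuotient.outCLM ℝ
      (GSpace I 3 nx nu np ng) g).ae_norm_le] with t ht y _
    rw [norm_out] at ht
    obtain ⟨h0, h1, -, h2, -⟩ := ht y
    rw [one_mul]
    exact ⟨h0, h1, fun y' _ => h2 y'⟩

theorem isC1Family_fderiv_rep :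
    IsC1Family I.vol fun (c : GQuot I nx nu np ng) t => fderiv ℝ (c.rep t) where
  add g h := by
    filter_upwards [GSpace.differentiable (SeparationQuotient.outCLM ℝ _ g),
      GSpace.differentiable (SeparationQuotient.outCLM ℝ _ h)] with t h1 h2
    funext y
    rw [rep_add]
    exact fderiv_add (h1 y) (h2 y)
  smul c g := by
    filter_upwards [GSpace.differentiable (SeparationQuotient.outCLM ℝ _ g)] with t h1
    funext y
    rw [rep_smul]
    exact fderiv_const_smul (h1 y) c
  meas g y := aestronglyMeasurable_fderiv (GSpace.fn_mem _).2.1 (GSpace.differentiable _) y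
  diff g := GSpace.differentiable_fderiv _
  bound R := by
    refine ⟨1, zero_le_one, fun g => ?_⟩
    filter_upwards [(SeparationQuotient.outCLM ℝ
      (GSpace I 3 nx nu np ng) g).ae_norm_le] with t ht y _
    rw [norm_out] at ht
    obtain ⟨-, h0, h1, -, h2⟩ := ht y
    rw [one_mul]
    exact ⟨h0, h1, fun y' _ => h2 y'⟩

end GQuot

end

/-! ### The linear-quadratic model along a trajectory -/

section

set_option maxSynthPendingDepth 3


section Pointwise

variable {m n : ℕ} {W : Type*} [NormedAddCommGroup W] [NormedSpace ℝ W]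

theorem pgrad_eq_rz (ι : Rn n →L[ℝ] W) (F : W → ℝ) (w : W) : pgrad ι F w = rz ι (fderiv ℝ F w) :=
  rfl

theorem phess_apply (ιa : Rn m →L[ℝ] W) (ιb : Rn n →L[ℝ] W) {F : W → ℝ} {w : W}
    (h : DifferentiableAt ℝ (fderiv ℝ F) w) (b : Rn n) :
    phess ιa ιb F w b = rz ιa (fderiv ℝ (fderiv ℝ F) w (ιb b)) := by
  have h1 : HasFDerivAt (pgrad ιa F) ((rz ιa).comp (fderiv ℝ (fderiv ℝ F) w)) w :=
    (rz ιa).hasFDerivAt.comp w h.hasFDerivAt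
  rw [phess, pjac, h1.fderiv]
  rfl

section AddInner

variable {l : W → ℝ} {f : W → Rn n} (a : Rn n) (hl : Differentiable ℝ l) (hf : Differentiable ℝ f)
include hl hf

theorem fderiv_add_inner : fderiv ℝ (fun w => l w + ⟪a, f w⟫_ℝ)
    = fun w => fderiv ℝ l w + pairL a (fderiv ℝ f w) := by
  funext w
  exact ((hl w).hasFDerivAt.add ((ipL n a).hasFDerivAt.comp w (hf w).hasFDerivAt)).fderiv

theorem hasFDerivAt_fderiv_add_inner {w : W} (hl' : DifferentiableAt ℝ (fderiv ℝ l) w)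
    (hf' : DifferentiableAt ℝ (fderiv ℝ f) w) :
    HasFDerivAt (fderiv ℝ fun w => l w + ⟪a, f w⟫_ℝ)
      (fderiv ℝ (fderiv ℝ l) w + (pairL (W := W) a).comp (fderiv ℝ (fderiv ℝ f) w)) w := by
  rw [fderiv_add_inner a hl hf]
  exact hl'.hasFDerivAt.add ((pairL (W := W) a).hasFDerivAt.comp w hf'.hasFDerivAt)

theorem phess_add_inner {k j : ℕ} (ιa : Rn k →L[ℝ] W) (ιb : Rn j →L[ℝ] W) {w : W}
    (hl' : DifferentiableAt ℝ (fderiv ℝ l) w) (hf' : DifferentiableAt ℝ (fderiv ℝ f) w) (b : Rn j) :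
    phess ιa ιb (fun w => l w + ⟪a, f w⟫_ℝ) w b
      = rz ιa ((fderiv ℝ (fderiv ℝ l) w + (pairL (W := W) a).comp (fderiv ℝ (fderiv ℝ f) w))
        (ιb b)) := by
  have h := hasFDerivAt_fderiv_add_inner a hl hf hl' hf'
  rw [phess_apply _ _ h.differentiableAt, h.fderiv]

end AddInner

theorem phess_inner (ιa : Rn m →L[ℝ] W) {k : ℕ} (ιb : Rn k →L[ℝ] W) {f : W → Rn n} (a : Rn n)
    (hf : Differentiable ℝ f) {w : W} (hf' : DifferentiableAt ℝ (fderiv ℝ f) w) (b : Rn k)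
      (v : Rn m) :
    ⟪phess ιa ιb (fun w => ⟪a, f w⟫_ℝ) w b, v⟫_ℝ
      = ⟪a, fderiv ℝ (fderiv ℝ f) w (ιb b) (ιa v)⟫_ℝ := by
  have h1 : fderiv ℝ (fun w => ⟪a, f w⟫_ℝ) = fun w => pairL a (fderiv ℝ f w) :=
    funext fun w => ((ipL n a).hasFDerivAt.comp w (hf w).hasFDerivAt).fderiv
  have h2 : HasFDerivAt (fderiv ℝ fun w => ⟪a, f w⟫_ℝ)
      ((pairL (W := W) a).comp (fderiv ℝ (fderiv ℝ f) w)) w := by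
    rw [h1]
    exact (pairL (W := W) a).hasFDerivAt.comp w hf'.hasFDerivAt
  rw [phess_apply _ _ h2.differentiableAt, inner_rz, h2.fderiv]
  rfl

theorem isSymm_fderiv_fderiv {V : Type*} [NormedAddCommGroup V] [NormedSpace ℝ V] {F : W → V}
    (hF : ContDiff ℝ 2 F) (w v v' : W) :
    fderiv ℝ (fderiv ℝ F) w v v' = fderiv ℝ (fderiv ℝ F) w v' v :=
  (hF.contDiffAt.isSymmSndFDerivAt (x := w) (by simp)).eq v v'

theorem adjoint_comp_eq_rz (T : W →L[ℝ] Rn m) (ι : Rn n →L[ℝ] W) (v : Rn m) :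
    adjoint (T.comp ι) v = rz ι (pairL v T) := by
  refine eq_rz_iff.2 fun a => ?_
  rw [ContinuousLinearMap.adjoint_inner_left]
  rfl

end Pointwise

section Pull

variable {Y W : Type*} [NormedAddCommGroup Y] [NormedSpace ℝ Y] [NormedAddCommGroup W]
  [NormedSpace ℝ W]

/-- The pull-back of a bilinear form. -/
def pullBilin (B : W →L[ℝ] W →L[ℝ] ℝ) (S : Y →L[ℝ] W) : Y →L[ℝ] Y →L[ℝ] ℝ :=
  ((ContinuousLinearMap.compL ℝ Y W ℝ).flip S).comp (B.comp S)

@[simp] theorem pullBilin_apply (B : W →L[ℝ] W →L[ℝ] ℝ) (S : Y →L[ℝ] W) (v v' : Y) :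
    pullBilin B S v v' = B (S v) (S v') := rfl

variable {α : Type*} {m : MeasurableSpace α} {μ : Measure α}

theorem memLp_pullBilin {B : α → W →L[ℝ] W →L[ℝ] ℝ} {S : α → Y →L[ℝ] W} (hB : MemLp B ∞ μ)
    (hS : MemLp S ∞ μ) : MemLp (fun t => pullBilin (B t) (S t)) ∞ μ :=
  memLp_top_clm_comp (memLp_map (ContinuousLinearMap.compL ℝ Y W ℝ).flip hS)
    (memLp_top_clm_comp hB hS)

theorem memLp_pairL {n : ℕ} {q : ℝ≥0∞} {a : α → Rn n} {T : α → W →L[ℝ] Rn n} (ha : MemLp a q μ)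
    (hT : MemLp T ∞ μ) : MemLp (fun t => pairL (a t) (T t)) q μ :=
  (pairL (n := n) (W := W)).memLp_of_bilin q ha hT

theorem memLp_pairL_comp {n : ℕ} {a : α → Rn n} {T : α → Y →L[ℝ] W →L[ℝ] Rn n}
    (ha : MemLp a ∞ μ) (hT : MemLp T ∞ μ) :
    MemLp (fun t => ((pairL (a t) : (W →L[ℝ] Rn n) →L[ℝ] W →L[ℝ] ℝ)).comp (T t)) ∞ μ := by
  have h : MemLp (fun t => (pairL (a t) : (W →L[ℝ] Rn n) →L[ℝ] W →L[ℝ] ℝ)) ∞ μ :=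
    memLp_map (E := Rn n) (F := (W →L[ℝ] Rn n) →L[ℝ] W →L[ℝ] ℝ) (pairL (W := W) (n := n)) ha
  exact memLp_top_clm_comp h hT

theorem memLp_compL_comp {V : Type*} [NormedAddCommGroup V] [NormedSpace ℝ V]
    {h : α → V →L[ℝ] ℝ} {T : α → Y →L[ℝ] W →L[ℝ] V}
    (hh : MemLp h ∞ μ) (hT : MemLp T ∞ μ) :
    MemLp (fun t => (ContinuousLinearMap.compL ℝ W V ℝ (h t)).comp (T t)) ∞ μ :=
  memLp_top_clm_comp (memLp_map (ContinuousLinearMap.compL ℝ W V ℝ) hh) hT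

end Pull

section Along

variable {nx nu np ng : ℕ} (P : Bolza nx nu np ng) (g : ℝ → Yn nx nu np → Rn ng)
  (z : ZSpace P.I nx nu np)

/-- The derivative of `y ↦ (y, g(t, y))`. -/
def lift (t : ℝ) : Yn nx nu np →L[ℝ] Yn nx nu np × Rn ng :=
  (ContinuousLinearMap.id ℝ (Yn nx nu np)).prod (fderiv ℝ (g t) (curve z.1 t))

/-- The derivative of the Hamiltonian. -/
def hamD (t : ℝ) : Yn nx nu np × Rn ng →L[ℝ] ℝ :=
  fderiv ℝ (P.l t) (pt P g z.1 t) + pairL (z.2.val t) (fderiv ℝ (P.f t) (pt P g z.1 t))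

/-- The second derivative of the Hamiltonian. -/
def hamD2 (t : ℝ) : Yn nx nu np × Rn ng →L[ℝ] Yn nx nu np × Rn ng →L[ℝ] ℝ :=
  fderiv ℝ (fderiv ℝ (P.l t)) (pt P g z.1 t)
    + (pairL (z.2.val t)).comp (fderiv ℝ (fderiv ℝ (P.f t)) (pt P g z.1 t))

/-- The matrix `(A B C)` of the linearized differential equation. -/
def dynAt (t : ℝ) : Yn nx nu np →L[ℝ] Rn nx := (fderiv ℝ (P.f t) (pt P g z.1 t)).comp (lift P g z t)

/-- The matrix `(H_{ab})`, `a, b ∈ {x, u, p}`, as a bilinear form. -/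
def hessAt (t : ℝ) : Yn nx nu np →L[ℝ] Yn nx nu np →L[ℝ] ℝ :=
  pullBilin (hamD2 P g z t) (lift P g z t)
    + (ContinuousLinearMap.compL ℝ (Yn nx nu np) (Rn ng) ℝ ((hamD P g z t).comp ιg)).comp
      (fderiv ℝ (fderiv ℝ (g t)) (curve z.1 t))

/-- The total derivative with respect to `y` of the integrand `L(t, y, g(t, y))`. -/
def totD (L : ℝ → Yn nx nu np × Rn ng → ℝ) (t : ℝ) : Yn nx nu np →L[ℝ] ℝ :=
  (fderiv ℝ (L t) (pt P g z.1 t)).comp (lift P g z t)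

/-- The change of the gradient of the Lagrangian integrand under a variation `δg` of the component
function. -/
def varD (δg : ℝ → Yn nx nu np → Rn ng) (t : ℝ) : Yn nx nu np →L[ℝ] ℝ :=
  (hamD2 P g z t (ιg (δg t (curve z.1 t)))).comp (lift P g z t)
    + ((hamD P g z t).comp ιg).comp (fderiv ℝ (δg t) (curve z.1 t))

variable {P g z}

theorem lift_apply (t : ℝ) (v : Yn nx nu np) :
    lift P g z t v = ιY v + ιg (fderiv ℝ (g t) (curve z.1 t) v) := by
  simp [lift, ιY, ιg]

theorem hessAt_apply (t : ℝ) (v v' : Yn nx nu np) :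
    hessAt P g z t v v' = hamD2 P g z t (lift P g z t v) (lift P g z t v')
      + hamD P g z t (ιg (fderiv ℝ (fderiv ℝ (g t)) (curve z.1 t) v v')) := rfl

theorem fTot_eq {n : ℕ} (ι : Rn n →L[ℝ] Yn nx nu np) (t : ℝ) :
    fTot P g z.1 ι t = (dynAt P g z t).comp ι := by
  ext1 v
  simp only [fTot, dynAt, ContinuousLinearMap.comp_apply, lift_apply, map_add, _root_.add_apply]
  rfl

theorem gradTot_eq (L : ℝ → Yn nx nu np × Rn ng → ℝ) {n : ℕ} (ι : Rn n →L[ℝ] Yn nx nu np) (t : ℝ) :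
    gradTot P g z.1 L ι t = rz ι (totD P g z L t) := by
  refine eq_rz_iff.2 fun v => ?_
  rw [gradTot, inner_add_left, ContinuousLinearMap.adjoint_inner_left, pgrad_eq_rz, pgrad_eq_rz,
    inner_rz, inner_rz]
  have h : totD P g z L t (ι v) = fderiv ℝ (L t) (pt P g z.1 t) (lift P g z t (ι v)) := rfl
  rw [h, lift_apply, map_add]
  rfl

variable (hl : StrongSmooth P.I P.l) (hf : StrongSmooth P.I P.f)
include hl hf

theorem fderiv_ham : ∀ᵐ t ∂P.I.vol, fderiv ℝ (ham P z t) (pt P g z.1 t) = hamD P g z t := by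
  filter_upwards [hl.differentiable, hf.differentiable] with t h1 h2
  exact congrFun (fderiv_add_inner (z.2.val t) h1 h2) _

theorem hamD2_symm : ∀ᵐ t ∂P.I.vol, ∀ v v', hamD2 P g z t v v' = hamD2 P g z t v' v := by
  filter_upwards [hl.2.1, hf.2.1] with t h1 h2 v v'
  exact congrArg₂ (· + ·) (isSymm_fderiv_fderiv h1 _ v v')
    (congrArg (fun c => ⟪z.2.val t, c⟫_ℝ) (isSymm_fderiv_fderiv h2 _ v v'))

theorem coefd_eq : ∀ᵐ t ∂P.I.vol, coefd P g z t = rz ιg (hamD P g z t) := by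
  filter_upwards [fderiv_ham (g := g) (z := z) hl hf] with t h1
  rw [coefd, pgrad_eq_rz, h1]

theorem phess_ham : ∀ᵐ t ∂P.I.vol, ∀ {m n : ℕ} (ιa : Rn m →L[ℝ] Yn nx nu np × Rn ng)
    (ιb : Rn n →L[ℝ] Yn nx nu np × Rn ng) (b : Rn n),
    phess ιa ιb (ham P z t) (pt P g z.1 t) b = rz ιa (hamD2 P g z t (ιb b)) := by
  filter_upwards [hl.differentiable, hf.differentiable, hl.differentiable_fderiv,
    hf.differentiable_fderiv] with t h1 h2 h3 h4 m n ιa ιb b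
  exact phess_add_inner (z.2.val t) h1 h2 ιa ιb (h3 _) (h4 _) b

theorem coefHg_eq : ∀ᵐ t ∂P.I.vol, ∀ {n : ℕ} (ιa : Rn n →L[ℝ] Yn nx nu np) (v : Rn n),
    coefHg P g z ιa t v = rz ιg (hamD2 P g z t (lift P g z t (ιa v))) := by
  filter_upwards [phess_ham (g := g) (z := z) hl hf] with t h1 n ιa v
  rw [lift_apply, map_add, map_add, coefHg, _root_.add_apply, ContinuousLinearMap.comp_apply,
    h1, h1]
  rfl

theorem coefH_eq (hg : ∀ᵐ t ∂P.I.vol, ContDiff ℝ 3 (g t)) : ∀ᵐ t ∂P.I.vol, ∀ {m n : ℕ}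
    (ιa : Rn m →L[ℝ] Yn nx nu np) (ιb : Rn n →L[ℝ] Yn nx nu np),
    coefH P g z ιa ιb t = (rz ιa).comp ((hessAt P g z t).comp ιb) := by
  filter_upwards [phess_ham (g := g) (z := z) hl hf, coefd_eq (g := g) (z := z) hl hf,
    hg] with t h1 h2 h3 m n ιa ιb
  have h4 : Differentiable ℝ (g t) := h3.differentiable three_ne_zero
  have h5 : Differentiable ℝ (fderiv ℝ (g t)) :=
    (h3.fderiv_right (m := 2) (by norm_num)).differentiable two_ne_zero
  ext1 b
  refine eq_rz_iff.2 fun a => ?_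
  have h8 : ⟪gCurv P g z ιa ιb t b, a⟫_ℝ
      = hamD P g z t (ιg (fderiv ℝ (fderiv ℝ (g t)) (curve z.1 t) (ιb b) (ιa a))) := by
    rw [gCurv, phess_inner _ _ _ h4 (h5 _), h2, inner_rz]
  have h10 : ((hessAt P g z t).comp ιb b) (ιa a) = hessAt P g z t (ιb b) (ιa a) := rfl
  have h9 : ∀ {k : ℕ} (ι : Rn k →L[ℝ] Yn nx nu np) (v : Rn k),
      gjac P g z.1 ι t v = fderiv ℝ (g t) (curve z.1 t) (ι v) := fun _ _ => rfl
  refine Eq.trans ?_ h10.symm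
  rw [hessAt_apply, ← h8]
  simp only [coefH, _root_.add_apply, ContinuousLinearMap.comp_apply, inner_add_left,
    ContinuousLinearMap.adjoint_inner_left, h1, inner_rz, lift_apply, map_add, h9]
  ring

end Along

end

/-! ### Coefficients along bounded curves -/

section AlongCurves

variable {α : Type*} {m : MeasurableSpace α} {μ : Measure α} {𝔾 W V : Type*}
  [NormedAddCommGroup 𝔾] [NormedSpace ℝ 𝔾] [NormedAddCommGroup W] [NormedSpace ℝ W]
  [NormedAddCommGroup V] [NormedSpace ℝ V] [FiniteDimensional ℝ W] {J : 𝔾 → α → W → V}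

omit [FiniteDimensional ℝ W] in
theorem IsC1Family.memLp_comp (hJ : IsC1Family μ J) (g : 𝔾) {w : α → W} (hw : MemLp w ∞ μ) :
    MemLp (fun t => J g t (w t)) ∞ μ := by
  refine (memLp_congr_ae ?_).1 (hJ.memLp g hw.toLp)
  filter_upwards [hw.coeFn_toLp] with t ht
  rw [ht]

theorem IsC1Family.memLp_fderiv_comp (hJ : IsC1Family μ J) (g : 𝔾) {w : α → W}
    (hw : MemLp w ∞ μ) : MemLp (fun t => fderiv ℝ (J g t) (w t)) ∞ μ := by
  refine (memLp_congr_ae ?_).1 (hJ.memLp_fderiv g hw.toLp)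
  filter_upwards [hw.coeFn_toLp] with t ht
  rw [ht]

variable {I : TimeInterval} {F : ℝ → W → V} {w : ℝ → W}

theorem StrongSmooth.memLp_fderiv (hF : StrongSmooth I F) (hw : MemLp w ∞ I.vol) :
    MemLp (fun t => fderiv ℝ (F t) (w t)) ∞ I.vol := by
  simpa only [one_smul] using hF.isC1Family_fderiv.memLp_comp 1 hw

theorem StrongSmooth.memLp_fderiv_fderiv (hF : StrongSmooth I F) (hw : MemLp w ∞ I.vol) :
    MemLp (fun t => fderiv ℝ (fderiv ℝ (F t)) (w t)) ∞ I.vol := by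
  simpa only [one_smul] using hF.isC1Family_fderiv.memLp_fderiv_comp 1 hw

end AlongCurves

namespace GSpace

variable {I : TimeInterval} {nx nu np ng : ℕ} (g : GSpace I 3 nx nu np ng)
  {w : ℝ → Yn nx nu np} (hw : MemLp w ∞ I.vol)
include hw

theorem memLp : MemLp (fun t => g.fn t (w t)) ∞ I.vol := by
  refine (memLp_congr_ae ?_).1 (GQuot.isC1Family_rep.memLp_comp (SeparationQuotient.mk g) hw)
  filter_upwards [GQuot.rep_mk g] with t ht
  rw [ht]

theorem memLp_fderiv : MemLp (fun t => fderiv ℝ (g.fn t) (w t)) ∞ I.vol := by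
  refine (memLp_congr_ae ?_).1 (GQuot.isC1Family_fderiv_rep.memLp_comp (SeparationQuotient.mk g) hw)
  filter_upwards [GQuot.rep_mk g] with t ht
  rw [ht]

theorem memLp_fderiv_fderiv : MemLp (fun t => fderiv ℝ (fderiv ℝ (g.fn t)) (w t)) ∞ I.vol := by
  refine (memLp_congr_ae ?_).1
    (GQuot.isC1Family_fderiv_rep.memLp_fderiv_comp (SeparationQuotient.mk g) hw)
  filter_upwards [GQuot.rep_mk g] with t ht
  rw [ht]

end GSpace

section Model

variable {nx nu np ng : ℕ} {P : Bolza nx nu np ng} (g : GSpace P.I 3 nx nu np ng)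
  (z : ZSpace P.I nx nu np)

theorem memLp_pt : MemLp (pt P g.fn z.1) ∞ P.I.vol :=
  memLp_prodMk (memLp_curve z.1) (g.memLp (memLp_curve z.1))

theorem memLp_lift : MemLp (lift P g.fn z) ∞ P.I.vol := by
  have h : MemLp (fun t => (ContinuousLinearMap.inl ℝ (Yn nx nu np) (Rn ng))
      + (ContinuousLinearMap.inr ℝ (Yn nx nu np) (Rn ng)).comp
        (fderiv ℝ (g.fn t) (curve z.1 t))) ∞ P.I.vol :=
    memLp_add (memLp_const _) (memLp_top_clm_comp (E := Yn nx nu np) (F := Rn ng)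
      (G := Yn nx nu np × Rn ng) (memLp_const _) (g.memLp_fderiv (memLp_curve z.1)))
  refine (memLp_congr_ae (Eventually.of_forall fun t => ?_)).1 h
  refine ContinuousLinearMap.ext fun v => ?_
  rw [lift_apply]
  rfl

theorem memLp_totD {L : ℝ → Yn nx nu np × Rn ng → ℝ} (hL : StrongSmooth P.I L) :
    MemLp (totD P g.fn z L) ∞ P.I.vol :=
  memLp_top_clm_comp (E := Yn nx nu np) (F := Yn nx nu np × Rn ng) (G := ℝ)
    (hL.memLp_fderiv (memLp_pt g z)) (memLp_lift g z)

theorem memLp_dynAt (hf : StrongSmooth P.I P.f) : MemLp (dynAt P g.fn z) ∞ P.I.vol :=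
  memLp_top_clm_comp (E := Yn nx nu np) (F := Yn nx nu np × Rn ng) (G := Rn nx)
    (hf.memLp_fderiv (memLp_pt g z)) (memLp_lift g z)

variable (hl : StrongSmooth P.I P.l) (hf : StrongSmooth P.I P.f)
include hl hf

theorem memLp_hamD : MemLp (hamD P g.fn z) ∞ P.I.vol :=
  memLp_add (E := Yn nx nu np × Rn ng →L[ℝ] ℝ) (hl.memLp_fderiv (memLp_pt g z))
    (memLp_pairL (W := Yn nx nu np × Rn ng) (z.2.memLp_val ∞) (hf.memLp_fderiv (memLp_pt g z)))

theorem memLp_hamD2 : MemLp (hamD2 P g.fn z) ∞ P.I.vol :=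
  memLp_add (E := Yn nx nu np × Rn ng →L[ℝ] Yn nx nu np × Rn ng →L[ℝ] ℝ)
    (hl.memLp_fderiv_fderiv (memLp_pt g z))
    (memLp_pairL_comp (Y := Yn nx nu np × Rn ng) (W := Yn nx nu np × Rn ng) (z.2.memLp_val ∞)
      (hf.memLp_fderiv_fderiv (memLp_pt g z)))

theorem memLp_hessAt : MemLp (hessAt P g.fn z) ∞ P.I.vol := by
  have h1 : MemLp (fun t => (hamD P g.fn z t).comp (ιg (nx := nx) (nu := nu)
    (np := np))) ∞ P.I.vol :=
    memLp_top_clm_comp (E := Rn ng) (F := Yn nx nu np × Rn ng) (G := ℝ) (memLp_hamD g z hl hf)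
      (memLp_const ιg)
  exact memLp_add (E := Yn nx nu np →L[ℝ] Yn nx nu np →L[ℝ] ℝ)
    (memLp_pullBilin (Y := Yn nx nu np) (W := Yn nx nu np × Rn ng) (memLp_hamD2 g z hl hf)
      (memLp_lift g z))
    (memLp_compL_comp (Y := Yn nx nu np) (W := Yn nx nu np) (V := Rn ng) h1
      (g.memLp_fderiv_fderiv (memLp_curve z.1)))

theorem memLp_varD (δg : GSpace P.I 3 nx nu np ng) : MemLp (varD P g.fn z δg.fn) ∞ P.I.vol := by
  have h1 : MemLp (fun t => (hamD P g.fn z t).comp (ιg (nx := nx) (nu := nu)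
    (np := np))) ∞ P.I.vol :=
    memLp_top_clm_comp (E := Rn ng) (F := Yn nx nu np × Rn ng) (G := ℝ) (memLp_hamD g z hl hf)
      (memLp_const ιg)
  have h2 : MemLp (fun t => (ιg (δg.fn t (curve z.1 t)) : Yn nx nu np × Rn ng)) ∞ P.I.vol :=
    memLp_map (E := Rn ng) (F := Yn nx nu np × Rn ng) ιg (δg.memLp (memLp_curve z.1))
  have h3 : MemLp (fun t => hamD2 P g.fn z t (ιg (δg.fn t (curve z.1 t)))) ∞ P.I.vol :=
    memLp_clm_apply (E := Yn nx nu np × Rn ng) (F := Yn nx nu np × Rn ng →L[ℝ] ℝ) (q := ∞) ∞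
      (memLp_hamD2 g z hl hf) h2
  exact memLp_add (E := Yn nx nu np →L[ℝ] ℝ)
    (memLp_top_clm_comp (E := Yn nx nu np) (F := Yn nx nu np × Rn ng) (G := ℝ) h3 (memLp_lift g z))
    (memLp_top_clm_comp (E := Yn nx nu np) (F := Rn ng) (G := ℝ) h1
      (δg.memLp_fderiv (memLp_curve z.1)))

theorem hessAt_symm : ∀ᵐ t ∂P.I.vol, ∀ v v', hessAt P g.fn z t v v' = hessAt P g.fn z t v' v := by
  filter_upwards [hamD2_symm (g := g.fn) (z := z) hl hf, g.contDiff] with t h1 h2 v v'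
  rw [hessAt_apply, hessAt_apply, h1, isSymm_fderiv_fderiv (h2.of_le (by norm_num)) _ v v']

/-- The linear-quadratic model whose optimality system is the linearized optimality system. -/
def lqModel (hφ : ContDiff ℝ 2 P.φ) : LQModel P.I nx nu np where
  dyn := dynAt P g.fn z
  hess := hessAt P g.fn z
  endHess := fderiv ℝ (fderiv ℝ P.φ) (endPt P z.1)
  memLp_dyn := memLp_dynAt g z hf
  memLp_hess := memLp_hessAt g z hl hf
  hess_symm := hessAt_symm g z hl hf
  endHess_symm := isSymm_fderiv_fderiv hφ _

end Model

/-! ### The residual of the optimality system -/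

section Functionals

variable {α : Type*} {m : MeasurableSpace α} (μ : Measure α) [IsFiniteMeasure μ] (V : Type*)
  [NormedAddCommGroup V] [NormedSpace ℝ V]

/-- The integral of essentially bounded functions. -/
def intL : Lp V ∞ μ →L[ℝ] V :=
  LinearMap.mkContinuous
    { toFun := fun f => ∫ t, f t ∂μ
      map_add' := fun f g => by
        rw [← integral_add ((Lp.memLp f).integrable le_top) ((Lp.memLp g).integrable le_top)]
        exact integral_congr_ae (Lp.coeFn_add f g)
      map_smul' := fun c f => by
        rw [RingHom.id_apply, ← integral_smul]
        exact integral_congr_ae (Lp.coeFn_smul c f) } (μ.real univ)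
    fun f => by
      rw [mul_comm]
      exact norm_integral_le_of_norm_le_const (ae_norm_le_norm_top f)

variable {μ V}

theorem intL_eq {f : Lp V ∞ μ} {v : α → V} (h : f =ᵐ[μ] v) : intL μ V f = ∫ t, v t ∂μ :=
  integral_congr_ae h

theorem IsC1Op.hasFDerivAt_intL {P : Type*} [NormedAddCommGroup P] [NormedSpace ℝ P]
    {Φ : P → Lp V ∞ μ} {v : P → α → V} {v' : P → P → α → V} (h : IsC1Op Φ v v') :
    ContDiff ℝ 1 (fun p => ∫ t, v p t ∂μ) ∧
      ∀ p d, fderiv ℝ (fun p => ∫ t, v p t ∂μ) p d = ∫ t, v' p d t ∂μ := by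
  have h0 : (fun p => ∫ t, v p t ∂μ) = fun p => intL μ V (Φ p) :=
    funext fun p => (intL_eq (h.val p)).symm
  rw [h0]
  refine ⟨(intL μ V).contDiff.comp h.contDiff, fun p d => ?_⟩
  rw [← intL_eq (h.deriv p d)]
  exact DFunLike.congr_fun ((intL μ V).hasFDerivAt.comp p (h.hasFDerivAt p)).fderiv d

end Functionals

section Curves

variable {I : TimeInterval} {nx nu np ng : ℕ}

/-- The curve of `(x, u, p)` as an essentially bounded function. -/
def curveL : YSpace I ∞ nx nu np →L[ℝ] Lp (Yn nx nu np) ∞ I.vol :=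
  ((ιx (nu := nu) (np := np)).compLpL ∞ I.vol).comp
      (W1.valL.comp (ContinuousLinearMap.fst ℝ (W1 I ∞ nx) (Lq I ∞ nu × Rn np)))
    + ((ιu (nx := nx) (np := np)).compLpL ∞ I.vol).comp
      ((ContinuousLinearMap.fst ℝ (Lq I ∞ nu) (Rn np)).comp
        (ContinuousLinearMap.snd ℝ (W1 I ∞ nx) (Lq I ∞ nu × Rn np)))
    + ((Lp.constL ∞ I.vol ℝ).comp (ιp (nx := nx) (nu := nu))).comp
      ((ContinuousLinearMap.snd ℝ (Lq I ∞ nu) (Rn np)).comp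
        (ContinuousLinearMap.snd ℝ (W1 I ∞ nx) (Lq I ∞ nu × Rn np)))

theorem coeFn_curveL (y : YSpace I ∞ nx nu np) : curveL y =ᵐ[I.vol] curve y := by
  set a : Lp (Yn nx nu np) ∞ I.vol := (ιx (nu := nu) (np := np)).compLpL ∞ I.vol
    (W1.valL y.1) with ha
  set b : Lp (Yn nx nu np) ∞ I.vol := (ιu (nx := nx) (np := np)).compLpL ∞ I.vol y.2.1 with hb
  set c : Lp (Yn nx nu np) ∞ I.vol := Lp.const ∞ I.vol (ιp (nx := nx) (nu := nu) y.2.2) with hc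
  have h : curveL y = a + b + c := rfl
  rw [h]
  filter_upwards [Lp.coeFn_add (a + b) c, Lp.coeFn_add a b,
    (ιx (nu := nu) (np := np)).coeFn_compLpL (p := ∞) (W1.valL y.1),
    (ιu (nx := nx) (np := np)).coeFn_compLpL (p := ∞) y.2.1, W1.coeFn_valL y.1,
    Lp.coeFn_const (p := ∞) (μ := I.vol) (ιp (nx := nx) (nu := nu) y.2.2)] with t h1 h2 h3 h4 h5 h6
  rw [h1, Pi.add_apply, h2, Pi.add_apply, ha, h3, hb, h4, hc, h6, h5, Yn_split (curve y t)]
  rfl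

/-- The end point `(x(t_f), p)` as a continuous linear function. -/
def endL : YSpace I ∞ nx nu np →L[ℝ] Rn nx × Rn np :=
  ((W1.evalL I.tf).comp (ContinuousLinearMap.fst ℝ (W1 I ∞ nx) (Lq I ∞ nu × Rn np))).prod
    ((ContinuousLinearMap.snd ℝ (Lq I ∞ nu) (Rn np)).comp
      (ContinuousLinearMap.snd ℝ (W1 I ∞ nx) (Lq I ∞ nu × Rn np)))

/-- The projection of `(g, z)` to the curve of `z`. -/
def curveZ : GQuot I nx nu np ng × ZSpace I nx nu np →L[ℝ] Lp (Yn nx nu np) ∞ I.vol :=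
  curveL.comp ((ContinuousLinearMap.fst ℝ (YSpace I ∞ nx nu np) (W1 I ∞ nx)).comp
    (ContinuousLinearMap.snd ℝ (GQuot I nx nu np ng) (ZSpace I nx nu np)))

/-- The projection of `(g, z)` to the costate. -/
def costateZ : GQuot I nx nu np ng × ZSpace I nx nu np →L[ℝ] W1 I ∞ nx :=
  (ContinuousLinearMap.snd ℝ (YSpace I ∞ nx nu np) (W1 I ∞ nx)).comp
    (ContinuousLinearMap.snd ℝ (GQuot I nx nu np ng) (ZSpace I nx nu np))

/-- The projection of `(g, z)` to the state. -/
def stateZ : GQuot I nx nu np ng × ZSpace I nx nu np →L[ℝ] W1 I ∞ nx :=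
  (ContinuousLinearMap.fst ℝ (W1 I ∞ nx) (Lq I ∞ nu × Rn np)).comp
    ((ContinuousLinearMap.fst ℝ (YSpace I ∞ nx nu np) (W1 I ∞ nx)).comp
      (ContinuousLinearMap.snd ℝ (GQuot I nx nu np ng) (ZSpace I nx nu np)))

/-- The projection of `(g, z)` to the end point. -/
def endZ : GQuot I nx nu np ng × ZSpace I nx nu np →L[ℝ] Rn nx × Rn np :=
  endL.comp ((ContinuousLinearMap.fst ℝ (YSpace I ∞ nx nu np) (W1 I ∞ nx)).comp
    (ContinuousLinearMap.snd ℝ (GQuot I nx nu np ng) (ZSpace I nx nu np)))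

theorem isC1Op_curveZ : IsC1Op (curveZ (I := I) (nx := nx) (nu := nu) (np := np) (ng := ng))
    (fun p => curve p.2.1) (fun _ d => curve d.2.1) :=
  IsC1Op.of_clm _ fun p => coeFn_curveL p.2.1

end Curves

section Residual

variable {nx nu np ng : ℕ} {P : Bolza nx nu np ng}

/-- The values of an element of the residual space. -/
structure HasComponents {I : TimeInterval} (ρ : RSpace I nx nu np) (a : ℝ → Rn nx) (b : Rn nx)
    (c : ℝ → Rn nx) (d : Rn nx) (e : ℝ → Rn nu) (k : Rn np) : Prop where
  state : ∀ᵐ t ∂I.vol, ρ.1 t = a t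
  init : ρ.2.1 = b
  costate : ∀ᵐ t ∂I.vol, ρ.2.2.1 t = c t
  term : ρ.2.2.2.1 = d
  ctrl : ∀ᵐ t ∂I.vol, ρ.2.2.2.2.1 t = e t
  param : ρ.2.2.2.2.2 = k

variable (P) in
/-- The gradient of the integrand of the Lagrangian along the trajectory. -/
def lagD (g : ℝ → Yn nx nu np → Rn ng) (z : ZSpace P.I nx nu np) (t : ℝ) : Yn nx nu np →L[ℝ] ℝ :=
  totD P g z P.l t + pairL (z.2.val t) (dynAt P g z t)

variable (P) in
/-- The derivative of `lagD` in the direction `(δg, ζ)`. -/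
def lagV (g : ℝ → Yn nx nu np → Rn ng) (z : ZSpace P.I nx nu np) (δg : ℝ → Yn nx nu np → Rn ng)
    (ζ : ZSpace P.I nx nu np) (t : ℝ) : Yn nx nu np →L[ℝ] ℝ :=
  hessAt P g z t (curve ζ.1 t) + pairL (ζ.2.val t) (dynAt P g z t) + varD P g z δg t

/-- The product rule for the gradient `DH ∘ S` of the Lagrangian integrand, where both the point at
which `DH` is evaluated and `S = (id, g_y)` vary. -/
theorem gradient_variation {W Y G : Type*} [NormedAddCommGroup W] [NormedSpace ℝ W]
    [NormedAddCommGroup Y] [NormedSpace ℝ Y] [NormedAddCommGroup G] [NormedSpace ℝ G]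
    (B : W →L[ℝ] W →L[ℝ] ℝ) (S : Y →L[ℝ] W) (h : W →L[ℝ] ℝ) (j : G →L[ℝ] W) (k : W →L[ℝ] ℝ) (w : Y)
    (δ : G) (Γ' : Y →L[ℝ] G) (D : Y →L[ℝ] Y →L[ℝ] G) :
    (B (S w + j δ) + k).comp S + (h.comp j).comp (Γ' + D w)
      = (pullBilin B S + (ContinuousLinearMap.compL ℝ Y G ℝ (h.comp j)).comp D) w + k.comp S
        + ((B (j δ)).comp S + (h.comp j).comp Γ') := by
  ext η
  simp only [map_add, _root_.add_apply, ContinuousLinearMap.comp_apply, pullBilin_apply,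
    ContinuousLinearMap.compL_apply]
  ring

/-- The derivative of `(y, g) ↦ (y(t), g(t, y(t)))`. -/
theorem exists_isC1Op_pt :
    ∃ Φ : GQuot P.I nx nu np ng × ZSpace P.I nx nu np → Lp (Yn nx nu np × Rn ng) ∞ P.I.vol,
      IsC1Op Φ (fun p => pt P p.1.rep p.2.1) (fun p d t =>
        lift P p.1.rep p.2 t (curve d.2.1 t) + ιg (d.1.rep t (curve p.2.1 t))) := by
  have h := ((isC1Op_curveZ (I := P.I) (nx := nx) (nu := nu) (np := np) (ng := ng)).map
    (V' := Yn nx nu np × Rn ng) ιY).add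
    ((IsC1Op.superpose GQuot.isC1Family_rep isC1Op_curveZ
      (ContinuousLinearMap.fst ℝ _ _)).map (V' := Yn nx nu np × Rn ng) ιg)
  refine ⟨_, h.contDiff, fun p => ?_, fun p d => ?_⟩
  · filter_upwards [h.val p] with t ht
    rw [ht]
    exact Prod.ext (add_zero _) (zero_add _)
  · filter_upwards [h.deriv p d] with t ht
    rw [ht, lift_apply, map_add]
    simp only [ContinuousLinearMap.coe_fst']
    abel

variable (hl : StrongSmooth P.I P.l) (hf : StrongSmooth P.I P.f)
include hl hf

theorem exists_isC1Op_lagrangian :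
    ∃ Θ : GQuot P.I nx nu np ng × ZSpace P.I nx nu np → Lp (Yn nx nu np →L[ℝ] ℝ) ∞ P.I.vol,
      IsC1Op Θ (fun p => lagD P p.1.rep p.2) (fun p d => lagV P p.1.rep p.2 d.1.rep d.2) := by
  obtain ⟨Φ, hΦ⟩ := exists_isC1Op_pt (P := P)
  have hlam : IsC1Op (W1.valL.comp
      (costateZ (I := P.I) (nx := nx) (nu := nu) (np := np) (ng := ng)))
      (fun p => p.2.2.val) (fun _ d => d.2.2.val) := IsC1Op.of_clm _ fun p => W1.coeFn_valL p.2.2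
  obtain ⟨Θ, hΘ⟩ := exists_isC1Op_gradient (Y := Yn nx nu np) (G := Rn ng)
    GQuot.isC1Family_fderiv_rep hf.isC1Family_fderiv hl.isC1Family_fderiv
    (ContinuousLinearMap.fst ℝ (GQuot P.I nx nu np ng) (ZSpace P.I nx nu np)) isC1Op_curveZ hΦ hlam
  refine ⟨Θ, hΘ.contDiff, fun p => ?_, fun p d => ?_⟩
  · filter_upwards [hΘ.val p] with t ht
    rw [ht]
    rfl
  · filter_upwards [hΘ.deriv p d] with t ht
    rw [ht]
    exact gradient_variation (hamD2 P p.1.rep p.2 t) (lift P p.1.rep p.2 t)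
      (hamD P p.1.rep p.2 t) ιg
      (pairL (d.2.2.val t) (fderiv ℝ (P.f t) (pt P p.1.rep p.2.1 t))) (curve d.2.1 t)
      (d.1.rep t (curve p.2.1 t)) (fderiv ℝ (d.1.rep t) (curve p.2.1 t))
      (fderiv ℝ (fderiv ℝ (p.1.rep t)) (curve p.2.1 t))

omit hl hf in
theorem contDiff_tuple {E R₁ R₂ R₃ R₄ R₅ R₆ : Type*} [NormedAddCommGroup E] [NormedSpace ℝ E]
    [NormedAddCommGroup R₁] [NormedSpace ℝ R₁] [NormedAddCommGroup R₂] [NormedSpace ℝ R₂]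
    [NormedAddCommGroup R₃] [NormedSpace ℝ R₃] [NormedAddCommGroup R₄] [NormedSpace ℝ R₄]
    [NormedAddCommGroup R₅] [NormedSpace ℝ R₅] [NormedAddCommGroup R₆] [NormedSpace ℝ R₆]
    {F₁ : E → R₁} {F₂ : E → R₂} {F₃ : E → R₃} {F₄ : E → R₄} {F₅ : E → R₅} {F₆ : E → R₆}
    (h₁ : ContDiff ℝ 1 F₁) (h₂ : ContDiff ℝ 1 F₂) (h₃ : ContDiff ℝ 1 F₃) (h₄ : ContDiff ℝ 1 F₄)
    (h₅ : ContDiff ℝ 1 F₅) (h₆ : ContDiff ℝ 1 F₆) :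
    ContDiff ℝ 1 (fun p => (F₁ p, F₂ p, F₃ p, F₄ p, F₅ p, F₆ p)) ∧
      ∀ p d, fderiv ℝ (fun p => (F₁ p, F₂ p, F₃ p, F₄ p, F₅ p, F₆ p)) p d
        = (fderiv ℝ F₁ p d, fderiv ℝ F₂ p d, fderiv ℝ F₃ p d, fderiv ℝ F₄ p d, fderiv ℝ F₅ p d,
          fderiv ℝ F₆ p d) := by
  refine ⟨h₁.prodMk (h₂.prodMk (h₃.prodMk (h₄.prodMk (h₅.prodMk h₆)))), fun p d => ?_⟩
  exact DFunLike.congr_fun ((h₁.differentiable one_ne_zero p).hasFDerivAt.prodMk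
    ((h₂.differentiable one_ne_zero p).hasFDerivAt.prodMk
    ((h₃.differentiable one_ne_zero p).hasFDerivAt.prodMk
    ((h₄.differentiable one_ne_zero p).hasFDerivAt.prodMk
    ((h₅.differentiable one_ne_zero p).hasFDerivAt.prodMk
      (h₆.differentiable one_ne_zero p).hasFDerivAt))))).fderiv d

omit hl hf in
theorem contDiff_clm_comp_fderiv {E N V : Type*} [NormedAddCommGroup E] [NormedSpace ℝ E]
    [NormedAddCommGroup N] [NormedSpace ℝ N] [NormedAddCommGroup V] [NormedSpace ℝ V] {φ : N → ℝ}
    (hφ : ContDiff ℝ 2 φ) (e : E →L[ℝ] N) (r : (N →L[ℝ] ℝ) →L[ℝ] V) {F : E → V}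
    (hF : ContDiff ℝ 1 F) :
    ContDiff ℝ 1 (fun p => F p + r (fderiv ℝ φ (e p))) ∧
      ∀ p d, fderiv ℝ (fun p => F p + r (fderiv ℝ φ (e p))) p d
        = fderiv ℝ F p d + r (fderiv ℝ (fderiv ℝ φ) (e p) (e d)) := by
  have hD : ContDiff ℝ 1 (fderiv ℝ φ) := hφ.fderiv_right (m := 1) (by norm_num)
  refine ⟨hF.add (r.contDiff.comp (hD.comp e.contDiff)), fun p d => ?_⟩
  exact DFunLike.congr_fun ((hF.differentiable one_ne_zero p).hasFDerivAt.add
    (r.hasFDerivAt.comp p (((hD.differentiable one_ne_zero (e p)).hasFDerivAt).comp p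
      e.hasFDerivAt))).fderiv d

omit hl in
theorem exists_isC1Op_state :
    ∃ Φ : GQuot P.I nx nu np ng × ZSpace P.I nx nu np → Lq P.I ∞ nx,
      IsC1Op Φ (fun p t => p.2.1.1.der t - P.f t (pt P p.1.rep p.2.1 t)) (fun p d t =>
        d.2.1.1.der t - (dynAt P p.1.rep p.2 t (curve d.2.1 t)
          + fg P p.1.rep p.2.1 t (d.1.rep t (curve p.2.1 t)))) := by
  obtain ⟨Φ, hΦ⟩ := exists_isC1Op_pt (P := P)
  have h := (IsC1Op.of_clm (W1.derL.comp
    (stateZ (I := P.I) (nx := nx) (nu := nu) (np := np) (ng := ng)))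
    (v := fun p => p.2.1.1.der) fun p => EventuallyEq.rfl).add
    ((IsC1Op.superpose_const hf.isC1Family hΦ).map (-ContinuousLinearMap.id ℝ (Rn nx)))
  refine ⟨_, h.contDiff, fun p => ?_, fun p d => ?_⟩
  · filter_upwards [h.val p] with t ht
    rw [ht, sub_eq_add_neg]
    rfl
  · filter_upwards [h.deriv p d] with t ht
    rw [ht, map_add, sub_eq_add_neg]
    rfl

theorem exists_isC1Op_costate :
    ∃ Φ : GQuot P.I nx nu np ng × ZSpace P.I nx nu np → Lq P.I ∞ nx,
      IsC1Op Φ (fun p t => p.2.2.der t + rz ιx (lagD P p.1.rep p.2 t))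
        (fun p d t => d.2.2.der t + rz ιx (lagV P p.1.rep p.2 d.1.rep d.2 t)) := by
  obtain ⟨Θ, hΘ⟩ := exists_isC1Op_lagrangian hl hf
  exact ⟨_, (IsC1Op.of_clm (W1.derL.comp
    (costateZ (I := P.I) (nx := nx) (nu := nu) (np := np) (ng := ng)))
    (v := fun p => p.2.2.der) fun p => EventuallyEq.rfl).add (hΘ.map (rz ιx))⟩

/-- The optimality system as an equation `ψ(g, z) = 0` with a continuously differentiable map
`ψ`. -/
theorem exists_residual (hφ : ContDiff ℝ 2 P.φ) :
    ∃ ψ : GQuot P.I nx nu np ng × ZSpace P.I nx nu np → RSpace P.I nx nu np, ContDiff ℝ 1 ψ ∧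
      (∀ p, HasComponents (ψ p)
        (fun t => p.2.1.1.der t - P.f t (pt P p.1.rep p.2.1 t))
        (p.2.1.1.val P.I.t0 - P.x0)
        (fun t => p.2.2.der t + rz ιx (lagD P p.1.rep p.2 t))
        (p.2.2.val P.I.tf + (-rz (ContinuousLinearMap.inl ℝ _ _)) (fderiv ℝ P.φ (endPt P p.2.1)))
        (fun t => rz ιu (lagD P p.1.rep p.2 t))
        (∫ t, rz ιp (lagD P p.1.rep p.2 t) ∂P.I.vol
          + rz (ContinuousLinearMap.inr ℝ _ _) (fderiv ℝ P.φ (endPt P p.2.1)))) ∧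
      ∀ p d, HasComponents (fderiv ℝ ψ p d)
        (fun t => d.2.1.1.der t - (dynAt P p.1.rep p.2 t (curve d.2.1 t)
          + fg P p.1.rep p.2.1 t (d.1.rep t (curve p.2.1 t))))
        (d.2.1.1.val P.I.t0)
        (fun t => d.2.2.der t + rz ιx (lagV P p.1.rep p.2 d.1.rep d.2 t))
        (d.2.2.val P.I.tf + (-rz (ContinuousLinearMap.inl ℝ _ _))
          (fderiv ℝ (fderiv ℝ P.φ) (endPt P p.2.1) (endT P.I (toTraj d.2.1))))
        (fun t => rz ιu (lagV P p.1.rep p.2 d.1.rep d.2 t))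
        (∫ t, rz ιp (lagV P p.1.rep p.2 d.1.rep d.2 t) ∂P.I.vol
          + rz (ContinuousLinearMap.inr ℝ _ _)
            (fderiv ℝ (fderiv ℝ P.φ) (endPt P p.2.1) (endT P.I (toTraj d.2.1)))) := by
  obtain ⟨Φ1, h1⟩ := exists_isC1Op_state hf
  obtain ⟨Φ3, h3⟩ := exists_isC1Op_costate hl hf
  obtain ⟨Θ, hΘ⟩ := exists_isC1Op_lagrangian hl hf
  have h5 := hΘ.map (rz ιu)
  obtain ⟨h6, h6'⟩ := (hΘ.map (rz ιp)).hasFDerivAt_intL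
  obtain ⟨k2, k2'⟩ : ∃ F : GQuot P.I nx nu np ng × ZSpace P.I nx nu np → Rn nx,
      ContDiff ℝ 1 F ∧ (∀ p, F p = p.2.1.1.val P.I.t0 - P.x0) ∧
        ∀ p d, fderiv ℝ F p d = d.2.1.1.val P.I.t0 :=
    ⟨fun p => (W1.evalL P.I.t0).comp stateZ p - P.x0,
      ((W1.evalL P.I.t0).comp stateZ).contDiff.sub contDiff_const, fun p => rfl, fun p d =>
      DFunLike.congr_fun (((W1.evalL P.I.t0).comp stateZ).hasFDerivAt.sub_const P.x0).fderiv d⟩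
  obtain ⟨k4, k4'⟩ := contDiff_clm_comp_fderiv hφ
    (endZ (I := P.I) (nx := nx) (nu := nu) (np := np) (ng := ng))
    (-rz (ContinuousLinearMap.inl ℝ _ _))
    ((W1.evalL P.I.tf).comp
      (costateZ (I := P.I) (nx := nx) (nu := nu) (np := np) (ng := ng))).contDiff
  obtain ⟨k6, k6'⟩ := contDiff_clm_comp_fderiv hφ
    (endZ (I := P.I) (nx := nx) (nu := nu) (np := np) (ng := ng))
    (rz (ContinuousLinearMap.inr ℝ _ _)) h6
  obtain ⟨hψ, hψ'⟩ := contDiff_tuple h1.contDiff k2'.1 h3.contDiff k4 h5.contDiff k6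
  refine ⟨_, hψ, fun p => ⟨h1.val p, k2'.2.1 p, h3.val p, rfl, h5.val p, rfl⟩, fun p d => ?_⟩
  rw [hψ']
  refine ⟨h1.deriv p d, k2'.2.2 p d, h3.deriv p d, (k4' p d).trans ?_, h5.deriv p d,
    (k6' p d).trans ?_⟩
  · rw [ContinuousLinearMap.fderiv]
    rfl
  · rw [h6']
    rfl

end Residual

/-! ### The optimality system and its linearization -/

section Linearization

variable {nx nu np ng : ℕ} {P : Bolza nx nu np ng}

theorem HasComponents.eq_zero_iff {I : TimeInterval} {ρ : RSpace I nx nu np} {a : ℝ → Rn nx}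
    {b : Rn nx} {c : ℝ → Rn nx} {d : Rn nx} {e : ℝ → Rn nu} {k : Rn np}
    (h : HasComponents ρ a b c d e k) :
    ρ = 0 ↔ (∀ᵐ t ∂I.vol, a t = 0) ∧ b = 0 ∧ (∀ᵐ t ∂I.vol, c t = 0) ∧ d = 0 ∧
      (∀ᵐ t ∂I.vol, e t = 0) ∧ k = 0 := by
  have key : ∀ {n : ℕ} {r : Lq I ∞ n} {a : ℝ → Rn n}, (∀ᵐ t ∂I.vol, r t = a t) →
      (r = 0 ↔ ∀ᵐ t ∂I.vol, a t = 0) := by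
    intro n r a hr
    rw [Lp.eq_zero_iff_ae_eq_zero]
    constructor
    · intro h0
      filter_upwards [hr, h0] with t h1 h2
      rw [← h1, h2]
      rfl
    · intro h0
      filter_upwards [hr, h0] with t h1 h2
      rw [h1, h2]
      rfl
  rw [← key h.state, ← h.init, ← key h.costate, ← h.term, ← key h.ctrl, ← h.param]
  constructor
  · rintro rfl
    exact ⟨rfl, rfl, rfl, rfl, rfl, rfl⟩
  · rintro ⟨h1, h2, h3, h4, h5, h6⟩
    exact Prod.ext h1 (Prod.ext h2 (Prod.ext h3 (Prod.ext h4 (Prod.ext h5 h6))))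

theorem HasComponents.congr {I : TimeInterval} {ρ : RSpace I nx nu np} {a a' : ℝ → Rn nx}
    {b : Rn nx} {c c' : ℝ → Rn nx} {d : Rn nx} {e e' : ℝ → Rn nu} {k k' : Rn np}
    (h : HasComponents ρ a b c d e k) (ha : ∀ᵐ t ∂I.vol, a t = a' t)
    (hc : ∀ᵐ t ∂I.vol, c t = c' t) (he : ∀ᵐ t ∂I.vol, e t = e' t) (hk : k = k') :
    HasComponents ρ a' b c' d e' k' where
  state := by filter_upwards [h.state, ha] with t h1 h2 using h1.trans h2
  init := h.init
  costate := by filter_upwards [h.costate, hc] with t h1 h2 using h1.trans h2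
  term := h.term
  ctrl := by filter_upwards [h.ctrl, he] with t h1 h2 using h1.trans h2
  param := h.param.trans hk

theorem lagD_congr {g g' : ℝ → Yn nx nu np → Rn ng} {t : ℝ} (h : g t = g' t)
    (z : ZSpace P.I nx nu np) : lagD P g z t = lagD P g' z t := by
  simp only [lagD, totD, dynAt, lift, pt, h]

theorem lagV_congr {g g' δ δ' : ℝ → Yn nx nu np → Rn ng} {t : ℝ} (h : g t = g' t) (h' : δ t = δ' t)
    (z ζ : ZSpace P.I nx nu np) : lagV P g z δ ζ t = lagV P g' z δ' ζ t := by
  simp only [lagV, hessAt, varD, hamD, hamD2, dynAt, lift, pt, h, h']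

theorem adjoint_add_gradTot (g : ℝ → Yn nx nu np → Rn ng) (z : ZSpace P.I nx nu np) {n : ℕ}
    (ι : Rn n →L[ℝ] Yn nx nu np) (t : ℝ) :
    adjoint (fTot P g z.1 ι t) (z.2.val t) + gradTot P g z.1 P.l ι t = rz ι (lagD P g z t) := by
  rw [fTot_eq, adjoint_comp_eq_rz, gradTot_eq (z := z), ← map_add, add_comm]
  rfl

/-- The optimality system in terms of the derivative of the Lagrangian integrand. -/
theorem isKKT_iff (g : ℝ → Yn nx nu np → Rn ng) (z : ZSpace P.I nx nu np) :
    IsKKT P g z ↔ (∀ᵐ t ∂P.I.vol, z.1.1.der t - P.f t (pt P g z.1 t) = 0) ∧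
      z.1.1.val P.I.t0 - P.x0 = 0 ∧ (∀ᵐ t ∂P.I.vol, z.2.der t + rz ιx (lagD P g z t) = 0) ∧
      z.2.val P.I.tf + (-rz (ContinuousLinearMap.inl ℝ _ _)) (fderiv ℝ P.φ (endPt P z.1)) = 0 ∧
      (∀ᵐ t ∂P.I.vol, rz ιu (lagD P g z t) = 0) ∧
      ∫ t, rz ιp (lagD P g z t) ∂P.I.vol
        + rz (ContinuousLinearMap.inr ℝ _ _) (fderiv ℝ P.φ (endPt P z.1)) = 0 := by
  simp only [← adjoint_add_gradTot, sub_eq_zero]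
  refine and_congr Iff.rfl (and_congr Iff.rfl (and_congr ?_ (and_congr ?_ (and_congr Iff.rfl ?_))))
  · refine eventually_congr (Eventually.of_forall fun t => ?_)
    rw [add_eq_zero_iff_eq_neg, neg_add, ← sub_eq_add_neg]
    rfl
  · rw [_root_.neg_apply, ← sub_eq_add_neg, sub_eq_zero]
    rfl
  · rw [add_comm]
    rfl

theorem isKKT_congr {g g' : ℝ → Yn nx nu np → Rn ng} (h : ∀ᵐ t ∂P.I.vol, g t = g' t)
    (z : ZSpace P.I nx nu np) : IsKKT P g z ↔ IsKKT P g' z := by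
  have hL : ∀ᵐ t ∂P.I.vol, lagD P g z t = lagD P g' z t := by
    filter_upwards [h] with t ht using lagD_congr ht z
  have hp : ∀ᵐ t ∂P.I.vol, pt P g z.1 t = pt P g' z.1 t := by
    filter_upwards [h] with t ht
    rw [pt, pt, ht]
  rw [isKKT_iff, isKKT_iff, integral_congr_ae (hL.mono fun t ht => congrArg (rz ιp) ht)]
  refine and_congr (eventually_congr (hp.mono fun t ht => ?_)) (and_congr Iff.rfl
    (and_congr (eventually_congr (hL.mono fun t ht => ?_)) (and_congr Iff.rfl
      (and_congr (eventually_congr (hL.mono fun t ht => ?_)) Iff.rfl))))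
  · rw [ht]
  · rw [ht]
  · rw [ht]

variable (hl : StrongSmooth P.I P.l) (hf : StrongSmooth P.I P.f)
include hl hf

/-- The optimality system for a component function `g` as an equation `ψ([g], z) = 0`, and the
derivative of `ψ` in terms of representatives. -/
theorem exists_residual_mk (hφ : ContDiff ℝ 2 P.φ) :
    ∃ ψ : GQuot P.I nx nu np ng × ZSpace P.I nx nu np → RSpace P.I nx nu np, ContDiff ℝ 1 ψ ∧
      (∀ (g : GSpace P.I 3 nx nu np ng) z, ψ (SeparationQuotient.mk g, z) = 0 ↔ IsKKT P g.fn z) ∧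
      ∀ (g δg : GSpace P.I 3 nx nu np ng) (z ζ : ZSpace P.I nx nu np),
        HasComponents (fderiv ℝ ψ (SeparationQuotient.mk g, z) (SeparationQuotient.mk δg, ζ))
        (fun t => ζ.1.1.der t - (dynAt P g.fn z t (curve ζ.1 t)
          + fg P g.fn z.1 t (δg.fn t (curve z.1 t))))
        (ζ.1.1.val P.I.t0)
        (fun t => ζ.2.der t + rz ιx (lagV P g.fn z δg.fn ζ t))
        (ζ.2.val P.I.tf + (-rz (ContinuousLinearMap.inl ℝ _ _))
          (fderiv ℝ (fderiv ℝ P.φ) (endPt P z.1) (endT P.I (toTraj ζ.1))))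
        (fun t => rz ιu (lagV P g.fn z δg.fn ζ t))
        (∫ t, rz ιp (lagV P g.fn z δg.fn ζ t) ∂P.I.vol
          + rz (ContinuousLinearMap.inr ℝ _ _)
            (fderiv ℝ (fderiv ℝ P.φ) (endPt P z.1) (endT P.I (toTraj ζ.1)))) := by
  obtain ⟨ψ, h1, h2, h3⟩ := exists_residual hl hf hφ
  refine ⟨ψ, h1, fun g z => ?_, fun g δg z ζ => ?_⟩
  · rw [(h2 (SeparationQuotient.mk g, z)).eq_zero_iff, ← isKKT_congr (GQuot.rep_mk g) z, isKKT_iff]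
  · have hL : ∀ᵐ t ∂P.I.vol,
        lagV P (GQuot.rep (SeparationQuotient.mk g)) z (GQuot.rep (SeparationQuotient.mk δg)) ζ t
          = lagV P g.fn z δg.fn ζ t := by
      filter_upwards [GQuot.rep_mk g, GQuot.rep_mk δg] with t k1 k2 using lagV_congr k1 k2 z ζ
    refine (h3 (SeparationQuotient.mk g, z) (SeparationQuotient.mk δg, ζ)).congr ?_ ?_ ?_ ?_
    · filter_upwards [GQuot.rep_mk g, GQuot.rep_mk δg] with t k1 k2
      simp only [dynAt, lift, fg, pt, k1, k2]
    · filter_upwards [hL] with t ht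
      simp only [ht]
    · filter_upwards [hL] with t ht
      simp only [ht]
    · rw [integral_congr_ae (hL.mono fun t ht => congrArg (rz ιp) ht)]

/-- The linearization of the optimality system at `(g, z)` is the operator of the linear-quadratic
model. -/
theorem isOperator_lqModel (hφ : ContDiff ℝ 2 P.φ)
    {ψ' : GQuot P.I nx nu np ng × ZSpace P.I nx nu np →L[ℝ] RSpace P.I nx nu np}
    {g : GSpace P.I 3 nx nu np ng} {z : ZSpace P.I nx nu np}
    (h : ∀ (δg : GSpace P.I 3 nx nu np ng) (ζ : ZSpace P.I nx nu np),
      HasComponents (ψ' (SeparationQuotient.mk δg, ζ))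
        (fun t => ζ.1.1.der t - (dynAt P g.fn z t (curve ζ.1 t)
          + fg P g.fn z.1 t (δg.fn t (curve z.1 t))))
        (ζ.1.1.val P.I.t0)
        (fun t => ζ.2.der t + rz ιx (lagV P g.fn z δg.fn ζ t))
        (ζ.2.val P.I.tf + (-rz (ContinuousLinearMap.inl ℝ _ _))
          (fderiv ℝ (fderiv ℝ P.φ) (endPt P z.1) (endT P.I (toTraj ζ.1))))
        (fun t => rz ιu (lagV P g.fn z δg.fn ζ t))
        (∫ t, rz ιp (lagV P g.fn z δg.fn ζ t) ∂P.I.vol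
          + rz (ContinuousLinearMap.inr ℝ _ _)
            (fderiv ℝ (fderiv ℝ P.φ) (endPt P z.1) (endT P.I (toTraj ζ.1))))) :
    (lqModel g z hl hf hφ).IsOperator
      (ψ'.comp (ContinuousLinearMap.inr ℝ (GQuot P.I nx nu np ng) (ZSpace P.I nx nu np))) := by
  have h0 : ∀ ζ t, lagV P g.fn z (GSpace.fn (0 : GSpace P.I 3 nx nu np ng)) ζ t
      = (lqModel g z hl hf hφ).grad ζ t := by
    intro ζ t
    have h1 : GSpace.fn (0 : GSpace P.I 3 nx nu np ng) t = fun _ => 0 := rfl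
    have h2 : varD P g.fn z (GSpace.fn (0 : GSpace P.I 3 nx nu np ng)) t = 0 := by
      refine ContinuousLinearMap.ext fun v => ?_
      simp [varD, h1]
    rw [lagV, h2, add_zero]
    rfl
  have h1 : ∀ ζ, _ := fun ζ => h 0 ζ
  simp only [h0] at h1
  refine ⟨fun ζ => ?_, fun ζ => (h1 ζ).init, fun ζ => (h1 ζ).costate, fun ζ => ?_,
    fun ζ => (h1 ζ).ctrl, fun ζ => ?_⟩
  · filter_upwards [(h1 ζ).state] with t ht
    refine ht.trans ?_
    have h2 : GSpace.fn (0 : GSpace P.I 3 nx nu np ng) t (curve z.1 t) = 0 := rfl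
    rw [h2, map_zero, add_zero]
    rfl
  · refine (h1 ζ).term.trans ?_
    rw [_root_.neg_apply, ← sub_eq_add_neg]
    rfl
  · refine (h1 ζ).param.trans ?_
    rw [add_comm]
    rfl

/-- Directions tangential to the solution set solve the linearized optimality system with the
inhomogeneities caused by the variation `δg`. -/
theorem system_of_tangent (hφ : ContDiff ℝ 2 P.φ) {ρ : RSpace P.I nx nu np}
    {g δg : GSpace P.I 3 nx nu np ng} {z ζ : ZSpace P.I nx nu np}
    (h : HasComponents ρ
        (fun t => ζ.1.1.der t - (dynAt P g.fn z t (curve ζ.1 t)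
          + fg P g.fn z.1 t (δg.fn t (curve z.1 t))))
        (ζ.1.1.val P.I.t0)
        (fun t => ζ.2.der t + rz ιx (lagV P g.fn z δg.fn ζ t))
        (ζ.2.val P.I.tf + (-rz (ContinuousLinearMap.inl ℝ _ _))
          (fderiv ℝ (fderiv ℝ P.φ) (endPt P z.1) (endT P.I (toTraj ζ.1))))
        (fun t => rz ιu (lagV P g.fn z δg.fn ζ t))
        (∫ t, rz ιp (lagV P g.fn z δg.fn ζ t) ∂P.I.vol
          + rz (ContinuousLinearMap.inr ℝ _ _)
            (fderiv ℝ (fderiv ℝ P.φ) (endPt P z.1) (endT P.I (toTraj ζ.1))))) (hρ : ρ = 0) :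
    (lqModel g z hl hf hφ).System (fun t => fg P g.fn z.1 t (δg.fn t (curve z.1 t))) 0
      (varD P g.fn z δg.fn) 0 ζ := by
  obtain ⟨h1, h2, h3, h4, h5, h6⟩ := h.eq_zero_iff.1 hρ
  refine ⟨?_, h2, ?_, ?_, h5, ?_⟩
  · filter_upwards [h1] with t ht using sub_eq_zero.1 ht
  · filter_upwards [h3] with t ht using eq_neg_of_add_eq_zero_left ht
  · rw [_root_.neg_apply, ← sub_eq_add_neg, sub_eq_zero] at h4
    rw [add_zero]
    exact h4
  · rw [add_comm] at h6
    rw [add_zero]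
    exact h6

end Linearization

section Qoi

variable {nx nu np ng : ℕ} {P : Bolza nx nu np ng} {Q : QoI nx nu np ng}

/-- The quantity of interest is a continuously differentiable function of `([g], z)`. -/
theorem exists_qoi (hϕ : ContDiff ℝ 2 Q.ϕ) (hℓ : StrongSmooth P.I Q.ℓ) :
    ∃ q : GQuot P.I nx nu np ng × ZSpace P.I nx nu np → ℝ, ContDiff ℝ 1 q ∧
      (∀ (g : GSpace P.I 3 nx nu np ng) z, q (SeparationQuotient.mk g, z) = qoi P Q g.fn z.1) ∧
      ∀ (g δg : GSpace P.I 3 nx nu np ng) (z ζ : ZSpace P.I nx nu np),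
        fderiv ℝ q (SeparationQuotient.mk g, z) (SeparationQuotient.mk δg, ζ)
          = fderiv ℝ Q.ϕ (endPt P z.1) (endT P.I (toTraj ζ.1))
            + ∫ t, fderiv ℝ (Q.ℓ t) (pt P g.fn z.1 t)
              (lift P g.fn z t (curve ζ.1 t) + ιg (δg.fn t (curve z.1 t))) ∂P.I.vol := by
  obtain ⟨Φ, hΦ⟩ := exists_isC1Op_pt (P := P)
  obtain ⟨h1, h2⟩ := (IsC1Op.superpose_const hℓ.isC1Family hΦ).hasFDerivAt_intL
  have h3 : ContDiff ℝ 1 fun p : GQuot P.I nx nu np ng × ZSpace P.I nx nu np => Q.ϕ (endZ p) :=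
    (hϕ.of_le (by norm_num)).comp endZ.contDiff
  refine ⟨fun p => Q.ϕ (endZ p) + ∫ t, Q.ℓ t (pt P p.1.rep p.2.1 t) ∂P.I.vol, h3.add h1,
    fun g z => ?_, fun g δg z ζ => ?_⟩
  · refine congrArg (Q.ϕ (endPt P z.1) + ·) (integral_congr_ae ?_)
    filter_upwards [GQuot.rep_mk g] with t ht
    rw [pt, pt, ht]
  · have h4 := ((hϕ.differentiable two_ne_zero _).hasFDerivAt.comp
      (SeparationQuotient.mk g, z) (endZ (I := P.I) (ng := ng)).hasFDerivAt).add
      (h1.differentiable one_ne_zero (SeparationQuotient.mk g, z)).hasFDerivAt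
    refine (DFunLike.congr_fun h4.fderiv (SeparationQuotient.mk δg, ζ)).trans ?_
    rw [_root_.add_apply, h2]
    refine congrArg₂ (· + ·) rfl (integral_congr_ae ?_)
    filter_upwards [GQuot.rep_mk g, GQuot.rep_mk δg] with t k1 k2
    simp only [lift, pt, k1, k2]

end Qoi

/-! ### Minimizers and costates of linear-quadratic problems -/

/-- A trajectory comes from an element of `W^{1,2} × L² × ℝ^{n_p}`, up to null sets. -/
theorem IsTraj.exists_toTraj {I : TimeInterval} {nx nu np : ℕ} {w : Traj nx nu np}
    (h : IsTraj I w) : ∃ y : YSpace I 2 nx nu np, curveT (toTraj y) =ᵐ[I.vol] curveT w ∧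
      (toTraj y).2.1 =ᵐ[I.vol] w.2.1 ∧ endT I (toTraj y) = endT I w ∧
      (toTraj y).1 I.t0 = w.1 I.t0 := by
  obtain ⟨y, h1, h2, h3, h4⟩ := h.exists_ySpace
  refine ⟨y, ?_, h2, Prod.ext (h1 _ I.right_mem) h4, h1 _ I.left_mem⟩
  filter_upwards [I.ae_mem_Icc, h3] with t ht h5
  exact Prod.ext (h1 t ht) (Prod.ext h5 h4)

namespace LQModel

variable {I : TimeInterval} {nx nu np : ℕ} {D : LQModel I nx nu np}
  {θ : ℝ → Yn nx nu np →L[ℝ] ℝ} {κ : (Rn nx × Rn np) →L[ℝ] ℝ} {w w' : Traj nx nu np}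

theorem cost_congr (hc : curveT w =ᵐ[I.vol] curveT w') (he : endT I w = endT I w') :
    D.cost θ κ w = D.cost θ κ w' := by
  have h1 : ∫ t, θ t (curveT w t) ∂I.vol = ∫ t, θ t (curveT w' t) ∂I.vol :=
    integral_congr_ae (hc.mono fun t ht => by simp only [ht])
  have h2 : ∫ t, D.hess t (curveT w t) (curveT w t) ∂I.vol
      = ∫ t, D.hess t (curveT w' t) (curveT w' t) ∂I.vol :=
    integral_congr_ae (hc.mono fun t ht => by simp only [ht])
  rw [cost, cost, lin, lin, bil, bil, h1, h2, he]

theorem res_congr {μ : ℝ → Rn nx} (hc : curveT w =ᵐ[I.vol] curveT w')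
    (hd : w.2.1 =ᵐ[I.vol] w'.2.1) : D.res μ w = D.res μ w' := by
  refine integral_congr_ae ?_
  filter_upwards [hc, hd] with t h1 h2
  rw [h1, h2]

theorem Admissible.congr (h : D.Admissible w) (hc : curveT w' =ᵐ[I.vol] curveT w)
    (hd : w'.2.1 =ᵐ[I.vol] w.2.1) (h0 : w'.1 I.t0 = w.1 I.t0) : D.Admissible w' := by
  refine ⟨?_, h0.trans h.2⟩
  filter_upwards [h.1, hc, hd] with t h1 h2 h3
  rw [h3, h2, h1]

theorem Admissible.sub (h : D.Admissible w) (h' : D.Admissible w') : D.Admissible (w - w') := by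
  refine ⟨?_, ?_⟩
  · filter_upwards [h.1, h'.1] with t h1 h2
    have h3 : curveT (w - w') t = curveT w t - curveT w' t := rfl
    have h4 : (w - w').2.1 t = w.2.1 t - w'.2.1 t := rfl
    rw [h3, h4, map_sub, h1, h2]
  · have h4 : (w - w').1 I.t0 = w.1 I.t0 - w'.1 I.t0 := rfl
    rw [h4, h.2, h'.2, sub_zero]

theorem Admissible.res_eq_zero (h : D.Admissible w) (μ : ℝ → Rn nx) : D.res μ w = 0 := by
  refine integral_eq_zero_of_ae ?_
  filter_upwards [h.1] with t ht
  simp [ht]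

theorem bil_comm (w w' : Traj nx nu np) : D.bil w w' = D.bil w' w := by
  refine congrArg₂ (· + ·) (integral_congr_ae ?_) (D.endHess_symm _ _)
  filter_upwards [D.hess_symm] with t ht using ht _ _

theorem Coercive.bil_nonneg (hD : D.Coercive) (hw : IsTraj I w) (ha : D.Admissible w) :
    0 ≤ D.bil w w := by
  obtain ⟨hend, ε, hε, hco⟩ := hD
  refine add_nonneg (le_trans (mul_nonneg hε.le ?_) (hco w hw ha)) (hend _)
  exact add_nonneg (add_nonneg (integral_nonneg fun t => sq_nonneg _)
    (integral_nonneg fun t => sq_nonneg _)) (sq_nonneg _)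

section Optimality

variable {ζ : ZSpace I nx nu np} (h : D.System (fun _ => 0) 0 θ κ ζ) (hθ : MemLp θ ∞ I.vol)
include h

theorem System.admissible : D.Admissible (toTraj ζ.1) := by
  refine ⟨?_, h.init⟩
  filter_upwards [h.state] with t ht
  exact ht.trans (add_zero _)

include hθ

/-- At a solution of the optimality system the linear part of the cost expansion vanishes on
admissible directions. -/
theorem System.cost_eq (hw : IsTraj I w) (ha : D.Admissible w) :
    D.cost θ κ w = D.cost θ κ (toTraj ζ.1)
      + 1 / 2 * D.bil (w - toTraj ζ.1) (w - toTraj ζ.1) := by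
  have hζ : IsTraj I (toTraj ζ.1) := isTraj_toTraj le_top ζ.1
  have hd : IsTraj I (w - toTraj ζ.1) := by
    have h1 := hw.add (hζ.const_smul (-1))
    rwa [neg_one_smul, ← sub_eq_add_neg] at h1
  have hda := ha.sub h.admissible
  have h1 := h.weak hθ hd
  rw [hda.res_eq_zero, hda.2, inner_zero_right, add_zero] at h1
  have h2 := cost_add_smul (D := D) (κ := κ) hθ hζ hd 1
  rw [one_smul, add_sub_cancel, h1] at h2
  rw [h2]
  ring

theorem System.cost_le (hD : D.Coercive) (hw : IsTraj I w) (ha : D.Admissible w) :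
    D.cost θ κ (toTraj ζ.1) ≤ D.cost θ κ w := by
  have hd : IsTraj I (w - toTraj ζ.1) := by
    have h1 := hw.add ((isTraj_toTraj le_top ζ.1).const_smul (-1))
    rwa [neg_one_smul, ← sub_eq_add_neg] at h1
  rw [h.cost_eq hθ hw ha]
  linarith [hD.bil_nonneg hd (ha.sub h.admissible)]

/-- The minimizer of the linear-quadratic problem is unique. -/
theorem System.eq_of_cost_le (hD : D.Coercive) {y : YSpace I ∞ nx nu np}
    (ha : D.Admissible (toTraj y)) (hy : D.cost θ κ (toTraj y) ≤ D.cost θ κ (toTraj ζ.1)) :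
    y = ζ.1 := by
  have hw : IsTraj I (toTraj y) := isTraj_toTraj le_top y
  have hd : IsTraj I (toTraj y - toTraj ζ.1) := by
    have h1 := hw.add ((isTraj_toTraj le_top ζ.1).const_smul (-1))
    rwa [neg_one_smul, ← sub_eq_add_neg] at h1
  have h1 := h.cost_eq hθ hw ha
  obtain ⟨h2, h3, h4⟩ := hD.eq_zero hd (ha.sub h.admissible) (by linarith)
  refine Prod.ext (W1.eq_of_val fun t ht => ?_) (Prod.ext (Lp.ext ?_) (sub_eq_zero.1 h4))
  · exact sub_eq_zero.1 (eq_zero_of_ae_eq_zero (y.1 - ζ.1.1).continuous_val h2 ht)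
  · filter_upwards [h3] with t ht using sub_eq_zero.1 ht

/-- The costate is determined by the stationarity of the Lagrangian. -/
theorem System.costate_unique {μ : W1 I ∞ nx}
    (hμ : ∀ η : YSpace I 2 nx nu np, (toTraj η).1 I.t0 = 0 →
      D.bil (toTraj ζ.1) (toTraj η) + D.lin θ κ (toTraj η) + D.res μ.val (toTraj η) = 0) :
    μ = ζ.2 := by
  refine W1.eq_of_val fun t ht => sub_eq_zero.1 ?_
  refine costate_eq_zero (D := D) (μ - ζ.2) (fun w hw hw0 => ?_) ht
  obtain ⟨η, h1, h2, -, h4⟩ := hw.exists_toTraj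
  have hη := isTraj_toTraj le_rfl η
  have hη0 : (toTraj η).1 I.t0 = 0 := h4.trans hw0
  have h5 := hμ η hη0
  have h6 := h.weak hθ hη
  rw [hη0, inner_zero_right] at h6
  rw [← res_congr h1 h2, ← sub_eq_zero.2 (add_left_cancel (h5.trans h6.symm)), res, res, res,
    ← integral_sub (integrable_res (μ.memLp_val 2) hη) (integrable_res (ζ.2.memLp_val 2) hη)]
  simp only [W1.val_sub, inner_sub_left]

/-- Duality: the linear functional that defines the adjoint solution `ζ`, evaluated at the solution
of the system with data `(r, θ')`, is a functional of these data that involves `ζ` only. -/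
theorem System.lin_eq {r : ℝ → Rn nx} {θ' : ℝ → Yn nx nu np →L[ℝ] ℝ} {ξ : ZSpace I nx nu np}
    (h' : D.System r 0 θ' 0 ξ) (hθ' : MemLp θ' ∞ I.vol) :
    D.lin θ κ (toTraj ξ.1)
      = ∫ t, θ' t (curve ζ.1 t) ∂I.vol + ∫ t, ⟪ζ.2.val t, r t⟫_ℝ ∂I.vol := by
  have h1 := h.weak hθ (isTraj_toTraj le_top ξ.1)
  have h2 := h'.weak hθ' (isTraj_toTraj le_top ζ.1)
  have h3 : (toTraj ξ.1).1 I.t0 = 0 := h'.init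
  have h4 : D.res ζ.2.val (toTraj ξ.1) = -∫ t, ⟪ζ.2.val t, r t⟫_ℝ ∂I.vol := by
    rw [← integral_neg]
    refine integral_congr_ae ?_
    filter_upwards [h'.state] with t ht
    have h5 : (toTraj ξ.1).2.1 t = D.dyn t (curveT (toTraj ξ.1) t) + r t := ht
    rw [h5, sub_add_cancel_left, inner_neg_right]
  have h5 : D.lin θ' 0 (toTraj ζ.1) = ∫ t, θ' t (curve ζ.1 t) ∂I.vol := add_zero _
  rw [h3, inner_zero_right, h4] at h1
  rw [h.admissible.res_eq_zero, h.admissible.2, inner_zero_right, h5,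
    bil_comm (toTraj ξ.1) (toTraj ζ.1)] at h2
  linarith

end Optimality

end LQModel

/-! ### The adjoint system and its linear-quadratic problem -/

section AdjointLQ

variable {nx nu np ng : ℕ} {P : Bolza nx nu np ng} {Q : QoI nx nu np ng}
  (g : GSpace P.I 3 nx nu np ng) (z : ZSpace P.I nx nu np)

theorem coefABC_apply (g : ℝ → Yn nx nu np → Rn ng) (t : ℝ) (v : Yn nx nu np) :
    coefA P g z.1 t v.1 + coefB P g z.1 t v.2.1 + coefC P g z.1 t v.2.2 = dynAt P g z t v := by
  rw [coefA, coefB, coefC, fTot_eq, fTot_eq, fTot_eq]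
  exact (clm_Yn_apply (dynAt P g z t) v).symm

/-- The rows of the Hessian of the terminal cost. -/
theorem endHess_row {n : ℕ} (hφ : ContDiff ℝ 2 P.φ) (ι : Rn n →L[ℝ] Rn nx × Rn np)
    (v : Rn nx × Rn np) :
    phess ι (ContinuousLinearMap.inl ℝ _ _) P.φ (endPt P z.1) v.1
      + phess ι (ContinuousLinearMap.inr ℝ _ _) P.φ (endPt P z.1) v.2
      = rz ι (fderiv ℝ (fderiv ℝ P.φ) (endPt P z.1) v) := by
  have h : DifferentiableAt ℝ (fderiv ℝ P.φ) (endPt P z.1) :=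
    (hφ.fderiv_right (m := 1) (by norm_num)).differentiable one_ne_zero _
  rw [phess_apply _ _ h, phess_apply _ _ h, ← map_add, ← map_add]
  simp

theorem endQuadForm_eq (hφ : ContDiff ℝ 2 P.φ) (v : Rn nx × Rn np) :
    endQuadForm P z v = fderiv ℝ (fderiv ℝ P.φ) (endPt P z.1) v v := by
  rw [endQuadForm, φxx, φxp, φpx, φpp, endHess_row z hφ, endHess_row z hφ, real_inner_comm,
    inner_rz, real_inner_comm, inner_rz, ← map_add]
  simp

variable (hl : StrongSmooth P.I P.l) (hf : StrongSmooth P.I P.f)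
include hl hf

/-- The rows of the block matrix `(H_{ab})`. -/
theorem coefH_row : ∀ᵐ t ∂P.I.vol, ∀ {m : ℕ} (ιa : Rn m →L[ℝ] Yn nx nu np) (v : Yn nx nu np),
    coefH P g.fn z ιa ιx t v.1 + coefH P g.fn z ιa ιu t v.2.1 + coefH P g.fn z ιa ιp t v.2.2
      = rz ιa (hessAt P g.fn z t v) := by
  filter_upwards [coefH_eq (z := z) hl hf g.contDiff] with t ht m ιa v
  rw [ht, ht, ht, clm_Yn_apply (hessAt P g.fn z t) v, map_add, map_add]
  rfl

theorem quadForm_eq : ∀ᵐ t ∂P.I.vol, ∀ v, quadForm P g.fn z t v = hessAt P g.fn z t v v := by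
  filter_upwards [coefH_row g z hl hf] with t ht v
  rw [quadForm, ht, ht, ht, real_inner_comm, inner_rz, real_inner_comm, inner_rz, real_inner_comm,
    inner_rz, ← clm_Yn_apply]

theorem memLp_coefH_apply {m n : ℕ} (ιa : Rn m →L[ℝ] Yn nx nu np) (ιb : Rn n →L[ℝ] Yn nx nu np)
    {v : ℝ → Rn n} (hv : MemLp v ∞ P.I.vol) :
    MemLp (fun t => coefH P g.fn z ιa ιb t (v t)) ∞ P.I.vol := by
  have h1 : MemLp (fun t => hessAt P g.fn z t (ιb (v t))) ∞ P.I.vol :=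
    memLp_clm_apply (E := Yn nx nu np) (F := Yn nx nu np →L[ℝ] ℝ) (q := ∞) ∞
      (memLp_hessAt g z hl hf) (memLp_map ιb hv)
  refine (memLp_congr_ae ?_).1 (memLp_map (rz ιa) h1)
  filter_upwards [coefH_eq (z := z) hl hf g.contDiff] with t ht
  rw [ht]
  rfl

theorem memLp_coefH {m n : ℕ} (ιa : Rn m →L[ℝ] Yn nx nu np) (ιb : Rn n →L[ℝ] Yn nx nu np) :
    MemLp (coefH P g.fn z ιa ιb) ∞ P.I.vol := by
  have h1 : MemLp (fun t => (hessAt P g.fn z t).comp ιb) ∞ P.I.vol :=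
    memLp_top_clm_comp (E := Rn n) (F := Yn nx nu np) (G := Yn nx nu np →L[ℝ] ℝ)
      (memLp_hessAt g z hl hf) (memLp_const ιb)
  have h2 : MemLp (fun t => (rz ιa).comp ((hessAt P g.fn z t).comp ιb)) ∞ P.I.vol :=
    memLp_top_clm_comp (E := Rn n) (F := Yn nx nu np →L[ℝ] ℝ) (G := Rn m) (memLp_const (rz ιa)) h1
  refine (memLp_congr_ae ?_).1 h2
  filter_upwards [coefH_eq (z := z) hl hf g.contDiff] with t ht
  rw [ht]

omit hl in
theorem memLp_adjoint_fTot {n : ℕ} (ι : Rn n →L[ℝ] Yn nx nu np) {v : ℝ → Rn nx}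
    (hv : MemLp v ∞ P.I.vol) :
    MemLp (fun t => adjoint (fTot P g.fn z.1 ι t) (v t)) ∞ P.I.vol := by
  refine (memLp_congr_ae (Eventually.of_forall fun t => ?_)).1 (memLp_map (rz ι)
    (memLp_pairL (W := Yn nx nu np) hv (memLp_dynAt g z hf)))
  rw [fTot_eq, adjoint_comp_eq_rz]

variable (hφ : ContDiff ℝ 2 P.φ)

/-- The `a`-component of the gradient of the Lagrangian of the linear-quadratic problem, for
`a ∈ {x, u, p}`. -/
theorem rz_grad (L : ℝ → Yn nx nu np × Rn ng → ℝ) (ζ : ZSpace P.I nx nu np) :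
    ∀ᵐ t ∂P.I.vol, ∀ {m : ℕ} (ι : Rn m →L[ℝ] Yn nx nu np),
      rz ι ((lqModel g z hl hf hφ).grad ζ t + totD P g.fn z L t)
        = coefH P g.fn z ι ιx t (ζ.1.1.val t) + coefH P g.fn z ι ιu t (ζ.1.2.1 t)
          + coefH P g.fn z ι ιp t ζ.1.2.2 + adjoint (fTot P g.fn z.1 ι t) (ζ.2.val t)
          + gradTot P g.fn z.1 L ι t := by
  filter_upwards [coefH_row g z hl hf] with t ht m ι
  have h1 := ht ι (curve ζ.1 t)
  have h2 : (lqModel g z hl hf hφ).grad ζ t = hessAt P g.fn z t (curve ζ.1 t)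
    + pairL (W := Yn nx nu np) (ζ.2.val t) (dynAt P g.fn z t) := rfl
  rw [fTot_eq, adjoint_comp_eq_rz, gradTot_eq (z := z), h2, map_add, map_add, ← h1]
  rfl

/-- The adjoint system is the optimality system of the linear-quadratic model whose linear cost is
the derivative of the quantity of interest. -/
theorem adjointSystem_iff (hℓ : StrongSmooth P.I Q.ℓ) (ζ : ZSpace P.I nx nu np) :
    AdjointSystem P Q g.fn z ζ ↔ (lqModel g z hl hf hφ).System (fun _ => 0) 0
      (totD P g.fn z Q.ℓ) (fderiv ℝ Q.ϕ (endPt P z.1)) ζ := by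
  have hrow := rz_grad g z hl hf hφ Q.ℓ ζ
  have hstate : ∀ t, coefA P g.fn z.1 t (ζ.1.1.val t) + coefB P g.fn z.1 t (ζ.1.2.1 t)
      + coefC P g.fn z.1 t ζ.1.2.2 = (lqModel g z hl hf hφ).dyn t (curve ζ.1 t) + 0 := by
    intro t
    rw [add_zero]
    exact coefABC_apply z g.fn t (curve ζ.1 t)
  have hend : ∀ {n : ℕ} (ι : Rn n →L[ℝ] Rn nx × Rn np),
      rz ι ((lqModel g z hl hf hφ).endHess (endT P.I (toTraj ζ.1)) + fderiv ℝ Q.ϕ (endPt P z.1))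
        = phess ι (ContinuousLinearMap.inl ℝ _ _) P.φ (endPt P z.1) (ζ.1.1.val P.I.tf)
          + phess ι (ContinuousLinearMap.inr ℝ _ _) P.φ (endPt P z.1) ζ.1.2.2
          + pgrad ι Q.ϕ (endPt P z.1) := by
    intro n ι
    rw [map_add]
    exact congrArg (· + _) (endHess_row z hφ ι (endT P.I (toTraj ζ.1))).symm
  have hx : MemLp ζ.1.1.val ∞ P.I.vol := ζ.1.1.memLp_val ∞
  have hu : MemLp (fun t => ζ.1.2.1 t) ∞ P.I.vol := Lp.memLp ζ.1.2.1
  have hi1 : Integrable (fun t => coefH P g.fn z ιp ιx t (ζ.1.1.val t)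
      + coefH P g.fn z ιp ιu t (ζ.1.2.1 t) + adjoint (coefC P g.fn z.1 t) (ζ.2.val t)) P.I.vol :=
    (((memLp_coefH_apply g z hl hf ιp ιx hx).add (memLp_coefH_apply g z hl hf ιp ιu hu)).add
      (memLp_adjoint_fTot g z hf ιp (ζ.2.memLp_val ∞))).integrable le_top
  have hi2 : Integrable (coefH P g.fn z ιp ιp) P.I.vol :=
    (memLp_coefH g z hl hf ιp ιp).integrable le_top
  have hi3 : Integrable (gradTot P g.fn z.1 Q.ℓ ιp) P.I.vol := by
    refine ((memLp_congr_ae (Eventually.of_forall fun t => ?_)).1 (memLp_map (rz ιp)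
      (memLp_totD g z hℓ))).integrable le_top
    rw [gradTot_eq (z := z)]
  have hi4 : Integrable (fun t => coefH P g.fn z ιp ιp t ζ.1.2.2) P.I.vol :=
    hi2.apply_continuousLinearMap ζ.1.2.2
  have hparam : ∫ t, rz ιp ((lqModel g z hl hf hφ).grad ζ t + totD P g.fn z Q.ℓ t) ∂P.I.vol
      = ∫ t, (coefH P g.fn z ιp ιx t (ζ.1.1.val t) + coefH P g.fn z ιp ιu t (ζ.1.2.1 t)
          + adjoint (coefC P g.fn z.1 t) (ζ.2.val t)) ∂P.I.vol
        + (∫ t, coefH P g.fn z ιp ιp t ∂P.I.vol) ζ.1.2.2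
        + ∫ t, gradTot P g.fn z.1 Q.ℓ ιp t ∂P.I.vol := by
    have hi5 : Integrable (fun t => coefH P g.fn z ιp ιx t (ζ.1.1.val t)
      + coefH P g.fn z ιp ιu t (ζ.1.2.1 t) + adjoint (coefC P g.fn z.1 t) (ζ.2.val t)
      + coefH P g.fn z ιp ιp t ζ.1.2.2) P.I.vol := hi1.add hi4
    rw [ContinuousLinearMap.integral_apply hi2, ← integral_add hi1 hi4, ← integral_add hi5 hi3]
    refine integral_congr_ae ?_
    filter_upwards [hrow] with t ht
    rw [ht, coefC]
    abel
  have key : AdjointSystem P Q g.fn z ζ ↔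
      (∀ᵐ t ∂P.I.vol, ζ.1.1.der t = (lqModel g z hl hf hφ).dyn t (curve ζ.1 t) + 0) ∧
      ζ.1.1.val P.I.t0 = 0 ∧
      (∀ᵐ t ∂P.I.vol, ζ.2.der t
        = -rz ιx ((lqModel g z hl hf hφ).grad ζ t + totD P g.fn z Q.ℓ t)) ∧
      ζ.2.val P.I.tf = rz (ContinuousLinearMap.inl ℝ _ _)
        ((lqModel g z hl hf hφ).endHess (endT P.I (toTraj ζ.1)) + fderiv ℝ Q.ϕ (endPt P z.1)) ∧
      (∀ᵐ t ∂P.I.vol, rz ιu ((lqModel g z hl hf hφ).grad ζ t + totD P g.fn z Q.ℓ t) = 0) ∧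
      rz (ContinuousLinearMap.inr ℝ _ _)
        ((lqModel g z hl hf hφ).endHess (endT P.I (toTraj ζ.1)) + fderiv ℝ Q.ϕ (endPt P z.1))
        + ∫ t, rz ιp ((lqModel g z hl hf hφ).grad ζ t + totD P g.fn z Q.ℓ t) ∂P.I.vol = 0 := by
    rw [AdjointSystem]
    refine and_congr (eventually_congr (Eventually.of_forall fun t => ?_)) (and_congr Iff.rfl
      (and_congr (eventually_congr (hrow.mono fun t ht => ?_)) (and_congr ?_
        (and_congr (eventually_congr (hrow.mono fun t ht => ?_)) ?_))))
    · rw [hstate]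
    · rw [ht, coefA]
      refine Eq.congr_right ?_
      abel
    · rw [hend]
      refine Eq.congr_right ?_
      rw [φxx, φxp, endGradx]
      abel
    · rw [ht, ← coefB, eq_neg_iff_add_eq_zero]
    · rw [hend, hparam, φpx, φpp, endGradp, ← sub_eq_zero]
      refine Eq.congr_left ?_
      abel
  rw [key]
  exact ⟨fun ⟨h1, h2, h3, h4, h5, h6⟩ => ⟨h1, h2, h3, h4, h5, h6⟩,
    fun h => ⟨h.state, h.init, h.costate, h.term, h.ctrl, h.param⟩⟩

theorem lqCost_eq (hℓ : StrongSmooth P.I Q.ℓ) {w : Traj nx nu np} (hw : IsTraj P.I w) :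
    lqCost P g.fn z (adjointData P Q g.fn z) w = (lqModel g z hl hf hφ).cost
      (totD P g.fn z Q.ℓ) (fderiv ℝ Q.ϕ (endPt P z.1)) w := by
  have hθ := memLp_totD g z hℓ
  have hi1 : Integrable (fun t => rz ιp (totD P g.fn z Q.ℓ t)) P.I.vol :=
    (memLp_map (rz ιp) hθ).integrable le_top
  have hi2 : Integrable (fun t => ⟪rz ιp (totD P g.fn z Q.ℓ t), w.2.2.2⟫_ℝ) P.I.vol :=
    hi1.inner_const (𝕜 := ℝ) w.2.2.2
  have hi3 : Integrable (fun t => totD P g.fn z Q.ℓ t (curveT w t)) P.I.vol :=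
    LQModel.integrable_apply (hθ.mono_exponent le_top) hw
  have h1 : ∫ t, quadForm P g.fn z t (w.1 t, w.2.2.1 t, w.2.2.2) ∂P.I.vol
      = ∫ t, hessAt P g.fn z t (curveT w t) (curveT w t) ∂P.I.vol := by
    refine integral_congr_ae ?_
    filter_upwards [quadForm_eq g z hl hf] with t ht using ht _
  have h2 : ∫ t, (⟪gradTot P g.fn z.1 Q.ℓ ιx t, w.1 t⟫_ℝ
        + ⟪gradTot P g.fn z.1 Q.ℓ ιu t, w.2.2.1 t⟫_ℝ) ∂P.I.vol
      = ∫ t, totD P g.fn z Q.ℓ t (curveT w t) ∂P.I.vol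
        - ⟪∫ t, gradTot P g.fn z.1 Q.ℓ ιp t ∂P.I.vol, w.2.2.2⟫_ℝ := by
    simp only [gradTot_eq (z := z)]
    rw [← integral_inner_const hi1, ← integral_sub hi3 hi2]
    refine integral_congr_ae (Eventually.of_forall fun t => ?_)
    have h3 := clm_Yn_apply (totD P g.fn z Q.ℓ t) (curveT w t)
    simp only [inner_rz]
    rw [h3]
    simp only [curveT]
    ring
  have h3 : (fderiv ℝ Q.ϕ (endPt P z.1)) (endT P.I w)
      = ⟪endGradx P z.1 Q.ϕ, w.1 P.I.tf⟫_ℝ + ⟪endGradp P z.1 Q.ϕ, w.2.2.2⟫_ℝ := by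
    rw [endGradx, endGradp, pgrad_eq_rz, pgrad_eq_rz, inner_rz, inner_rz, ← map_add]
    simp [endT]
  have h4 : (lqModel g z hl hf hφ).bil w w
      = ∫ t, hessAt P g.fn z t (curveT w t) (curveT w t) ∂P.I.vol
        + fderiv ℝ (fderiv ℝ P.φ) (endPt P z.1) (endT P.I w) (endT P.I w) := rfl
  rw [lqCost, LQModel.cost, LQModel.lin, h4, h1, h3, endQuadForm_eq z hφ]
  simp only [adjointData, inner_add_left]
  rw [h2]
  simp only [endT]
  ring

theorem lqFeasible_iff {c : LQData nx nu np} (hr : c.r = 0) (h0 : c.r0 = 0) (w : Traj nx nu np) :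
    LQFeasible P g.fn z c w ↔ (lqModel g z hl hf hφ).Admissible w := by
  have h1 : ∀ t, lqRhs P g.fn z c w t = (lqModel g z hl hf hφ).dyn t (curveT w t) := by
    intro t
    rw [lqRhs, hr, Pi.zero_apply, add_zero]
    exact coefABC_apply z g.fn t (curveT w t)
  simp only [LQFeasible, LQModel.Admissible, h1, h0]

theorem SSOC.coercive (h : SSOC P g.fn z) : (lqModel g z hl hf hφ).Coercive := by
  obtain ⟨h1, ⟨ε, hε, h2⟩, -⟩ := h
  refine ⟨fun v => (h1 v).trans_eq (endQuadForm_eq z hφ v), ε, hε, fun w hw ha => ?_⟩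
  obtain ⟨η, k1, k2, k3, k4⟩ := hw.exists_toTraj
  have h3 := h2 η ((lqFeasible_iff g z hl hf hφ rfl rfl _).2 (ha.congr k1 k2 k4))
  have h4 : ∫ t, ‖η.1.val t‖ ^ 2 ∂P.I.vol = ∫ t, ‖w.1 t‖ ^ 2 ∂P.I.vol := by
    refine integral_congr_ae ?_
    filter_upwards [k1] with t ht
    rw [show η.1.val t = w.1 t from congrArg Prod.fst ht]
  have h5 : ∫ t, ‖η.2.1 t‖ ^ 2 ∂P.I.vol = ∫ t, ‖w.2.2.1 t‖ ^ 2 ∂P.I.vol := by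
    refine integral_congr_ae ?_
    filter_upwards [k1] with t ht
    rw [show η.2.1 t = w.2.2.1 t from congrArg (fun v => v.2.1) ht]
  have h6 : η.2.2 = w.2.2.2 := congrArg Prod.snd k3
  have h7 : ∫ t, quadForm P g.fn z t (curve η t) ∂P.I.vol
      = ∫ t, hessAt P g.fn z t (curveT w t) (curveT w t) ∂P.I.vol := by
    refine integral_congr_ae ?_
    filter_upwards [quadForm_eq g z hl hf, k1] with t ht k
    rw [ht, show curve η t = curveT w t from k]
  rw [h4, h5, h6, h7] at h3
  exact h3

theorem SSOC.controlInvertible (h : SSOC P g.fn z) :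
    (lqModel g z hl hf hφ).ControlInvertible := by
  obtain ⟨-, -, M, -, hM⟩ := h
  refine ⟨M, ?_⟩
  filter_upwards [hM, coefH_eq (z := z) hl hf g.contDiff] with t ⟨T, h1, h2, h3⟩ h4
  rw [h4] at h1 h2
  exact ⟨T, h1, h2, h3⟩

end AdjointLQ

/-! ### The adjoint representation of the derivative -/

section Equivalence

theorem integrable_apply_curve {I : TimeInterval} {nx nu np : ℕ}
    {θ : ℝ → Yn nx nu np →L[ℝ] ℝ} (hθ : MemLp θ ∞ I.vol) (y : YSpace I ∞ nx nu np) :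
    Integrable (fun t => θ t (curve y t)) I.vol :=
  LQModel.integrable_apply (hθ.mono_exponent le_top) (isTraj_toTraj le_top y)

variable {nx nu np ng : ℕ} {P : Bolza nx nu np ng} {Q : QoI nx nu np ng}
  {g : GSpace P.I 3 nx nu np ng} {z : ZSpace P.I nx nu np}
  (hl : StrongSmooth P.I P.l) (hf : StrongSmooth P.I P.f) (hφ : ContDiff ℝ 2 P.φ)
  (hℓ : StrongSmooth P.I Q.ℓ)
include hl hf hφ hℓ

/-- The derivative of the Lagrangian of the linear-quadratic problem. -/
theorem hasDerivAt_lqLagrangian (y : YSpace P.I ∞ nx nu np) (μ : W1 P.I ∞ nx) (μ₀ : Rn nx)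
    (η : YSpace P.I 2 nx nu np) :
    HasDerivAt (fun s : ℝ => lqLagrangian P g.fn z (adjointData P Q g.fn z) μ.val μ₀
        (toTraj y + s • toTraj η))
      ((lqModel g z hl hf hφ).bil (toTraj y) (toTraj η)
        + (lqModel g z hl hf hφ).lin (totD P g.fn z Q.ℓ) (fderiv ℝ Q.ϕ (endPt P z.1)) (toTraj η)
        + (lqModel g z hl hf hφ).res μ.val (toTraj η) - ⟪μ₀, (toTraj η).1 P.I.t0⟫_ℝ) 0 := by
  have hy : IsTraj P.I (toTraj y) := isTraj_toTraj le_top y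
  have hη : IsTraj P.I (toTraj η) := isTraj_toTraj le_rfl η
  have h1 := (lqModel g z hl hf hφ).hasDerivAt_lagrangian (κ := fderiv ℝ Q.ϕ (endPt P z.1))
    (memLp_totD g z hℓ) (μ.memLp_val 2) μ₀ hy hη
  refine h1.congr_of_eventuallyEq (Eventually.of_forall fun s => ?_)
  have h2 : ∀ w : Traj nx nu np, ∀ t, lqRhs P g.fn z (adjointData P Q g.fn z) w t
      = (lqModel g z hl hf hφ).dyn t (curveT w t) := by
    intro w t
    refine (add_zero _).trans ?_
    exact coefABC_apply z g.fn t (curveT w t)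
  simp only [lqLagrangian, lqCost_eq g z hl hf hφ hℓ (hy.add (hη.const_smul s)), h2]
  rfl

theorem AdjointSystem.isLQSolution (hS : SSOC P g.fn z) {ζ : ZSpace P.I nx nu np}
    (h : AdjointSystem P Q g.fn z ζ) :
    IsLQSolution P g.fn z (adjointData P Q g.fn z) ζ.1 := by
  have hs := (adjointSystem_iff g z hl hf hφ hℓ ζ).1 h
  refine ⟨(lqFeasible_iff g z hl hf hφ rfl rfl _).2 hs.admissible, fun y' hy' => ?_⟩
  have hw : IsTraj P.I (toTraj y') := isTraj_toTraj le_rfl y'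
  rw [lqCost_eq g z hl hf hφ hℓ (isTraj_toTraj le_top ζ.1), lqCost_eq g z hl hf hφ hℓ hw]
  exact hs.cost_le (memLp_totD g z hℓ) (SSOC.coercive g z hl hf hφ hS) hw
    ((lqFeasible_iff g z hl hf hφ rfl rfl _).1 hy')

theorem AdjointSystem.isLQCostate {ζ : ZSpace P.I nx nu np} (h : AdjointSystem P Q g.fn z ζ) :
    IsLQCostate P g.fn z (adjointData P Q g.fn z) ζ.1 ζ.2 := by
  have hs := (adjointSystem_iff g z hl hf hφ hℓ ζ).1 h
  refine ⟨ζ.2.val P.I.t0, fun η => ?_⟩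
  have h1 := hasDerivAt_lqLagrangian (Q := Q) hl hf hφ hℓ (z := z) (g := g) ζ.1 ζ.2
    (ζ.2.val P.I.t0) η
  rwa [hs.weak (memLp_totD g z hℓ) (isTraj_toTraj le_rfl η), sub_self] at h1

theorem IsLQSolution.eq (hS : SSOC P g.fn z) {ζ : ZSpace P.I nx nu np}
    (h : AdjointSystem P Q g.fn z ζ) {y : YSpace P.I ∞ nx nu np}
    (hy : IsLQSolution P g.fn z (adjointData P Q g.fn z) y) : y = ζ.1 := by
  have hs := (adjointSystem_iff g z hl hf hφ hℓ ζ).1 h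
  refine hs.eq_of_cost_le (memLp_totD g z hℓ) (SSOC.coercive g z hl hf hφ hS)
    ((lqFeasible_iff g z hl hf hφ rfl rfl _).1 hy.1) ?_
  have hζ : IsTraj P.I (toTraj ζ.1) := isTraj_toTraj le_top ζ.1
  obtain ⟨y', h1, h2, h3, h4⟩ := hζ.exists_toTraj
  have h5 := hy.2 y' ((lqFeasible_iff g z hl hf hφ rfl rfl _).2 (hs.admissible.congr h1 h2 h4))
  rwa [lqCost_eq g z hl hf hφ hℓ (isTraj_toTraj le_top y),
    lqCost_eq g z hl hf hφ hℓ (isTraj_toTraj le_rfl y'), LQModel.cost_congr h1 h3] at h5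

theorem IsLQCostate.eq {ζ : ZSpace P.I nx nu np} (h : AdjointSystem P Q g.fn z ζ)
    {μ : W1 P.I ∞ nx} (hμ : IsLQCostate P g.fn z (adjointData P Q g.fn z) ζ.1 μ) : μ = ζ.2 := by
  have hs := (adjointSystem_iff g z hl hf hφ hℓ ζ).1 h
  obtain ⟨μ₀, hμ⟩ := hμ
  refine hs.costate_unique (memLp_totD g z hℓ) fun η hη => ?_
  have h1 := (hasDerivAt_lqLagrangian (Q := Q) hl hf hφ hℓ (z := z) (g := g) ζ.1 μ μ₀ η).unique
    (hμ η)
  rwa [hη, inner_zero_right, sub_zero] at h1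

omit hl hf hφ hℓ in
theorem varD_apply (δg : ℝ → Yn nx nu np → Rn ng) (t : ℝ) (v : Yn nx nu np) :
    varD P g.fn z δg t v
      = hamD2 P g.fn z t (ιg (δg t (curve z.1 t))) (lift P g.fn z t v)
        + hamD P g.fn z t (ιg (fderiv ℝ (δg t) (curve z.1 t) v)) := rfl

omit hφ hℓ in
theorem integrable_hamD_fderiv (δg : GSpace P.I 3 nx nu np ng) (y : YSpace P.I ∞ nx nu np) :
    Integrable (fun t => hamD P g.fn z t
      (ιg (fderiv ℝ (δg.fn t) (curve z.1 t) (curve y t)))) P.I.vol := by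
  have h1 : MemLp (fun t => (hamD P g.fn z t).comp (ιg (nx := nx) (nu := nu) (np := np))) ∞
      P.I.vol :=
    memLp_top_clm_comp (E := Rn ng) (F := Yn nx nu np × Rn ng) (G := ℝ) (memLp_hamD g z hl hf)
      (memLp_const ιg)
  have h2 : MemLp (fun t => ((hamD P g.fn z t).comp ιg).comp
      (fderiv ℝ (δg.fn t) (curve z.1 t))) ∞ P.I.vol :=
    memLp_top_clm_comp (E := Yn nx nu np) (F := Rn ng) (G := ℝ) h1
      (δg.memLp_fderiv (memLp_curve z.1))
  exact integrable_apply_curve h2 y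

omit hl hf hφ hℓ in
theorem memLp_ιg_apply (δg : GSpace P.I 3 nx nu np ng) :
    MemLp (fun t => (ιg (δg.fn t (curve z.1 t)) : Yn nx nu np × Rn ng)) ∞ P.I.vol :=
  memLp_map (E := Rn ng) (F := Yn nx nu np × Rn ng) ιg (δg.memLp (memLp_curve z.1))

omit hl hφ hℓ in
theorem integrable_inner_fg (δg : GSpace P.I 3 nx nu np ng) {μ : ℝ → Rn nx}
    (hμ : MemLp μ ∞ P.I.vol) :
    Integrable (fun t => ⟪μ t, fg P g.fn z.1 t (δg.fn t (curve z.1 t))⟫_ℝ) P.I.vol := by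
  have h1 : MemLp (fun t => fg P g.fn z.1 t (δg.fn t (curve z.1 t))) ∞ P.I.vol :=
    memLp_clm_apply (E := Yn nx nu np × Rn ng) (F := Rn nx) (q := ∞) ∞
      (hf.memLp_fderiv (memLp_pt g z)) (memLp_ιg_apply δg)
  exact ((ipL nx).memLp_of_bilin ∞ hμ h1).integrable le_top

omit hl hf hφ in
theorem integrable_fderiv_ιg (δg : GSpace P.I 3 nx nu np ng) :
    Integrable (fun t => fderiv ℝ (Q.ℓ t) (pt P g.fn z.1 t) (ιg (δg.fn t (curve z.1 t))))
      P.I.vol :=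
  (memLp_clm_apply (E := Yn nx nu np × Rn ng) (F := ℝ) (q := ∞) ∞
    (hℓ.memLp_fderiv (memLp_pt g z)) (memLp_ιg_apply δg)).integrable le_top

omit hφ hℓ in
theorem coefHg_row : ∀ᵐ t ∂P.I.vol, ∀ (v : Yn nx nu np) (c : Rn ng),
    ⟪coefHg P g.fn z ιx t v.1 + coefHg P g.fn z ιu t v.2.1 + coefHg P g.fn z ιp t v.2.2, c⟫_ℝ
      = hamD2 P g.fn z t (ιg c) (lift P g.fn z t v) := by
  filter_upwards [coefHg_eq (g := g.fn) (z := z) hl hf,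
    hamD2_symm (g := g.fn) (z := z) hl hf] with t h1 h2 v c
  have h3 : lift P g.fn z t v
      = lift P g.fn z t (ιx v.1) + lift P g.fn z t (ιu v.2.1) + lift P g.fn z t (ιp v.2.2) :=
    clm_Yn_apply (lift P g.fn z t) v
  rw [h1, h1, h1, inner_add_left, inner_add_left, inner_rz, inner_rz, inner_rz, h3, map_add,
    map_add, h2 (ιg c), h2 (ιg c), h2 (ιg c)]

omit hφ hℓ in
theorem coefd_row (δg : ℝ → Yn nx nu np → Rn ng) : ∀ᵐ t ∂P.I.vol, ∀ v : Yn nx nu np,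
    ⟪coefd P g.fn z t, gjac P δg z.1 ιx t v.1⟫_ℝ + ⟪coefd P g.fn z t, gjac P δg z.1 ιu t v.2.1⟫_ℝ
      + ⟪coefd P g.fn z t, gjac P δg z.1 ιp t v.2.2⟫_ℝ
      = hamD P g.fn z t (ιg (fderiv ℝ (δg t) (curve z.1 t) v)) := by
  filter_upwards [coefd_eq (g := g.fn) (z := z) hl hf] with t h1 v
  have h3 : fderiv ℝ (δg t) (curve z.1 t) v = gjac P δg z.1 ιx t v.1 + gjac P δg z.1 ιu t v.2.1
      + gjac P δg z.1 ιp t v.2.2 := clm_Yn_apply (fderiv ℝ (δg t) (curve z.1 t)) v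
  rw [h1, ← inner_add_right, ← inner_add_right, ← h3, inner_rz]

/-- The derivative of the quantity of interest along a solution `ξ` of the linearized optimality
system, in terms of the adjoint solution. -/
theorem adjointExpr_eq {ζ ξ : ZSpace P.I nx nu np} (h : AdjointSystem P Q g.fn z ζ)
    {δg : GSpace P.I 3 nx nu np ng}
    (hξ : (lqModel g z hl hf hφ).System (fun t => fg P g.fn z.1 t (δg.fn t (curve z.1 t))) 0
      (varD P g.fn z δg.fn) 0 ξ) :
    fderiv ℝ Q.ϕ (endPt P z.1) (endT P.I (toTraj ξ.1))
      + ∫ t, fderiv ℝ (Q.ℓ t) (pt P g.fn z.1 t)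
          (lift P g.fn z t (curve ξ.1 t) + ιg (δg.fn t (curve z.1 t))) ∂P.I.vol
      = adjointExpr P Q g.fn z ζ δg.fn := by
  have hs := (adjointSystem_iff g z hl hf hφ hℓ ζ).1 h
  have hdual := hs.lin_eq (memLp_totD g z hℓ) hξ (memLp_varD g z hl hf δg)
  have hi1 := integrable_apply_curve (memLp_totD g z hℓ) ξ.1
  have hi2 := integrable_fderiv_ιg (Q := Q) (g := g) (z := z) hℓ δg
  have hi3 := integrable_apply_curve (memLp_varD g z hl hf δg) ζ.1
  have hi4 := integrable_inner_fg (g := g) (z := z) hf δg (ζ.2.memLp_val ∞)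
  have hi5 := integrable_hamD_fderiv (g := g) (z := z) hl hf δg ζ.1
  have hI1 : ∫ t, ⟪coefHg P g.fn z ιx t (ζ.1.1.val t) + coefHg P g.fn z ιu t (ζ.1.2.1 t)
      + coefHg P g.fn z ιp t ζ.1.2.2 + adjoint (fg P g.fn z.1 t) (ζ.2.val t)
      + pgrad ιg (Q.ℓ t) (pt P g.fn z.1 t), δg.fn t (curve z.1 t)⟫_ℝ ∂P.I.vol
      = ∫ t, (varD P g.fn z δg.fn t (curve ζ.1 t)
          - hamD P g.fn z t (ιg (fderiv ℝ (δg.fn t) (curve z.1 t) (curve ζ.1 t)))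
          + ⟪ζ.2.val t, fg P g.fn z.1 t (δg.fn t (curve z.1 t))⟫_ℝ
          + fderiv ℝ (Q.ℓ t) (pt P g.fn z.1 t) (ιg (δg.fn t (curve z.1 t)))) ∂P.I.vol := by
    refine integral_congr_ae ?_
    filter_upwards [coefHg_row (g := g) (z := z) hl hf] with t h1
    have h2 := h1 (curve ζ.1 t) (δg.fn t (curve z.1 t))
    have h3 := varD_apply (P := P) (g := g) (z := z) δg.fn t (curve ζ.1 t)
    have h4 : ⟪adjoint (fg P g.fn z.1 t) (ζ.2.val t), δg.fn t (curve z.1 t)⟫_ℝ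
        = ⟪ζ.2.val t, fg P g.fn z.1 t (δg.fn t (curve z.1 t))⟫_ℝ :=
      ContinuousLinearMap.adjoint_inner_left _ _ _
    rw [inner_add_left, inner_add_left _ (adjoint (fg P g.fn z.1 t) (ζ.2.val t)), pgrad_eq_rz,
      inner_rz, h4, h3, ← h2, add_sub_cancel_right]
    rfl
  have hI2 : ∫ t, (⟪coefd P g.fn z t, gjac P δg.fn z.1 ιx t (ζ.1.1.val t)⟫_ℝ
      + ⟪coefd P g.fn z t, gjac P δg.fn z.1 ιu t (ζ.1.2.1 t)⟫_ℝ
      + ⟪coefd P g.fn z t, gjac P δg.fn z.1 ιp t ζ.1.2.2⟫_ℝ) ∂P.I.vol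
      = ∫ t, hamD P g.fn z t (ιg (fderiv ℝ (δg.fn t) (curve z.1 t) (curve ζ.1 t))) ∂P.I.vol := by
    refine integral_congr_ae ?_
    filter_upwards [coefd_row (g := g) (z := z) hl hf δg.fn] with t h1 using h1 (curve ζ.1 t)
  have hi6 : Integrable (fun t => varD P g.fn z δg.fn t (curve ζ.1 t)
      - hamD P g.fn z t (ιg (fderiv ℝ (δg.fn t) (curve z.1 t) (curve ζ.1 t)))) P.I.vol :=
    hi3.sub hi5
  have hi7 : Integrable (fun t => varD P g.fn z δg.fn t (curve ζ.1 t)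
      - hamD P g.fn z t (ιg (fderiv ℝ (δg.fn t) (curve z.1 t) (curve ζ.1 t)))
      + ⟪ζ.2.val t, fg P g.fn z.1 t (δg.fn t (curve z.1 t))⟫_ℝ) P.I.vol := hi6.add hi4
  have hlin : (lqModel g z hl hf hφ).lin (totD P g.fn z Q.ℓ) (fderiv ℝ Q.ϕ (endPt P z.1))
      (toTraj ξ.1) = ∫ t, totD P g.fn z Q.ℓ t (curve ξ.1 t) ∂P.I.vol
        + fderiv ℝ Q.ϕ (endPt P z.1) (endT P.I (toTraj ξ.1)) := rfl
  have hsplit : ∫ t, fderiv ℝ (Q.ℓ t) (pt P g.fn z.1 t)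
        (lift P g.fn z t (curve ξ.1 t) + ιg (δg.fn t (curve z.1 t))) ∂P.I.vol
      = ∫ t, totD P g.fn z Q.ℓ t (curve ξ.1 t) ∂P.I.vol
        + ∫ t, fderiv ℝ (Q.ℓ t) (pt P g.fn z.1 t) (ιg (δg.fn t (curve z.1 t))) ∂P.I.vol := by
    rw [← integral_add hi1 hi2]
    refine integral_congr_ae (Eventually.of_forall fun t => ?_)
    exact map_add _ _ _
  rw [adjointExpr, hI1, hI2, integral_add hi7 hi2, integral_add hi6 hi4, integral_sub hi3 hi5,
    hsplit]
  rw [hlin] at hdual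
  linarith

end Equivalence

/-! ### Existence and uniqueness of the adjoint solution -/

/-- The optimality system is solvable for every linear cost. -/
theorem LQModel.IsOperator.exists_system {I : TimeInterval} {nx nu np : ℕ} {D : LQModel I nx nu np}
    {L : ZSpace I nx nu np →ₗ[ℝ] RSpace I nx nu np} (hL : D.IsOperator L)
    (hs : Function.Surjective L) {θ : ℝ → Yn nx nu np →L[ℝ] ℝ} (hθ : MemLp θ ∞ I.vol)
    (κ : (Rn nx × Rn np) →L[ℝ] ℝ) : ∃ ζ, D.System (fun _ => 0) 0 θ κ ζ := by
  have hx : MemLp (fun t => -rz ιx (θ t)) ∞ I.vol := (memLp_map (rz ιx) hθ).neg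
  have hu : MemLp (fun t => -rz ιu (θ t)) ∞ I.vol := (memLp_map (rz ιu) hθ).neg
  obtain ⟨ζ, hζ⟩ := hs (0, 0, hx.toLp, rz (ContinuousLinearMap.inl ℝ _ _) κ, hu.toLp,
    -(rz (ContinuousLinearMap.inr ℝ _ _) κ + ∫ t, rz ιp (θ t) ∂I.vol))
  have h1 := hL.state ζ
  have h2 := hL.init ζ
  have h3 := hL.costate ζ
  have h4 := hL.term ζ
  have h5 := hL.ctrl ζ
  have h6 := hL.param ζ
  rw [hζ] at h1 h2 h3 h4 h5 h6
  refine ⟨ζ, ?_, h2.symm, ?_, ?_, ?_, ?_⟩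
  · filter_upwards [h1, Lp.coeFn_zero (Rn nx) ∞ I.vol] with t k1 k2
    rw [add_zero, eq_of_sub_eq_zero (k1.symm.trans k2)]
  · filter_upwards [h3, hx.coeFn_toLp] with t k1 k2
    have k3 := k1.symm.trans k2
    rw [map_add, neg_add, ← k3]
    abel
  · rw [map_add, ← sub_eq_iff_eq_add']
    exact h4.symm
  · filter_upwards [h5, hu.coeFn_toLp] with t k1 k2
    rw [map_add, k1.symm.trans k2, neg_add_cancel]
  · have i1 : Integrable (fun t => rz ιp (D.grad ζ t)) I.vol :=
      (memLp_map (rz ιp) (LQModel.memLp_grad ζ)).integrable le_top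
    have i2 : Integrable (fun t => rz ιp (θ t)) I.vol := (memLp_map (rz ιp) hθ).integrable le_top
    simp only [map_add]
    rw [integral_add i1 i2, add_add_add_comm, ← h6]
    exact neg_add_cancel _

section Quotient

variable {G Z : Type*} [SeminormedAddCommGroup G] [NormedSpace ℝ G] [NormedAddCommGroup Z]
  [NormedSpace ℝ Z]

/-- Differentiability passes from the space of classes to the seminormed space, because the quotient
map is linear and preserves the norm. -/
theorem hasFDerivAt_comp_mk {f : SeparationQuotient G → Z} {f' : SeparationQuotient G →L[ℝ] Z}
    {g : G} (h : HasFDerivAt f f' (SeparationQuotient.mk g)) :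
    HasFDerivAt (fun g => f (SeparationQuotient.mk g))
      (f'.comp (SeparationQuotient.mkCLM ℝ G)) g := by
  have h1 := hasFDerivAt_iff_isLittleO.1 h
  have h2 := h1.comp_tendsto (SeparationQuotient.continuous_mk.tendsto g)
  refine hasFDerivAt_iff_isLittleOTVS.2 (Asymptotics.isLittleOTVS_iff_isLittleO.2 ?_)
  refine (h2.norm_right.congr_right fun g' => ?_).of_norm_right
  exact SeparationQuotient.norm_mk (g' - g)

theorem continuousOn_comp_mk {f' : SeparationQuotient G → SeparationQuotient G →L[ℝ] Z}
    {N : Set (SeparationQuotient G)} (h : ContinuousOn f' N) :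
    ContinuousOn (fun g => (f' (SeparationQuotient.mk g)).comp (SeparationQuotient.mkCLM ℝ G))
      (SeparationQuotient.mk ⁻¹' N) :=
  (h.comp SeparationQuotient.continuous_mk.continuousOn fun _ hg => hg).clm_comp
    continuousOn_const

end Quotient

section Solution

variable {nx nu np ng : ℕ} {P : Bolza nx nu np ng} {Q : QoI nx nu np ng}
  {g : GSpace P.I 3 nx nu np ng} {z : ZSpace P.I nx nu np}
  (hl : StrongSmooth P.I P.l) (hf : StrongSmooth P.I P.f) (hφ : ContDiff ℝ 2 P.φ)
  (hℓ : StrongSmooth P.I Q.ℓ)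
include hl hf hφ hℓ

theorem AdjointSystem.eq (hS : SSOC P g.fn z) {ζ ζ₁ : ZSpace P.I nx nu np}
    (h : AdjointSystem P Q g.fn z ζ) (h₁ : AdjointSystem P Q g.fn z ζ₁) : ζ₁ = ζ := by
  have h1 := IsLQSolution.eq hl hf hφ hℓ hS h (AdjointSystem.isLQSolution hl hf hφ hℓ hS h₁)
  have h2 := AdjointSystem.isLQCostate hl hf hφ hℓ h₁
  rw [h1] at h2
  exact Prod.ext h1 (IsLQCostate.eq hl hf hφ hℓ h h2)

end Solution

end OCPSens

end

theorem mainTheorem4 {nx nu np ng : ℕ}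
    (P : OCPSens.Bolza nx nu np ng) (Q : OCPSens.QoI nx nu np ng)
    (hφ : ContDiff ℝ 2 P.φ)
    (hl : OCPSens.StrongSmooth P.I P.l)
    (hf : OCPSens.StrongSmooth P.I P.f)
    (hϕ : ContDiff ℝ 2 Q.ϕ)
    (hℓ : OCPSens.StrongSmooth P.I Q.ℓ)
    (gbar : OCPSens.GSpace P.I 3 nx nu np ng)
    (zbar : OCPSens.ZSpace P.I nx nu np)
    (hKKT : OCPSens.IsKKT P gbar.fn zbar)
    (hSSOC : OCPSens.SSOC P gbar.fn zbar) :
    -- the locally unique solution map `g ↦ z(g)` of the optimality system near `(gbar, zbar)`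
    ∃ (Ng : Set (OCPSens.GSpace P.I 3 nx nu np ng)) (Nz : Set (OCPSens.ZSpace P.I nx nu np))
      (z : OCPSens.GSpace P.I 3 nx nu np ng → OCPSens.ZSpace P.I nx nu np)
      (z' : OCPSens.GSpace P.I 3 nx nu np ng →
        (OCPSens.GSpace P.I 3 nx nu np ng →L[ℝ] OCPSens.ZSpace P.I nx nu np))
      (q' : OCPSens.GSpace P.I 3 nx nu np ng → (OCPSens.GSpace P.I 3 nx nu np ng →L[ℝ] ℝ))
      (ζ : OCPSens.ZSpace P.I nx nu np),
      IsOpen Ng ∧ gbar ∈ Ng ∧ IsOpen Nz ∧ zbar ∈ Nz ∧ z gbar = zbar ∧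
      (∀ g ∈ Ng, ∀ w ∈ Nz, OCPSens.IsKKT P g.fn w ↔ w = z g) ∧
      (∀ g ∈ Ng, z g ∈ Nz) ∧
      (∀ g ∈ Ng, HasFDerivAt z (z' g) g) ∧ ContinuousOn z' Ng ∧
      -- the quantity of interest along the solution map is continuously differentiable
      (∀ g ∈ Ng, HasFDerivAt (fun h => OCPSens.qoi P Q h.fn (z h).1) (q' g) g) ∧
      ContinuousOn q' Ng ∧
      -- the adjoint system has exactly one solution, and it represents the derivative at `gbar`
      (∀ ζ₁, OCPSens.AdjointSystem P Q gbar.fn zbar ζ₁ ↔ ζ₁ = ζ) ∧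
      (∀ δg, q' gbar δg = OCPSens.adjointExpr P Q gbar.fn zbar ζ δg.fn) ∧
      -- the adjoint system is the necessary and sufficient optimality system of the
      -- linear-quadratic problem
      (∀ ζ₁ : OCPSens.ZSpace P.I nx nu np,
        OCPSens.AdjointSystem P Q gbar.fn zbar ζ₁ ↔
          OCPSens.IsLQSolution P gbar.fn zbar (OCPSens.adjointData P Q gbar.fn zbar) ζ₁.1 ∧
          OCPSens.IsLQCostate P gbar.fn zbar (OCPSens.adjointData P Q gbar.fn zbar) ζ₁.1 ζ₁.2) ∧
      (∀ y : OCPSens.YSpace P.I ∞ nx nu np,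
        OCPSens.IsLQSolution P gbar.fn zbar (OCPSens.adjointData P Q gbar.fn zbar) y ↔
          ∃ μ, OCPSens.AdjointSystem P Q gbar.fn zbar (y, μ)) := by
  obtain ⟨ψ, hψ, hψ0, hψ'⟩ := OCPSens.exists_residual_mk (ng := ng) hl hf hφ
  obtain ⟨q, hq, hq0, hq'⟩ := OCPSens.exists_qoi (ng := ng) hϕ hℓ
  have hop := OCPSens.isOperator_lqModel hl hf hφ (hψ' gbar · zbar ·)
  have hbij := hop.bijective (OCPSens.SSOC.coercive gbar zbar hl hf hφ hSSOC)
    (OCPSens.SSOC.controlInvertible gbar zbar hl hf hφ hSSOC)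
  obtain ⟨Ng, Nz, z, z', hNg, hgN, hNz, hzN, hz0, hsol, hmem, hderiv, hcont, htan⟩ :=
    OCPSens.exists_implicit_solution hψ ((hψ0 gbar zbar).2 hKKT)
      (ContinuousLinearEquiv.ofBijective
        ((fderiv ℝ ψ (SeparationQuotient.mk gbar, zbar)).comp
          (ContinuousLinearMap.inr ℝ (OCPSens.GQuot P.I nx nu np ng)
            (OCPSens.ZSpace P.I nx nu np)))
        (LinearMap.ker_eq_bot.2 hbij.1) (LinearMap.range_eq_top.2 hbij.2))
      (ContinuousLinearEquiv.coe_ofBijective _ _ _).symm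
  obtain ⟨ζ, hζs⟩ := hop.exists_system hbij.2 (OCPSens.memLp_totD gbar zbar hℓ)
    (fderiv ℝ Q.ϕ (OCPSens.endPt P zbar.1))
  have hζ : OCPSens.AdjointSystem P Q gbar.fn zbar ζ :=
    (OCPSens.adjointSystem_iff gbar zbar hl hf hφ hℓ ζ).2 hζs
  have huniq : ∀ ζ₁, OCPSens.AdjointSystem P Q gbar.fn zbar ζ₁ ↔ ζ₁ = ζ := fun ζ₁ =>
    ⟨fun h => hζ.eq hl hf hφ hℓ hSSOC h, fun h => h ▸ hζ⟩
  -- the derivative of the reduced quantity of interest, on the space of classes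
  let q' : OCPSens.GQuot P.I nx nu np ng → OCPSens.GQuot P.I nx nu np ng →L[ℝ] ℝ := fun c =>
    (fderiv ℝ q (c, z c)).comp ((ContinuousLinearMap.id ℝ _).prod (z' c))
  have hq'deriv : ∀ c ∈ Ng, HasFDerivAt (fun c => q (c, z c)) (q' c) c := fun c hc =>
    ((hq.differentiable one_ne_zero (c, z c)).hasFDerivAt).comp c
      ((hasFDerivAt_id c).prodMk (hderiv c hc))
  have hq'cont : ContinuousOn q' Ng := by
    have hzc : ContinuousOn z Ng := fun c hc => (hderiv c hc).continuousAt.continuousWithinAt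
    refine ContinuousOn.clm_comp ?_ ?_
    · exact (hq.continuous_fderiv one_ne_zero).comp_continuousOn (continuousOn_id.prodMk hzc)
    · exact (ContinuousLinearMap.prodₗᵢ ℝ).continuous.comp_continuousOn
        (continuousOn_const.prodMk hcont)
  refine ⟨SeparationQuotient.mk ⁻¹' Ng, Nz, fun g => z (SeparationQuotient.mk g),
    fun g => (z' (SeparationQuotient.mk g)).comp (SeparationQuotient.mkCLM ℝ _),
    fun g => (q' (SeparationQuotient.mk g)).comp (SeparationQuotient.mkCLM ℝ _), ζ,
    hNg.preimage SeparationQuotient.continuous_mk, hgN, hNz, hzN, hz0,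
    fun g hg w hw => (hψ0 g w).symm.trans (hsol _ hg w hw), fun g hg => hmem _ hg,
    fun g hg => OCPSens.hasFDerivAt_comp_mk (hderiv _ hg), OCPSens.continuousOn_comp_mk hcont,
    fun g hg => ?_, OCPSens.continuousOn_comp_mk hq'cont, huniq, fun δg => ?_, fun ζ₁ => ?_,
    fun y => ?_⟩
  · simpa only [hq0] using OCPSens.hasFDerivAt_comp_mk (hq'deriv _ hg)
  · -- the derivative of the solution map solves the linearized optimality system
    have h1 : fderiv ℝ ψ (SeparationQuotient.mk gbar, zbar)
        (SeparationQuotient.mk δg, z' (SeparationQuotient.mk gbar) (SeparationQuotient.mk δg))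
          = 0 := by
      have h2 := DFunLike.congr_fun (htan _ hgN) (SeparationQuotient.mk δg)
      rw [hz0] at h2
      exact h2
    have h3 := OCPSens.system_of_tangent hl hf hφ (hψ' gbar δg zbar _) h1
    rw [← OCPSens.adjointExpr_eq hl hf hφ hℓ hζ h3, ← hq' gbar δg zbar, ← hz0]
    rfl
  · refine ⟨fun h => ⟨h.isLQSolution hl hf hφ hℓ hSSOC, h.isLQCostate hl hf hφ hℓ⟩, ?_⟩
    rintro ⟨h1, h2⟩
    have h3 := h1.eq hl hf hφ hℓ hSSOC hζ
    rw [h3] at h2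
    exact (huniq ζ₁).2 (Prod.ext h3 (h2.eq hl hf hφ hℓ hζ))
  · refine ⟨fun h => ⟨ζ.2, ?_⟩, fun ⟨μ, hμ⟩ => hμ.isLQSolution hl hf hφ hℓ hSSOC⟩
    rw [h.eq hl hf hφ hℓ hSSOC hζ]
    exact hζ
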